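/- **Setting.** Let $d\ge 1$, $\beta>0$, $\mathbb T^d=\mathbb R^d/\mathbb Z^d$, and let $C(\mathbb T^d)$ carry the supremum norm. For $\alpha\ge 0$ let $\|f\|_{C^\alpha}=\|f\|_\infty+[f]_\alpha$ with $$[f]_\alpha=\max_{|k|=\lfloor\alpha\rfloor}\Big(\|\partial^kf\|_\infty 1_{\{|k|>0\}}+\sup_{x\ne y}\frac{|\partial^kf(x)-\partial^kf(y)|}{|x-y|^{\alpha-\lfloor\alpha\rfloor}}\Big).$$ For a smooth dyadic partition of unity $(\varrho_j)_{j\ge-1}$ on $\mathbb R^d$ and $\gamma<0$ let $\|v\|_{C^{\gamma}}=\|v\|_{B^\gamma_{\infty,\infty}}=\sup_{j\ge-1}2^{j\gamma}\|\Delta_jv\|_{\infty}$, where $\Delta_jv=\sum_{k\in\mathbb Z^d}\varrho_j(k)\hat v(k)e^{2\pi i\langle k,\cdot\rangle}$. For vector fields the norms are taken as the maximum over the components. Let $E$ be the set of strictly positive $f\in C(\mathbb T^d)$ with $\int f=1$, let $d_H(f,g)=\log\max(f/g)-\log\min(f/g)$ be Hilbert's projective distance, and for a bounded linear operator $A$ on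 $C(\mathbb T^d)$ that preserves strict positivity let $A^\pi f=Af/\int Af$ and $\tau(A)=\sup_{f\ne g\in E}d_H(A^\pi f,A^\pi g)/d_H(f,g)$. Let $(\Omega,\mathcal F,\mathbb P,(\vartheta^z)_{z\in\mathbb Z})$ be an ergodic, invertible, measure preserving system over a probability space, and let $\varphi:\mathbb R_+\times\Omega\to\mathcal L(C(\mathbb T^d))$ be such that $(t,\omega,f)\mapsto\varphi_t(\omega)f$ is measurable, $\varphi_0(\omega)=\mathrm{Id}$ and $\varphi_{t+n}(\omega)=\varphi_t(\vartheta^n\omega)\varphi_n(\omega)$ for all $t\ge0$, $n\in\mathbb N_0$, $\omega\in\Omega$. Assume that there is a $\vartheta$-invariant set $\Omega_0$ of full probability such that for all $\omega\in\Omega_0$ and $0<S<T$: 1. there is $K(\omega)\in C((0,\infty);C(\mathbb T^d\times\mathbb T^d))$ with $\varphi_t(\omega)f(x)=\int K(\omega,t,x,y)f(y)\,dy$ for all $t>0$, $f\in C(\mathbb T^d)$, $x\in\mathbb T^d$; 2. there are $0<\gamma(\omega,S,T)\le\delta(\omega,S,T)$ with $\gamma\le K(\omega,t,x,y)\le\delta$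 for all $x,y$ and $t\in[S,T]$; 3. $\|\varphi_t(\omega)f\|_{C^\beta}\le C(\omega,S,T)\|f\|_\infty$ for all $f\in C(\mathbb T^d)$, $t\in[S,T]$; 4. $\mathbb E\log C(S,T)<\infty$ (the positive part being integrable) and $\mathbb E\sup_{S\le t\le T}d_H(\varphi_t^\pi f,f)<\infty$ for every $f\in E$. For $z\in\mathbb Z$ and $h_0\in C(\mathbb T^d)$ the solution of the KPZ equation started in $h_0$ at time $z$ is $h^z(\omega,t)=\log\big(\varphi_{t-z}(\vartheta^z\omega)e^{h_0}\big)$, $t\ge z$; its gradient $\nabla h^z$, in the sense of distributions, is the solution of Burgers' equation. **Claim.** One has $\mathbb E\log\tau(\varphi_1)\in[-\infty,0)$, and there are a measurable $\vartheta$-invariant set $\widetilde\Omega\subseteq\Omega$ with $\mathbb P(\widetilde\Omega)=1$ and a random function $h_\infty$ such that for every $\alpha\in(0,\beta)\setminus\mathbb N$, every $T>0$, every $\omega\in\widetilde\Omega$ and every choice of the dyadic partition of unity the following hold. (a) Suppose in addition that $\mathbb E\sup_{S\le t\le T',\,x\in\mathbb T^d}|h(t,x)|<\infty$ for all $0<S<T'$,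 where $h$ is the solution started in $0$ at time $0$. Then for all $h_0^1,h_0^2\in C(\mathbb T^d)$ the solutions $h_1,h_2$ started in $h_0^1,h_0^2$ at time $0$ satisfy $$\limsup_{n\to\infty}\frac1n\log\Big(\sup_{t\in[n,n+T]}\|\nabla h_1(\omega,t)-\nabla h_2(\omega,t)\|_{C^{\alpha-1}(\mathbb T^d)}\Big)\le\mathbb E\log\tau(\varphi_1).$$ (b) With $h^{-n}$ the solution started in $h_0$ at time $-n$, $$\limsup_{n\to\infty}\frac1n\log\Big(\sup_{h_0\in C(\mathbb T^d),\ t\in[(-T)\vee(-n),T]}\|\nabla h^{-n}(\omega,t)-\nabla h_\infty(\omega,t)\|_{C^{\alpha-1}(\mathbb T^d)}\Big)\le\mathbb E\log\tau(\varphi_1).$$ Here $C^{\alpha-1}$ is the Besov space $B^{\alpha-1}_{\infty,\infty}$ if $\alpha<1$ and the Hölder space if $\alpha>1$. The function $h_\infty$ takes values in $C(\mathbb R;C^\alpha(\mathbb T^d))$ and is the pullback limit of the solutions modulo constants: there are $c^{-n}(\omega,t,h_0)\in\mathbb R$ such that (b) also holds with $\|h^{-n}(\omega,t)-h_\infty(\omega,t)-c^{-n}(\omega,t,h_0)\|_{C^\alpha(\mathbb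 T^d)}$ in place of the norm of the gradients. -/

import Mathlib

open MeasureTheory Filter Set
open scoped NNReal ENNReal Topology

noncomputable section

/-! ### The torus and its function spaces -/

/-- The torus `ℝ^d / ℤ^d`. -/
abbrev Torus (d : ℕ) : Type := UnitAddTorus (Fin d)

/-- The Banach space `C(𝕋^d)` with the supremum norm. -/
abbrev TorusFn (d : ℕ) : Type := C(Torus d, ℝ)

/-- Lebesgue measure on the torus, of total mass one (the measure used by
`UnitAddTorus.mFourierCoeff`). -/
def torusMeasure (d : ℕ) : Measure (Torus d) :=
  Measure.pi fun _ => AddCircle.haarAddCircle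

/-- The `ℤ^d`-periodic function on `ℝ^d` that corresponds to a function on the torus. -/
def periodicLift {d : ℕ} (f : Torus d → ℝ) : EuclideanSpace ℝ (Fin d) → ℝ :=
  fun x => f fun i => ((x i : ℝ) : UnitAddCircle)

/-- The partial derivative `∂_{s 0} ⋯ ∂_{s (m-1)} F`.  The derivatives `∂^k F` for multi-indices
`|k| = m` are those obtained from the tuples `s : Fin m → Fin d`. -/
def iteratedPartial {d m : ℕ} (s : Fin m → Fin d) (F : EuclideanSpace ℝ (Fin d) → ℝ) :
    EuclideanSpace ℝ (Fin d) → ℝ :=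
  fun x => iteratedFDeriv ℝ m F x fun j => EuclideanSpace.single (s j) (1 : ℝ)

/-- The supremum norm, possibly infinite. -/
def supNorm {X E : Type*} [ENorm E] (F : X → E) : ℝ≥0∞ := ⨆ x, ‖F x‖ₑ

open Classical in
/-- The Hölder seminorm `[F]_α`, `α ≥ 0`, of a periodic function; it is infinite if `F` is not
`⌊α⌋` times continuously differentiable.  For a periodic function the Hölder quotients over
`ℝ^d` and those over the torus with its quotient distance have the same supremum. -/
def holderSeminorm {d : ℕ} (α : ℝ) (F : EuclideanSpace ℝ (Fin d) → ℝ) : ℝ≥0∞ :=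
  if ContDiff ℝ ⌊α⌋₊ F then
    ⨆ s : Fin ⌊α⌋₊ → Fin d,
      ((if 0 < ⌊α⌋₊ then supNorm (iteratedPartial s F) else 0) +
        eHolderNorm (α - ⌊α⌋₊).toNNReal (iteratedPartial s F))
  else ⊤

/-- The norm `‖F‖_∞ + [F]_α` of `C^α(𝕋^d)`, `α ≥ 0`, infinite outside of that space. -/
def holderNorm {d : ℕ} (α : ℝ) (F : EuclideanSpace ℝ (Fin d) → ℝ) : ℝ≥0∞ :=
  supNorm F + holderSeminorm α F

/-! ### Besov spaces of negative order -/

/-- The functions `ϱ_{j-1}`, `j ≥ 0`, where `ϱ_{-1} = χ` and `ϱ_j = ϱ(2^{-j} ·)` for `j ≥ 0`. -/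
def dyadicPiece {d : ℕ} (χ ϱ : EuclideanSpace ℝ (Fin d) → ℝ) :
    ℕ → EuclideanSpace ℝ (Fin d) → ℝ
  | 0 => χ
  | j + 1 => fun ξ => ϱ (((2 : ℝ) ^ j)⁻¹ • ξ)

/-- `(χ, ϱ)` generates a smooth dyadic partition of unity on `ℝ^d`. -/
structure IsDyadicPartition {d : ℕ} (χ ϱ : EuclideanSpace ℝ (Fin d) → ℝ) : Prop where
  smooth_low : ContDiff ℝ (⊤ : ℕ∞) χ
  smooth_high : ContDiff ℝ (⊤ : ℕ∞) ϱ
  radial_low : ∀ ξ η, ‖ξ‖ = ‖η‖ → χ ξ = χ η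
  radial_high : ∀ ξ η, ‖ξ‖ = ‖η‖ → ϱ ξ = ϱ η
  range_low : ∀ ξ, χ ξ ∈ Icc (0 : ℝ) 1
  range_high : ∀ ξ, ϱ ξ ∈ Icc (0 : ℝ) 1
  support_low : ∀ ξ, χ ξ ≠ 0 → ‖ξ‖ ≤ 4 / 3
  support_high : ∀ ξ, ϱ ξ ≠ 0 → 3 / 4 ≤ ‖ξ‖ ∧ ‖ξ‖ ≤ 8 / 3
  hasSum_one : ∀ ξ, HasSum (fun j => dyadicPiece χ ϱ j ξ) 1

/-- Dyadic partitions of unity exist. -/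
theorem exists_isDyadicPartition (d : ℕ) :
    ∃ χ ϱ : EuclideanSpace ℝ (Fin d) → ℝ, IsDyadicPartition χ ϱ := by
  have hsm : ContDiff ℝ (⊤ : ℕ∞) fun ξ : EuclideanSpace ℝ (Fin d) =>
      Real.smoothTransition ((16 / 9 - ‖ξ‖ ^ 2) / (175 / 144)) := by
    refine Real.smoothTransition.contDiff.comp ?_
    exact (contDiff_const.sub (contDiff_norm_sq ℝ)).div_const _
  have hone : ∀ ξ : EuclideanSpace ℝ (Fin d), ‖ξ‖ ≤ 3 / 4 →
      Real.smoothTransition ((16 / 9 - ‖ξ‖ ^ 2) / (175 / 144)) = 1 := by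
    intro ξ hξ
    refine Real.smoothTransition.one_of_one_le ?_
    rw [le_div_iff₀ (by norm_num)]
    nlinarith [norm_nonneg ξ]
  have hzero : ∀ ξ : EuclideanSpace ℝ (Fin d), 4 / 3 ≤ ‖ξ‖ →
      Real.smoothTransition ((16 / 9 - ‖ξ‖ ^ 2) / (175 / 144)) = 0 := by
    intro ξ hξ
    refine Real.smoothTransition.zero_of_nonpos ?_
    exact div_nonpos_of_nonpos_of_nonneg (by nlinarith) (by norm_num)
  set χ : EuclideanSpace ℝ (Fin d) → ℝ := fun ξ =>
    Real.smoothTransition ((16 / 9 - ‖ξ‖ ^ 2) / (175 / 144)) with hχ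
  have hhalf : ∀ ξ : EuclideanSpace ℝ (Fin d), ‖(2 : ℝ)⁻¹ • ξ‖ = ‖ξ‖ / 2 := by
    intro ξ
    rw [norm_smul]
    norm_num
    ring
  have hmono : ∀ ξ, χ ξ ≤ χ ((2 : ℝ)⁻¹ • ξ) := by
    intro ξ
    refine Real.smoothTransition.monotone ?_
    rw [hhalf]
    gcongr
    linarith [norm_nonneg ξ]
  refine ⟨χ, fun ξ => χ ((2 : ℝ)⁻¹ • ξ) - χ ξ, hsm,
    (hsm.comp (contDiff_const_smul _)).sub hsm, ?_, ?_, ?_, ?_, ?_, ?_, ?_⟩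
  · intro ξ η h
    simp only [hχ, h]
  · intro ξ η h
    simp only [hχ, hhalf, h]
  · exact fun ξ => ⟨Real.smoothTransition.nonneg _, Real.smoothTransition.le_one _⟩
  · refine fun ξ => ⟨sub_nonneg.2 (hmono ξ), ?_⟩
    have h1 : χ ((2 : ℝ)⁻¹ • ξ) ≤ 1 := Real.smoothTransition.le_one _
    have h2 : 0 ≤ χ ξ := Real.smoothTransition.nonneg _
    linarith
  · intro ξ h
    by_contra! hc
    exact h (hzero ξ hc.le)
  · intro ξ h
    constructor
    · by_contra! hc
      refine h ?_
      have h1 : χ ξ = 1 := hone ξ hc.le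
      have h2 : χ ((2 : ℝ)⁻¹ • ξ) = 1 := hone _ (by rw [hhalf]; linarith [norm_nonneg ξ])
      simp only [h1, h2, sub_self]
    · by_contra! hc
      refine h ?_
      have h1 : χ ξ = 0 := hzero ξ (by linarith)
      have h2 : χ ((2 : ℝ)⁻¹ • ξ) = 0 := hzero _ (by rw [hhalf]; linarith)
      simp only [h1, h2, sub_self]
  · intro ξ
    rw [hasSum_iff_tendsto_nat_of_nonneg]
    · have hsum : ∀ n : ℕ, ∑ j ∈ Finset.range (n + 1),
          dyadicPiece χ (fun ξ => χ ((2 : ℝ)⁻¹ • ξ) - χ ξ) j ξ = χ (((2 : ℝ) ^ n)⁻¹ • ξ) := by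
        intro n
        induction n with
        | zero => simp [dyadicPiece]
        | succ n ih =>
          rw [Finset.sum_range_succ, ih]
          simp only [dyadicPiece, smul_smul, pow_succ, mul_inv]
          rw [mul_comm (2 : ℝ)⁻¹]
          ring
      rw [← tendsto_add_atTop_iff_nat 1]
      simp only [hsum]
      have hlim : Tendsto (fun n : ℕ => (2 : ℝ) ^ n) atTop atTop :=
        tendsto_pow_atTop_atTop_of_one_lt (by norm_num)
      refine tendsto_const_nhds.congr' ?_
      filter_upwards [hlim.eventually_ge_atTop (‖ξ‖ / (3 / 4))] with n hn
      refine (hone _ ?_).symm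
      rw [norm_smul, norm_inv, norm_pow, Real.norm_ofNat, inv_mul_le_iff₀ (by positivity)]
      rw [div_le_iff₀ (by norm_num)] at hn
      exact hn
    · intro j
      cases j with
      | zero => exact Real.smoothTransition.nonneg _
      | succ j => exact sub_nonneg.2 (hmono _)

/-- The Paley block `∑_k ϱ(k) c(k) e^{2πi⟨k,x⟩}` of the distribution with Fourier coefficients
`c`; the sum is finite when `ϱ` has compact support. -/
def paleyBlock {d : ℕ} (ϱ : EuclideanSpace ℝ (Fin d) → ℝ) (c : (Fin d → ℤ) → ℂ) (x : Torus d) : ℂ :=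
  ∑' k : Fin d → ℤ,
    (ϱ (WithLp.toLp 2 fun i => (k i : ℝ)) : ℂ) * c k * UnitAddTorus.mFourier k x

/-- The norm of `B^γ_{∞,∞}(𝕋^d)` of the distribution with Fourier coefficients `c`. -/
def besovNorm {d : ℕ} (χ ϱ : EuclideanSpace ℝ (Fin d) → ℝ) (γ : ℝ) (c : (Fin d → ℤ) → ℂ) : ℝ≥0∞ :=
  ⨆ j : ℕ, ENNReal.ofReal ((2 : ℝ) ^ (((j : ℝ) - 1) * γ)) *
    supNorm (paleyBlock (dyadicPiece χ ϱ j) c)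

/-- The Fourier coefficients `2πi k_i 𝓕f(k)` of the distributional derivative `∂_i f`. -/
def partialCoeff {d : ℕ} (i : Fin d) (f : Torus d → ℝ) (k : Fin d → ℤ) : ℂ :=
  2 * Real.pi * Complex.I * (k i : ℂ) * UnitAddTorus.mFourierCoeff (fun x => (f x : ℂ)) k

/-- The classical partial derivative `∂_i F`. -/
def classicalPartial {d : ℕ} (i : Fin d) (F : EuclideanSpace ℝ (Fin d) → ℝ) :
    EuclideanSpace ℝ (Fin d) → ℝ :=
  fun x => fderiv ℝ F x (EuclideanSpace.single i (1 : ℝ))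

open Classical in
/-- `‖∇f - ∇g‖_{C^{α-1}(𝕋^d)}` for `α > 0` that is not an integer.  For `α < 1` the gradients are
distributions and the norm is that of `B^{α-1}_{∞,∞}`; for `α > 1` the gradients are functions
and the norm is the Hölder norm (infinite if `f` or `g` is not continuously differentiable). -/
def gradDist {d : ℕ} (χ ϱ : EuclideanSpace ℝ (Fin d) → ℝ) (α : ℝ) (f g : Torus d → ℝ) : ℝ≥0∞ :=
  if α < 1 then
    ⨆ i : Fin d, besovNorm χ ϱ (α - 1) (partialCoeff i f - partialCoeff i g)
  else if ContDiff ℝ 1 (periodicLift f) ∧ ContDiff ℝ 1 (periodicLift g) then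
    ⨆ i : Fin d, holderNorm (α - 1)
      (classicalPartial i (periodicLift f) - classicalPartial i (periodicLift g))
  else ⊤

/-! ### Hilbert's projective distance -/

/-- The cone of nonnegative functions. -/
def posCone (d : ℕ) : Set (TorusFn d) := {f | ∀ x, 0 ≤ f x}

/-- `E`: interior points of the cone, normalized to have integral one. -/
def projSpace (d : ℕ) : Set (TorusFn d) :=
  interior (posCone d) ∩ {f | ∫ x, f x ∂torusMeasure d = 1}

/-- `M(f, g) = inf {a ≥ 0 : f ≤ a g}`. -/
def hilbertUpper {d : ℕ} (f g : TorusFn d) : ℝ≥0∞ :=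
  ⨅ (a : ℝ≥0) (_ : (a : ℝ) • g - f ∈ posCone d), (a : ℝ≥0∞)

/-- `m(f, g) = sup {a ≥ 0 : a g ≤ f}`. -/
def hilbertLower {d : ℕ} (f g : TorusFn d) : ℝ≥0∞ :=
  ⨆ (a : ℝ≥0) (_ : f - (a : ℝ) • g ∈ posCone d), (a : ℝ≥0∞)

/-- Hilbert's projective distance `log M(f, g) - log m(f, g) ∈ [0, ∞]` of `f, g ∈ K \ {0}`. -/
def hilbertDist {d : ℕ} (f g : TorusFn d) : ℝ≥0∞ :=
  (ENNReal.log (hilbertUpper f g) - ENNReal.log (hilbertLower f g)).toENNReal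

/-- The projective action `A^π f`: the multiple of `A f` that has integral one. -/
def projAction {d : ℕ} (A : TorusFn d →L[ℝ] TorusFn d) (f : TorusFn d) : TorusFn d :=
  (∫ x, A f x ∂torusMeasure d)⁻¹ • A f

/-- The projective norm `τ(A)` of a positive operator. -/
def projNorm {d : ℕ} (A : TorusFn d →L[ℝ] TorusFn d) : ℝ≥0∞ :=
  ⨆ (f ∈ projSpace d) (g ∈ projSpace d) (_ : f ≠ g),
    hilbertDist (projAction A f) (projAction A g) / hilbertDist f g

/-! ### Random dynamical systems -/

/-- `ϑ` is an ergodic, invertible, measure preserving action of `ℤ` on the space with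
probability `P`. -/
structure IsErgodicIDS {Ω : Type*} [MeasurableSpace Ω] (P : Measure Ω) (ϑ : ℤ → Ω → Ω) : Prop where
  zero : ∀ ω, ϑ 0 ω = ω
  add : ∀ z z' ω, ϑ (z + z') ω = ϑ z (ϑ z' ω)
  measurePreserving : ∀ z, MeasurePreserving (ϑ z) P P
  ergodic : Ergodic (ϑ 1) P

/-- `φ` is a (linear) continuous-time random dynamical system on `C(𝕋^d)` with its Borel sets,
over the discrete-time system `ϑ`. -/
structure IsContinuousRDS {Ω : Type*} [MeasurableSpace Ω] (ϑ : ℤ → Ω → Ω) {d : ℕ}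
    (φ : ℝ≥0 → Ω → (TorusFn d →L[ℝ] TorusFn d)) : Prop where
  measurable : letI : MeasurableSpace (TorusFn d) := borel (TorusFn d)
    Measurable fun p : ℝ≥0 × Ω × TorusFn d => φ p.1 p.2.1 p.2.2
  zero : ∀ ω f, φ 0 ω f = f
  cocycle : ∀ (t : ℝ≥0) (n : ℕ) ω f, φ (t + n) ω f = φ t (ϑ n ω) (φ n ω f)

/-- The standing assumption on the solution map `φ`: on an invariant set of full probability it
has a continuous kernel, bounded above and away from zero locally uniformly in time, it
regularizes from `C(𝕋^d)` to `C^β(𝕋^d)` with constant `C`, and the stated moments are finite.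
The expectation of `log C` is finite or `-∞`, that is, the positive part is integrable. -/
def RegularizingAssumption {Ω : Type*} [MeasurableSpace Ω] (P : Measure Ω) (ϑ : ℤ → Ω → Ω)
    {d : ℕ} (φ : ℝ≥0 → Ω → (TorusFn d →L[ℝ] TorusFn d)) (β : ℝ) : Prop :=
  ∃ (Ω₀ : Set Ω) (K : Ω → ℝ≥0 → C(Torus d × Torus d, ℝ)) (C : Ω → ℝ≥0 → ℝ≥0 → ℝ),
    (∀ z, ϑ z '' Ω₀ = Ω₀) ∧ P Ω₀ᶜ = 0 ∧
    (∀ ω ∈ Ω₀, ContinuousOn (K ω) (Ioi 0) ∧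
      ∀ t, 0 < t → ∀ f x, φ t ω f x = ∫ y, K ω t (x, y) * f y ∂torusMeasure d) ∧
    (∀ ω ∈ Ω₀, ∀ S T, 0 < S → S < T → ∃ γ δ : ℝ, 0 < γ ∧ γ ≤ δ ∧
      ∀ t ∈ Icc S T, ∀ x y, γ ≤ K ω t (x, y) ∧ K ω t (x, y) ≤ δ) ∧
    (∀ ω ∈ Ω₀, ∀ S T, 0 < S → S < T → ∀ t ∈ Icc S T, ∀ f : TorusFn d,
      holderNorm β (periodicLift (φ t ω f)) ≤ ENNReal.ofReal (C ω S T * ‖f‖)) ∧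
    (∀ S T, 0 < S → S < T →
      AEMeasurable (fun ω => C ω S T) P ∧
      ∫⁻ ω, ENNReal.ofReal (Real.log (C ω S T)) ∂P < ⊤ ∧
      ∀ f ∈ projSpace d, ∫⁻ ω, ⨆ t ∈ Icc S T, hilbertDist (projAction (φ t ω) f) f ∂P < ⊤)

/-- `E log τ(φ_1) ∈ [-∞, ∞]`, the expectation of the positive part minus that of the negative
part. -/
def contractionRate {Ω : Type*} [MeasurableSpace Ω] (P : Measure Ω) {d : ℕ}
    (φ : ℝ≥0 → Ω → (TorusFn d →L[ℝ] TorusFn d)) : EReal :=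
  ((∫⁻ ω, (ENNReal.log (projNorm (φ 1 ω))).toENNReal ∂P : ℝ≥0∞) : EReal) -
    ((∫⁻ ω, (-ENNReal.log (projNorm (φ 1 ω))).toENNReal ∂P : ℝ≥0∞) : EReal)

/-! ### Solutions of the KPZ equation -/

/-- `exp ∘ h` as a continuous function. -/
def expFn {d : ℕ} (h : TorusFn d) : TorusFn d :=
  ⟨fun x => Real.exp (h x), Real.continuous_exp.comp h.continuous⟩

/-- The solution `h^z(ω, t) = log (φ_{t-z}(ϑ^z ω) exp h₀)`, `t ≥ z`, started in `h₀` at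
time `z`. -/
def kpzSolution {Ω : Type*} (ϑ : ℤ → Ω → Ω) {d : ℕ}
    (φ : ℝ≥0 → Ω → (TorusFn d →L[ℝ] TorusFn d)) (z : ℤ) (h₀ : TorusFn d) (ω : Ω) (t : ℝ) :
    Torus d → ℝ :=
  fun x => Real.log (φ (t - z).toNNReal (ϑ z ω) (expFn h₀) x)

/-- `E sup_{S ≤ t ≤ T, x} |h(t, x)| < ∞` for all `0 < S < T`, where `h` is the solution started
in `0` at time `0`. -/
def HasKPZMoments {Ω : Type*} [MeasurableSpace Ω] (P : Measure Ω) (ϑ : ℤ → Ω → Ω) {d : ℕ}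
    (φ : ℝ≥0 → Ω → (TorusFn d →L[ℝ] TorusFn d)) : Prop :=
  ∀ S T : ℝ, 0 < S → S < T →
    ∫⁻ ω, ⨆ t ∈ Icc S T, supNorm (kpzSolution ϑ φ 0 0 ω t) ∂P < ⊤

/-- `limsup_{n → ∞} (1/n) log a_n ∈ [-∞, ∞]`. -/
def exponentialRate (a : ℕ → ℝ≥0∞) : EReal :=
  limsup (fun n : ℕ => (((n : ℝ)⁻¹ : ℝ) : EReal) * ENNReal.log (a n)) atTop

end

/-! Taking exponentials turns the equation into the linear positive cocycle φ, and Hilbert's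
distance of two positive functions is the oscillation of the difference of their logarithms
(`hilbertDist_eq_logDist`). Convergence of solutions modulo constants is thus contraction of
Hilbert's distance under φ.

Rate. An operator with a kernel bounded above and away from zero is a strict contraction
(`projNorm_lt_one_of_kernel`, Birkhoff), so E log τ(φ_1) < 0. The distance after n steps is at most
its initial value times the product of the τ's along the orbit. The ergodic theorem for truncations
of log τ bounds this product by exp(cn), for every c above E log τ (`ae_eventually_prod_le`).

Uniformity in the initial data. The image of the cone under φ_1 has almost surely finite diameter.
No moment of the diameter is needed: a set where it is at most M has probability close to one, so
the orbit visits it within εn steps of the starting time -n (`ae_eventually_exists_visit`), and only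
εn factors τ are lost. Hence the solutions started at -n are Cauchy modulo constants at time 0, with
a limit that does not depend on the data. This limit is invariant modulo constants, and evolving it
forward from the remote past gives h_∞.

Regularity. The last stretch of time, of length at least one, upgrades the distance to C^α. By
linearity, smoothing bounds the C^β norm of the difference of two images, and a logarithm calculus,
linear in the difference and polynomial in all other bounds, carries this to C^α
(`exists_log_image_estimate`). In the pullback the last operator does not depend on n, so its
constants are harmless. Forward in time they vary with n but grow subexponentially: log C is
controlled by its moment, and the moments of the solution started in 0 control both the lower bounds
and the oscillation of solutions (`eventually_logDist_one_le`).

Gradients. For α < 1 a Littlewood-Paley block of a derivative is a convolution with a dilated kernel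
of mean zero, so a Hölder seminorm controls the Besov norm. For α > 1 partial derivatives are taken
directly. Additive constants disappear in both cases. -/

/-! ### A Hölder calculus on Euclidean space -/

/-- `F` and its partial derivatives of order at most `m` are bounded by `M`, and those of order
`m` are `θ`-Hölder continuous with constant `M`. -/
def HolderBound {d : ℕ} (θ : ℝ) : ℕ → (EuclideanSpace ℝ (Fin d) → ℝ) → ℝ → Prop
  | 0, F, M => (∀ x, |F x| ≤ M) ∧ ∀ x y, |F x - F y| ≤ M * dist x y ^ θ
  | m + 1, F, M => (∀ x, |F x| ≤ M) ∧ Differentiable ℝ F ∧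
      ∀ i, HolderBound θ m (classicalPartial i F) M

section HolderCalculus

variable {d : ℕ} {θ : ℝ} {m : ℕ} {F G : EuclideanSpace ℝ (Fin d) → ℝ} {A B M : ℝ}

theorem HolderBound.abs_le (h : HolderBound θ m F M) (x) : |F x| ≤ M := by
  cases m with
  | zero => exact h.1 x
  | succ m => exact h.1 x

theorem HolderBound.nonneg (h : HolderBound θ m F M) : 0 ≤ M :=
  (abs_nonneg _).trans (h.abs_le 0)

theorem HolderBound.mono (h : HolderBound θ m F A) (hAB : A ≤ B) : HolderBound θ m F B := by
  induction m generalizing F with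
  | zero =>
    exact ⟨fun x => (h.1 x).trans hAB, fun x y => (h.2 x y).trans
      (mul_le_mul_of_nonneg_right hAB (Real.rpow_nonneg dist_nonneg _))⟩
  | succ m ih => exact ⟨fun x => (h.1 x).trans hAB, h.2.1, fun i => ih (h.2.2 i)⟩

theorem classicalPartial_add (hF : Differentiable ℝ F) (hG : Differentiable ℝ G) (i : Fin d) :
    classicalPartial i (F + G) = classicalPartial i F + classicalPartial i G := by
  ext x
  simp [classicalPartial, fderiv_add (hF x) (hG x)]

theorem classicalPartial_sub (hF : Differentiable ℝ F) (hG : Differentiable ℝ G) (i : Fin d) :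
    classicalPartial i (F - G) = classicalPartial i F - classicalPartial i G := by
  ext x
  simp [classicalPartial, fderiv_sub (hF x) (hG x)]

theorem classicalPartial_mul (hF : Differentiable ℝ F) (hG : Differentiable ℝ G) (i : Fin d) :
    classicalPartial i (F * G) = classicalPartial i F * G + F * classicalPartial i G := by
  ext x
  simp [classicalPartial, fderiv_mul (hF x) (hG x)]
  ring

theorem classicalPartial_inv (hF : Differentiable ℝ F) (h0 : ∀ x, F x ≠ 0) (i : Fin d) :
    classicalPartial i F⁻¹ = -(classicalPartial i F * (F⁻¹ * F⁻¹)) := by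
  ext x
  have h : HasFDerivAt F⁻¹ (-(F x ^ 2)⁻¹ • fderiv ℝ F x) x :=
    (hasDerivAt_inv (h0 x)).comp_hasFDerivAt x (hF x).hasFDerivAt
  simp only [classicalPartial, h.fderiv, Pi.neg_apply, Pi.mul_apply, Pi.inv_apply,
    _root_.smul_apply, smul_eq_mul]
  field_simp

theorem classicalPartial_log (hF : Differentiable ℝ F) (h0 : ∀ x, F x ≠ 0) (i : Fin d) :
    classicalPartial i (fun x => Real.log (F x)) = classicalPartial i F * F⁻¹ := by
  ext x
  have h := (hF x).hasFDerivAt.log (h0 x)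
  simp only [classicalPartial, h.fderiv, Pi.mul_apply, Pi.inv_apply,
    _root_.smul_apply, smul_eq_mul]
  ring

theorem classicalPartial_const (c : ℝ) (i : Fin d) :
    classicalPartial i (fun _ => c) = fun _ => 0 := by
  ext x
  simp [classicalPartial]

theorem HolderBound.const (c : ℝ) : HolderBound (d := d) θ m (fun _ => c) |c| := by
  -- The bound is generalized to any M ≥ |c|: differentiation replaces c by 0 but must keep M.
  have key : ∀ (m : ℕ) (c M : ℝ), |c| ≤ M →
      HolderBound (d := d) θ m (fun _ => c) M := by
    intro m
    induction m with
    | zero =>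
      intro c M h
      refine ⟨fun _ => h, fun x y => ?_⟩
      simp only [sub_self, abs_zero]
      exact mul_nonneg ((abs_nonneg c).trans h) (Real.rpow_nonneg dist_nonneg _)
    | succ m ih =>
      intro c M h
      refine ⟨fun _ => h, differentiable_const c, fun i => ?_⟩
      rw [classicalPartial_const]
      exact ih 0 M (by simpa using (abs_nonneg c).trans h)
  exact key m c _ le_rfl

theorem HolderBound.add (hF : HolderBound θ m F A) (hG : HolderBound θ m G B) :
    HolderBound θ m (F + G) (A + B) := by
  induction m generalizing F G with
  | zero =>
    refine ⟨fun x => (abs_add_le _ _).trans (add_le_add (hF.1 x) (hG.1 x)), fun x y => ?_⟩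
    calc |(F + G) x - (F + G) y| = |(F x - F y) + (G x - G y)| := by
          simp only [Pi.add_apply]; ring_nf
      _ ≤ A * dist x y ^ θ + B * dist x y ^ θ :=
          (abs_add_le _ _).trans (add_le_add (hF.2 x y) (hG.2 x y))
      _ = (A + B) * dist x y ^ θ := by ring
  | succ m ih =>
    refine ⟨fun x => (abs_add_le _ _).trans (add_le_add (hF.1 x) (hG.1 x)),
      hF.2.1.add hG.2.1, fun i => ?_⟩
    rw [classicalPartial_add hF.2.1 hG.2.1]
    exact ih (hF.2.2 i) (hG.2.2 i)

theorem HolderBound.neg (hF : HolderBound θ m F A) : HolderBound θ m (-F) A := by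
  induction m generalizing F with
  | zero =>
    refine ⟨fun x => by simpa using hF.1 x, fun x y => ?_⟩
    have : (-F) x - (-F) y = -(F x - F y) := by simp only [Pi.neg_apply]; ring
    rw [this, abs_neg]
    exact hF.2 x y
  | succ m ih =>
    refine ⟨fun x => by simpa using hF.1 x, hF.2.1.neg, fun i => ?_⟩
    have : classicalPartial i (-F) = -classicalPartial i F := by
      ext x
      simp [classicalPartial, fderiv_neg]
    rw [this]
    exact ih (hF.2.2 i)

theorem HolderBound.sub (hF : HolderBound θ m F A) (hG : HolderBound θ m G B) :
    HolderBound θ m (F - G) (A + B) := by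
  rw [sub_eq_add_neg]
  exact hF.add hG.neg

theorem fderiv_eq_sum_classicalPartial (F : EuclideanSpace ℝ (Fin d) → ℝ) (x) :
    fderiv ℝ F x = ∑ i, classicalPartial i F x •
      (EuclideanSpace.proj i : EuclideanSpace ℝ (Fin d) →L[ℝ] ℝ) := by
  refine ContinuousLinearMap.ext fun v => ?_
  have hv : v = ∑ i, v i • EuclideanSpace.single i (1 : ℝ) := by
    ext j
    simp [Finset.sum_apply, Pi.single_apply]
  conv_lhs => rw [hv]
  simp [classicalPartial, map_sum, mul_comm]

theorem norm_fderiv_le_of_classicalPartial {x : EuclideanSpace ℝ (Fin d)}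
    (h : ∀ i, |classicalPartial i F x| ≤ M) : ‖fderiv ℝ F x‖ ≤ d * M := by
  rw [fderiv_eq_sum_classicalPartial]
  refine (norm_sum_le _ _).trans ?_
  have : ∀ i ∈ (Finset.univ : Finset (Fin d)), ‖classicalPartial i F x •
      (EuclideanSpace.proj i : EuclideanSpace ℝ (Fin d) →L[ℝ] ℝ)‖ ≤ M := by
    intro i _
    have h1 : ‖(EuclideanSpace.proj i : EuclideanSpace ℝ (Fin d) →L[ℝ] ℝ)‖ ≤ 1 :=
      ContinuousLinearMap.opNorm_le_bound _ zero_le_one fun v => by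
        simpa using PiLp.norm_apply_le v i
    rw [norm_smul]
    calc _ ≤ |classicalPartial i F x| * 1 := by
          rw [Real.norm_eq_abs]; gcongr
      _ ≤ M := by simpa using h i
  simpa using Finset.sum_le_card_nsmul _ _ _ this

theorem abs_sub_le_of_classicalPartial (hF : Differentiable ℝ F)
    (h : ∀ i x, |classicalPartial i F x| ≤ M) (x y) : |F x - F y| ≤ d * M * dist x y := by
  have := convex_univ.norm_image_sub_le_of_norm_fderiv_le (𝕜 := ℝ) (f := F) (C := d * M)
    (fun z _ => hF z) (fun z _ => norm_fderiv_le_of_classicalPartial fun i => h i z)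
    (mem_univ y) (mem_univ x)
  rwa [Real.norm_eq_abs, ← dist_eq_norm] at this

/-- For r ≤ 1 the power r ^ s is at most r ^ θ; for r > 1 the trivial bound suffices because r ^ θ ≥
1. -/
theorem le_mul_rpow_of_le {a L r : ℝ} (hL : 0 ≤ L) (hM : 0 ≤ M) {s : ℝ} (hr : 0 ≤ r) (hθ : 0 ≤ θ)
    (hθs : θ ≤ s) (h1 : a ≤ M) (h2 : a ≤ L * r ^ s) : a ≤ (M + L) * r ^ θ := by
  rcases le_or_gt r 1 with hr1 | hr1
  · rcases hr.eq_or_lt with rfl | hr0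
    -- At r = 0 the exponent matters, since 0 ^ 0 = 1.
    · rcases hθs.eq_or_lt with rfl | hlt
      · refine h2.trans ?_
        have := Real.rpow_nonneg hr θ
        nlinarith
      · rw [Real.zero_rpow (by linarith), mul_zero] at h2
        exact h2.trans (mul_nonneg (by linarith) (Real.rpow_nonneg hr _))
    · have := Real.rpow_le_rpow_of_exponent_ge hr0 hr1 hθs
      have h0 := Real.rpow_nonneg hr s
      nlinarith
  · have := Real.one_le_rpow hr1.le hθ
    nlinarith

theorem HolderBound.of_exponent_le {s : ℝ} (h : HolderBound s m F M) (hθ : 0 ≤ θ) (hθs : θ ≤ s) :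
    HolderBound θ m F (3 * M) := by
  have hM := h.nonneg
  induction m generalizing F with
  | zero =>
    refine ⟨fun x => (h.1 x).trans (by linarith), fun x y => ?_⟩
    have := le_mul_rpow_of_le (M := 2 * M) hM (by linarith) dist_nonneg hθ hθs
      ((abs_sub (F x) (F y)).trans (by linarith [h.1 x, h.1 y])) (h.2 x y)
    convert this using 2
    ring
  | succ m ih =>
    exact ⟨fun x => (h.1 x).trans (by linarith), h.2.1, fun i => ih (h.2.2 i)⟩

/-- Bounded partial derivatives give the Lipschitz constant dM, and the oscillation is at most 2M;
together they bound the Hölder quotient by (d + 2)M. -/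
theorem HolderBound.of_succ (h : HolderBound θ (m + 1) F M) (hθ : 0 ≤ θ) (hθ1 : θ ≤ 1) :
    HolderBound θ m F ((d + 2) * M) := by
  have hM := h.nonneg
  have hdM : 0 ≤ d * M := by positivity
  induction m generalizing F with
  | zero =>
    refine ⟨fun x => (h.1 x).trans (by nlinarith), fun x y => ?_⟩
    have := le_mul_rpow_of_le (M := 2 * M) (L := d * M) hdM (by linarith) (dist_nonneg (x := x)
      (y := y)) hθ hθ1
      ((abs_sub (F x) (F y)).trans (by linarith [h.1 x, h.1 y])) (by
        rw [Real.rpow_one]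
        exact abs_sub_le_of_classicalPartial h.2.1 (fun i => (h.2.2 i).1) x y)
    convert this using 2
    ring
  | succ m ih =>
    exact ⟨fun x => (h.1 x).trans (by nlinarith), h.2.1, fun i => ih (h.2.2 i)⟩

theorem HolderBound.mul (hθ : 0 ≤ θ) (hθ1 : θ ≤ 1) (hF : HolderBound θ m F A)
    (hG : HolderBound θ m G B) :
    HolderBound θ m (F * G) (2 * (2 * (d + 2)) ^ m * (A * B)) := by
  have hA := hF.nonneg
  have hB := hG.nonneg
  have hAB : 0 ≤ A * B := mul_nonneg hA hB
  have habs : ∀ x, |(F * G) x| ≤ A * B := fun x => by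
    rw [Pi.mul_apply, abs_mul]
    exact mul_le_mul (hF.abs_le x) (hG.abs_le x) (abs_nonneg _) hA
  induction m generalizing F G A B with
  | zero =>
    refine ⟨fun x => (habs x).trans (by linarith), fun x y => ?_⟩
    have hr : 0 ≤ dist x y ^ θ := Real.rpow_nonneg dist_nonneg _
    calc |(F * G) x - (F * G) y| = |(F x - F y) * G x + F y * (G x - G y)| := by
          simp only [Pi.mul_apply]; ring_nf
      _ ≤ |F x - F y| * |G x| + |F y| * |G x - G y| := by
          rw [← abs_mul, ← abs_mul]; exact abs_add_le _ _
      _ ≤ (A * dist x y ^ θ) * B + A * (B * dist x y ^ θ) := by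
          gcongr
          · exact hF.2 x y
          · exact hG.1 x
          · exact hF.1 y
          · exact hG.2 x y
      _ = _ := by ring
  | succ m ih =>
    have hone : 1 ≤ 2 * (2 * ((d : ℝ) + 2)) ^ (m + 1) := by
      have : 1 ≤ (2 * ((d : ℝ) + 2)) ^ (m + 1) :=
        one_le_pow₀ (by linarith [Nat.cast_nonneg (α := ℝ) d])
      linarith
    refine ⟨fun x => (habs x).trans (le_mul_of_one_le_left hAB hone), hF.2.1.mul hG.2.1,
      fun i => ?_⟩
    have hF' := hF.of_succ hθ hθ1
    have hG' := hG.of_succ hθ hθ1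
    rw [classicalPartial_mul hF.2.1 hG.2.1]
    have h1 := ih (hF.2.2 i) hG' hA hG'.nonneg (mul_nonneg hA hG'.nonneg) (fun x => by
      rw [Pi.mul_apply, abs_mul]
      exact mul_le_mul ((hF.2.2 i).abs_le x) (hG'.abs_le x) (abs_nonneg _) hA)
    have h2 := ih hF' (hG.2.2 i) hF'.nonneg hB (mul_nonneg hF'.nonneg hB) (fun x => by
      rw [Pi.mul_apply, abs_mul]
      exact mul_le_mul (hF'.abs_le x) ((hG.2.2 i).abs_le x) (abs_nonneg _) hF'.nonneg)
    -- Two Leibniz terms, each with one factor lowered by an order at the cost d + 2, give the ratio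
    -- 2(d + 2) per derivative.
    refine (h1.add h2).mono (le_of_eq ?_)
    ring

/-- The polynomial dependence on R is essential: forward in time R is exp(εn) up to constants, and
its powers must stay subexponential. -/
theorem HolderBound.exists_inv (d : ℕ) (hθ : 0 ≤ θ) (hθ1 : θ ≤ 1) (m : ℕ) :
    ∃ (K : ℝ) (N : ℕ), 1 ≤ K ∧ ∀ (F : EuclideanSpace ℝ (Fin d) → ℝ) (R : ℝ), 1 ≤ R →
      HolderBound θ m F R → (∀ x, R⁻¹ ≤ F x) → HolderBound θ m F⁻¹ (K * R ^ N) := by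
  have hinv : ∀ (F : EuclideanSpace ℝ (Fin d) → ℝ) (R : ℝ), 1 ≤ R → (∀ x, R⁻¹ ≤ F x) →
      ∀ x, |F⁻¹ x| ≤ R := by
    intro F R hR hF x
    have hR0 : 0 < R⁻¹ := by positivity
    have hx : 0 < F x := hR0.trans_le (hF x)
    rw [Pi.inv_apply, abs_of_pos (inv_pos.2 hx)]
    exact inv_le_of_inv_le₀ (by positivity) (hF x)
  induction m with
  | zero =>
    refine ⟨1, 3, le_rfl, fun F R hR h hF => ⟨fun x => ?_, fun x y => ?_⟩⟩
    · refine (hinv F R hR hF x).trans ?_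
      rw [one_mul]
      exact le_self_pow₀ hR (by norm_num)
    · have hR0 : 0 < R⁻¹ := by positivity
      have hx : 0 < F x := hR0.trans_le (hF x)
      have hy : 0 < F y := hR0.trans_le (hF y)
      have : F⁻¹ x - F⁻¹ y = -(F x - F y) * F⁻¹ x * F⁻¹ y := by
        simp only [Pi.inv_apply]
        field_simp
        ring
      rw [this, abs_mul, abs_mul, abs_neg]
      have hr : 0 ≤ dist x y ^ θ := Real.rpow_nonneg dist_nonneg _
      calc _ ≤ (R * dist x y ^ θ) * R * R := by
            gcongr
            · exact h.2 x y
            · exact hinv F R hR hF x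
            · exact hinv F R hR hF y
        _ = _ := by ring
  | succ m ih =>
    obtain ⟨K, N, hK, ih⟩ := ih
    set e : ℝ := d + 2 with he
    have he1 : 1 ≤ e := by rw [he]; linarith [Nat.cast_nonneg (α := ℝ) d]
    set c : ℝ := 2 * (2 * e) ^ m with hc
    have hc1 : 1 ≤ c := by
      have : 1 ≤ (2 * e) ^ m := one_le_pow₀ (by linarith)
      rw [hc]; linarith
    refine ⟨c * c * (K * e ^ N) ^ 2, 2 * N + 1, ?_, fun F R hR h hF => ⟨fun x => ?_, ?_,
      fun i => ?_⟩⟩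
    · have : 1 ≤ K * e ^ N := one_le_mul_of_one_le_of_one_le hK (one_le_pow₀ he1)
      exact one_le_mul_of_one_le_of_one_le (one_le_mul_of_one_le_of_one_le hc1 hc1)
        (one_le_pow₀ this)
    · have h1 : 1 ≤ K * e ^ N := one_le_mul_of_one_le_of_one_le hK (one_le_pow₀ he1)
      have h2 := one_le_mul_of_one_le_of_one_le (one_le_mul_of_one_le_of_one_le hc1 hc1)
        (one_le_pow₀ h1 (n := 2))
      refine (hinv F R hR hF x).trans ?_
      calc R ≤ R ^ (2 * N + 1) := le_self_pow₀ hR (by omega)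
        _ ≤ _ := le_mul_of_one_le_left (by positivity) h2
    · have hR0 : 0 < R⁻¹ := by positivity
      intro x
      exact (h.2.1 x).inv (hR0.trans_le (hF x)).ne'
    · have hR0 : 0 < R⁻¹ := by positivity
      rw [classicalPartial_inv h.2.1 fun x => (hR0.trans_le (hF x)).ne']
      -- At order m the bound for F is eR, so the induction hypothesis is applied with eR in place
      -- of R and the lower bound is weakened to match.
      have h' : HolderBound θ m F (e * R) := h.of_succ hθ hθ1
      have hI := ih F (e * R) (one_le_mul_of_one_le_of_one_le he1 hR) h' fun x =>
        (inv_anti₀ (by positivity) (le_mul_of_one_le_left (by positivity) he1)).trans (hF x)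
      refine (((h.2.2 i).mul hθ hθ1 (hI.mul hθ hθ1 hI)).neg).mono (le_of_eq ?_)
      rw [← he, ← hc, mul_pow]
      ring

theorem abs_log_sub_log_le {a b r : ℝ} (hr : 0 < r) (ha : r ≤ a) (hb : r ≤ b) :
    |Real.log a - Real.log b| ≤ r⁻¹ * |a - b| := by
  wlog hab : b ≤ a generalizing a b
  · rw [abs_sub_comm, abs_sub_comm a b]
    exact this hb ha (le_of_not_ge hab)
  have hb0 : 0 < b := hr.trans_le hb
  have ha0 : 0 < a := hr.trans_le ha
  rw [abs_of_nonneg (sub_nonneg.2 (Real.log_le_log hb0 hab)), abs_of_nonneg (sub_nonneg.2 hab),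
    ← Real.log_div ha0.ne' hb0.ne']
  calc Real.log (a / b) ≤ a / b - 1 := Real.log_le_sub_one_of_pos (by positivity)
    _ = b⁻¹ * (a - b) := by field_simp
    _ ≤ r⁻¹ * (a - b) := by
      have := inv_anti₀ hr hb
      have := sub_nonneg.2 hab
      gcongr

/-- Linearity in δ preserves the exponential rate when passing to logarithms, and the polynomial
factor in R does not affect it as long as R grows subexponentially. -/
theorem HolderBound.exists_log_sub_log (d : ℕ) (hθ : 0 ≤ θ) (hθ1 : θ ≤ 1) (m : ℕ) :
    ∃ (K : ℝ) (N : ℕ), 1 ≤ K ∧ ∀ (F G : EuclideanSpace ℝ (Fin d) → ℝ) (R δ : ℝ), 1 ≤ R →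
      HolderBound θ m F R → HolderBound θ m G R → (∀ x, R⁻¹ ≤ F x) → (∀ x, R⁻¹ ≤ G x) →
      HolderBound θ m (F - G) δ →
      HolderBound θ m (fun x => Real.log (F x) - Real.log (G x)) (K * R ^ N * δ) := by
  have habs : ∀ (F G : EuclideanSpace ℝ (Fin d) → ℝ) (R δ : ℝ), 1 ≤ R →
      (∀ x, R⁻¹ ≤ F x) → (∀ x, R⁻¹ ≤ G x) → (∀ x, |(F - G) x| ≤ δ) →
      ∀ x, |Real.log (F x) - Real.log (G x)| ≤ R * δ := by
    intro F G R δ hR hF hG h x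
    have hR0 : 0 < R⁻¹ := by positivity
    refine (abs_log_sub_log_le hR0 (hF x) (hG x)).trans ?_
    rw [inv_inv]
    gcongr
    exact h x
  cases m with
  | zero =>
    obtain ⟨K, N, hK, hinv⟩ := HolderBound.exists_inv d hθ hθ1 0
    refine ⟨2 * K, N + 2, by linarith, fun F G R δ hR hF hG hFR hGR h => ⟨fun x => ?_,
      fun x y => ?_⟩⟩
    · refine (habs F G R δ hR hFR hGR h.1 x).trans ?_
      have hδ := h.nonneg
      gcongr
      calc R ≤ R ^ (N + 2) := le_self_pow₀ hR (by omega)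
        _ ≤ _ := le_mul_of_one_le_left (by positivity) (by linarith)
    · have hR0 : 0 < R⁻¹ := by positivity
      have hI := hinv G R hR hG hGR
      have hQ := h.mul hθ hθ1 hI
      have hF0 : ∀ x, 0 < F x := fun x => hR0.trans_le (hFR x)
      have hG0 : ∀ x, 0 < G x := fun x => hR0.trans_le (hGR x)
      have hq : ∀ x, (R ^ 2)⁻¹ ≤ F x / G x := fun x => by
        rw [pow_two, mul_inv, div_eq_mul_inv]
        have : G x ≤ R := (le_abs_self _).trans (hG.1 x)
        have := inv_anti₀ (hG0 x) this
        exact mul_le_mul (hFR x) this hR0.le (hF0 x).le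
      have := abs_log_sub_log_le (by positivity) (hq x) (hq y)
      rw [Real.log_div (hF0 x).ne' (hG0 x).ne', Real.log_div (hF0 y).ne' (hG0 y).ne'] at this
      refine this.trans ?_
      -- F / G = 1 + (F - G) / G, so the increments of the quotient are linear in F - G.
      have h3 : F x / G x - F y / G y = ((F - G) * G⁻¹) x - ((F - G) * G⁻¹) y := by
        have := (hG0 x).ne'
        have := (hG0 y).ne'
        simp only [Pi.mul_apply, Pi.sub_apply, Pi.inv_apply]
        field_simp
        ring
      rw [h3, inv_inv]
      refine (mul_le_mul_of_nonneg_left (hQ.2 x y) (by positivity)).trans (le_of_eq ?_)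
      ring
  | succ m =>
    obtain ⟨K, N, hK, hinv⟩ := HolderBound.exists_inv d hθ hθ1 m
    set e : ℝ := d + 2 with he
    have he1 : 1 ≤ e := by rw [he]; linarith [Nat.cast_nonneg (α := ℝ) d]
    set c : ℝ := 2 * (2 * e) ^ m with hc
    have hc1 : 1 ≤ c := by
      have : 1 ≤ (2 * e) ^ m := one_le_pow₀ (by linarith)
      rw [hc]; linarith
    have hKe : 1 ≤ K * e ^ N := one_le_mul_of_one_le_of_one_le hK (one_le_pow₀ he1)
    have hC : 1 ≤ 2 * c ^ 3 * e * (K * e ^ N) ^ 2 := by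
      have h1 := one_le_mul_of_one_le_of_one_le (one_le_mul_of_one_le_of_one_le
        (one_le_pow₀ hc1 (n := 3)) he1) (one_le_pow₀ hKe (n := 2))
      linarith
    refine ⟨2 * c ^ 3 * e * (K * e ^ N) ^ 2, 2 * N + 1, hC,
      fun F G R δ hR hF hG hFR hGR h => ⟨fun x => ?_, ?_, fun i => ?_⟩⟩
    · refine (habs F G R δ hR hFR hGR h.1 x).trans ?_
      have hδ := h.nonneg
      gcongr
      calc R ≤ R ^ (2 * N + 1) := le_self_pow₀ hR (by omega)
        _ ≤ _ := le_mul_of_one_le_left (by positivity) hC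
    · have hR0 : 0 < R⁻¹ := by positivity
      intro x
      exact ((hF.2.1 x).log (hR0.trans_le (hFR x)).ne').sub
        ((hG.2.1 x).log (hR0.trans_le (hGR x)).ne')
    · have hR0 : 0 < R⁻¹ := by positivity
      have hF0 : ∀ x, F x ≠ 0 := fun x => (hR0.trans_le (hFR x)).ne'
      have hG0 : ∀ x, G x ≠ 0 := fun x => (hR0.trans_le (hGR x)).ne'
      have hlow : (e * R)⁻¹ ≤ R⁻¹ :=
        inv_anti₀ (by positivity) (le_mul_of_one_le_left (by positivity) he1)
      have hF' : HolderBound θ m F (e * R) := hF.of_succ hθ hθ1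
      have hG' : HolderBound θ m G (e * R) := hG.of_succ hθ hθ1
      have h' : HolderBound θ m (F - G) (e * δ) := h.of_succ hθ hθ1
      have heR : 1 ≤ e * R := one_le_mul_of_one_le_of_one_le he1 hR
      have hFI := hinv F (e * R) heR hF' fun x => hlow.trans (hFR x)
      have hGI := hinv G (e * R) heR hG' fun x => hlow.trans (hGR x)
      have hnum := ((h.2.2 i).mul hθ hθ1 hG').sub ((hG.2.2 i).mul hθ hθ1 h')
      have hall := hnum.mul hθ hθ1 (hFI.mul hθ hθ1 hGI)
      -- ∂F / F - ∂G / G over a common denominator, arranged so that every term of the numerator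
      -- contains F - G or its derivative.
      have hpart : classicalPartial i (fun x => Real.log (F x) - Real.log (G x)) =
          (classicalPartial i (F - G) * G - classicalPartial i G * (F - G)) * (F⁻¹ * G⁻¹) := by
        have hs : (fun x => Real.log (F x) - Real.log (G x)) =
            (fun x => Real.log (F x)) - fun x => Real.log (G x) := rfl
        rw [hs, classicalPartial_sub (fun x => (hF.2.1 x).log (hF0 x))
          (fun x => (hG.2.1 x).log (hG0 x)), classicalPartial_log hF.2.1 hF0,
          classicalPartial_log hG.2.1 hG0, classicalPartial_sub hF.2.1 hG.2.1]
        ext x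
        have := hF0 x
        have := hG0 x
        simp only [Pi.mul_apply, Pi.sub_apply, Pi.inv_apply]
        field_simp
        ring
      rw [hpart]
      refine hall.mono (le_of_eq ?_)
      rw [← he, ← hc, mul_pow]
      ring

end HolderCalculus

/-! ### Comparison of the recursive bounds with the Hölder norm -/

section HolderNorm

variable {d : ℕ} {θ : ℝ} {m : ℕ} {F G : EuclideanSpace ℝ (Fin d) → ℝ} {A B M : ℝ}

theorem HolderBound.continuous (h : HolderBound θ m F M) (hθ : 0 < θ) : Continuous F := by
  cases m with
  | zero =>
    have hM := h.nonneg
    have : HolderWith M.toNNReal θ.toNNReal F := by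
      intro x y
      rw [edist_dist, edist_dist, Real.dist_eq, Real.coe_toNNReal _ hθ.le,
        ENNReal.ofReal_rpow_of_nonneg dist_nonneg hθ.le,
        show ((M.toNNReal : ℝ≥0) : ℝ≥0∞) = ENNReal.ofReal M from rfl, ← ENNReal.ofReal_mul hM]
      exact ENNReal.ofReal_le_ofReal (h.2 x y)
    exact this.continuous (by simpa using hθ)
  | succ m => exact h.2.1.continuous

theorem HolderBound.contDiff (h : HolderBound θ m F M) (hθ : 0 < θ) : ContDiff ℝ m F := by
  induction m generalizing F with
  | zero => exact contDiff_zero.2 (h.continuous hθ)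
  | succ m ih =>
    have : ((m + 1 : ℕ) : WithTop ℕ∞) = (m : WithTop ℕ∞) + 1 := by norm_cast
    rw [this, contDiff_succ_iff_fderiv]
    refine ⟨h.2.1, fun h => absurd h (by simp), ?_⟩
    have he : fderiv ℝ F = fun x => ∑ i, classicalPartial i F x •
      (EuclideanSpace.proj i : EuclideanSpace ℝ (Fin d) →L[ℝ] ℝ) :=
      funext fun x => fderiv_eq_sum_classicalPartial F x
    rw [he]
    exact ContDiff.sum fun i _ => (ih (h.2.2 i)).smul contDiff_const

theorem contDiff_classicalPartial (hF : ContDiff ℝ (m + 1 : ℕ) F) (i : Fin d) :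
    ContDiff ℝ m (classicalPartial i F) :=
  (hF.fderiv_right (m := m) (by norm_cast)).clm_apply contDiff_const

theorem iteratedPartial_zero (s : Fin 0 → Fin d) (F : EuclideanSpace ℝ (Fin d) → ℝ) :
    iteratedPartial s F = F := by
  ext x
  simp [iteratedPartial]

/-- The last direction of the tuple is the one differentiated first, which matches the recursion of
`HolderBound`. -/
theorem iteratedPartial_succ (hF : ContDiff ℝ (m + 1 : ℕ) F) (s : Fin (m + 1) → Fin d) :
    iteratedPartial s F =
      iteratedPartial (Fin.init s) (classicalPartial (s (Fin.last m)) F) := by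
  ext x
  have hF' : ContDiff ℝ m (fderiv ℝ F) := hF.fderiv_right (m := m) (by norm_cast)
  have h := ContinuousLinearMap.iteratedFDeriv_comp_left
    (ContinuousLinearMap.apply ℝ ℝ (EuclideanSpace.single (s (Fin.last m)) (1 : ℝ)))
    hF'.contDiffAt (x := x) (i := m) le_rfl
  have he : classicalPartial (s (Fin.last m)) F = (ContinuousLinearMap.apply ℝ ℝ
      (EuclideanSpace.single (s (Fin.last m)) (1 : ℝ))) ∘ fderiv ℝ F := rfl
  rw [he, iteratedPartial, iteratedPartial, h, iteratedFDeriv_succ_apply_right]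
  rfl

theorem HolderBound.iteratedPartial (h : HolderBound θ m F M) (hθ : 0 < θ)
    (s : Fin m → Fin d) : HolderBound θ 0 (iteratedPartial s F) M := by
  induction m generalizing F with
  | zero => rwa [iteratedPartial_zero]
  | succ m ih =>
    rw [iteratedPartial_succ (h.contDiff hθ)]
    exact ih (h.2.2 _) _

theorem supNorm_le_ofReal (h : ∀ x, |F x| ≤ M) : supNorm F ≤ ENNReal.ofReal M := by
  refine iSup_le fun x => ?_
  rw [← ofReal_norm]
  exact ENNReal.ofReal_le_ofReal (h x)

theorem HolderBound.eHolderNorm_le (h : HolderBound θ 0 F M) (hθ : 0 < θ) :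
    eHolderNorm θ.toNNReal F ≤ ENNReal.ofReal M := by
  have : HolderWith M.toNNReal θ.toNNReal F := by
    intro x y
    rw [edist_dist, edist_dist, Real.dist_eq, Real.coe_toNNReal _ hθ.le,
      ENNReal.ofReal_rpow_of_nonneg dist_nonneg hθ.le,
      show ((M.toNNReal : ℝ≥0) : ℝ≥0∞) = ENNReal.ofReal M from rfl, ← ENNReal.ofReal_mul h.nonneg]
    exact ENNReal.ofReal_le_ofReal (h.2 x y)
  exact this.eHolderNorm_le

/-- The factor 3 counts the sup norm of F, the sup norm of the top derivatives and their Hölder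
quotient. -/
theorem HolderBound.holderNorm_le {α : ℝ} (h : HolderBound θ m F M) (hθ : 0 < θ)
    (hm : ⌊α⌋₊ = m) (hα : α - m = θ) : holderNorm α F ≤ ENNReal.ofReal (3 * M) := by
  subst hm
  have hM := h.nonneg
  have h1 : supNorm F ≤ ENNReal.ofReal M := supNorm_le_ofReal h.abs_le
  have h2 : holderSeminorm α F ≤ ENNReal.ofReal M + ENNReal.ofReal M := by
    rw [holderSeminorm, if_pos (h.contDiff hθ)]
    refine iSup_le fun s => add_le_add ?_ ?_
    · split_ifs
      · exact supNorm_le_ofReal (h.iteratedPartial hθ s).1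
      · exact zero_le
    · rw [hα]
      exact (h.iteratedPartial hθ s).eHolderNorm_le hθ
  refine (add_le_add h1 h2).trans (le_of_eq ?_)
  rw [← ENNReal.ofReal_add hM hM, ← ENNReal.ofReal_add hM (by linarith)]
  congr 1
  ring

/-! ### Periodic functions -/

/-- `F` has period one in every coordinate direction. -/
def UnitPeriodic (F : EuclideanSpace ℝ (Fin d) → ℝ) : Prop :=
  ∀ i x, F (x + EuclideanSpace.single i (1 : ℝ)) = F x

theorem unitPeriodic_periodicLift (f : Torus d → ℝ) : UnitPeriodic (periodicLift f) := by
  intro i x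
  refine congrArg f (funext fun j => ?_)
  by_cases hj : j = i
  · subst hj
    simp
  · simp [hj]

theorem UnitPeriodic.classicalPartial (h : UnitPeriodic F) (i : Fin d) :
    UnitPeriodic (classicalPartial i F) := by
  intro j x
  have h1 : (fun y => F (y + EuclideanSpace.single j (1 : ℝ))) = F := funext (h j)
  have h2 := fderiv_comp_add_right (𝕜 := ℝ) (f := F) (x := x) (EuclideanSpace.single j (1 : ℝ))
  rw [h1] at h2
  simp only [_root_.classicalPartial, h2]

theorem exists_classicalPartial_eq_slope (hF : Differentiable ℝ F) (i : Fin d) (x) {h : ℝ}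
    (hh : 0 < h) : ∃ c ∈ Ioo 0 h, classicalPartial i F (x + c • EuclideanSpace.single i (1 : ℝ)) =
      (F (x + h • EuclideanSpace.single i (1 : ℝ)) - F x) / h := by
  have hd : ∀ s : ℝ, HasDerivAt (fun s : ℝ => F (x + s • EuclideanSpace.single i (1 : ℝ)))
      (classicalPartial i F (x + s • EuclideanSpace.single i (1 : ℝ))) s := by
    intro s
    have h1 : HasDerivAt (fun s : ℝ => x + s • EuclideanSpace.single i (1 : ℝ))
        (EuclideanSpace.single i (1 : ℝ)) s := by
      simpa using ((hasDerivAt_id s).smul_const (EuclideanSpace.single i (1 : ℝ))).const_add x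
    exact (hF _).hasFDerivAt.comp_hasDerivAt s h1
  obtain ⟨c, hc, h2⟩ := exists_hasDerivAt_eq_slope _ _ hh
    (fun s _ => (hd s).continuousAt.continuousWithinAt) (fun s _ => hd s)
  exact ⟨c, hc, by simpa using h2⟩

/-- By Rolle on a period, ∂_i F vanishes at distance less than one from x in direction i; the mean
value theorem for ∂_i F does the rest. -/
theorem UnitPeriodic.abs_classicalPartial_le (hp : UnitPeriodic F) (hF : Differentiable ℝ F)
    {i : Fin d} (hF' : Differentiable ℝ (_root_.classicalPartial i F))
    (hM : ∀ x, |_root_.classicalPartial i (_root_.classicalPartial i F) x| ≤ M) (x) :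
    |_root_.classicalPartial i F x| ≤ M := by
  obtain ⟨c, hc, h⟩ := exists_classicalPartial_eq_slope hF i x one_pos
  rw [one_smul, hp, sub_self, zero_div] at h
  obtain ⟨c', -, h'⟩ := exists_classicalPartial_eq_slope hF' i x hc.1
  rw [h, zero_sub, eq_div_iff hc.1.ne'] at h'
  have h2 : |_root_.classicalPartial i F x| =
      |_root_.classicalPartial i (_root_.classicalPartial i F)
      (x + c' • EuclideanSpace.single i (1 : ℝ))| * c := by
    rw [← abs_neg, ← h', abs_mul, abs_of_pos hc.1]
  rw [h2]
  have := hM (x + c' • EuclideanSpace.single i (1 : ℝ))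
  nlinarith [hc.1, hc.2, abs_nonneg (_root_.classicalPartial i (_root_.classicalPartial i F)
      (x + c' • EuclideanSpace.single i (1 : ℝ)))]

/-- The norm of C^β sees only F and the derivatives of top order. For periodic functions the
intermediate orders are recovered by descending one order at a time. -/
theorem UnitPeriodic.abs_classicalPartial_le_of_iteratedPartial (hp : UnitPeriodic F)
    (hF : ContDiff ℝ (m + 1 : ℕ) F)
    (hM : ∀ (s : Fin (m + 1) → Fin d) x, |iteratedPartial s F x| ≤ M)
    (i : Fin d) (x) : |_root_.classicalPartial i F x| ≤ M := by
  induction m generalizing F i x with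
  | zero =>
    have := hM (fun _ => i) x
    rwa [iteratedPartial_succ hF, iteratedPartial_zero] at this
  | succ m ih =>
    have hF' := contDiff_classicalPartial hF i
    refine hp.abs_classicalPartial_le (hF.differentiable (by norm_cast))
      (hF'.differentiable (by norm_cast)) (fun y => ?_) x
    refine ih (hp.classicalPartial i) hF' (fun s y => ?_) i y
    have := hM (Fin.snoc s i) y
    rw [iteratedPartial_succ hF] at this
    simpa using this

theorem UnitPeriodic.holderBound (hp : UnitPeriodic F) (hF : ContDiff ℝ m F)
    (h0 : ∀ x, |F x| ≤ M) (hM : ∀ s : Fin m → Fin d, HolderBound θ 0 (iteratedPartial s F) M) :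
    HolderBound θ m F M := by
  induction m generalizing F with
  | zero => simpa [iteratedPartial_zero] using hM Fin.elim0
  | succ m ih =>
    refine ⟨h0, hF.differentiable (by norm_cast), fun i => ?_⟩
    refine ih (hp.classicalPartial i) (contDiff_classicalPartial hF i)
      (hp.abs_classicalPartial_le_of_iteratedPartial hF (fun s => (hM s).1) i) fun s => ?_
    have := hM (Fin.snoc s i)
    rw [iteratedPartial_succ hF] at this
    simpa using this

/-- Strictly below the top order all derivatives are Lipschitz, so the exponent is 1 there. -/
theorem UnitPeriodic.holderBound_one (hp : UnitPeriodic F) (hF : ContDiff ℝ (m + 1 : ℕ) F)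
    (h0 : ∀ x, |F x| ≤ M) (hM : ∀ (s : Fin (m + 1) → Fin d) x, |iteratedPartial s F x| ≤ M) :
    HolderBound 1 m F ((d + 1) * M) := by
  have hM0 : 0 ≤ M := (abs_nonneg _).trans (h0 0)
  have hdM : 0 ≤ d * M := by positivity
  induction m generalizing F with
  | zero =>
    refine ⟨fun x => (h0 x).trans (by linarith), fun x y => ?_⟩
    have := abs_sub_le_of_classicalPartial (hF.differentiable (by norm_cast))
      (hp.abs_classicalPartial_le_of_iteratedPartial hF hM) x y
    rw [Real.rpow_one]
    nlinarith [dist_nonneg (x := x) (y := y)]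
  | succ m ih =>
    refine ⟨fun x => (h0 x).trans (by linarith), hF.differentiable (by norm_cast), fun i => ?_⟩
    refine ih (hp.classicalPartial i) (contDiff_classicalPartial hF i)
      (hp.abs_classicalPartial_le_of_iteratedPartial hF hM i) fun s x => ?_
    have := hM (Fin.snoc s i) x
    rw [iteratedPartial_succ hF] at this
    simpa using this

theorem HolderBound.of_order_le {k : ℕ} (hkm : k ≤ m) (h : HolderBound θ m F M) (hθ : 0 ≤ θ)
    (hθ1 : θ ≤ 1) : HolderBound θ k F ((d + 2) ^ (m - k) * M) := by
  induction m, hkm using Nat.le_induction generalizing M with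
  | base => simpa using h
  | succ n hn ih =>
    have := ih (h.of_succ hθ hθ1)
    rwa [Nat.succ_sub hn, pow_succ, mul_assoc]

theorem abs_le_of_supNorm_le (hM : 0 ≤ M) (h : supNorm F ≤ ENNReal.ofReal M) (x) : |F x| ≤ M := by
  have := (le_iSup (fun x => ‖F x‖ₑ) x).trans h
  rw [← ofReal_norm, ENNReal.ofReal_le_ofReal_iff hM] at this
  exact this

/-- A bound for the `C^β` norm of a periodic function controls all Hölder norms of order at most
`β`. -/
theorem UnitPeriodic.holderBound_of_holderNorm_le {β : ℝ} (hp : UnitPeriodic F) (hM : 0 ≤ M)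
    (h : holderNorm β F ≤ ENNReal.ofReal M) (hθ : 0 < θ) (hθ1 : θ ≤ 1) (hm : m + θ ≤ β) :
    HolderBound θ m F (3 * (d + 2) ^ (⌊β⌋₊ + 1) * M) := by
  have hβ : 0 ≤ β := by linarith [Nat.cast_nonneg (α := ℝ) m]
  have h0 : ∀ x, |F x| ≤ M := abs_le_of_supNorm_le hM (le_self_add.trans h)
  have h1 : holderSeminorm β F ≤ ENNReal.ofReal M := le_add_self.trans h
  have hC : ContDiff ℝ ⌊β⌋₊ F := by
    by_contra hC
    rw [holderSeminorm, if_neg hC] at h1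
    simp at h1
  rw [holderSeminorm, if_pos hC] at h1
  have h2 := fun s => (le_iSup (fun s : Fin ⌊β⌋₊ → Fin d =>
      ((if 0 < ⌊β⌋₊ then supNorm (iteratedPartial s F) else 0) +
        eHolderNorm (β - ⌊β⌋₊).toNNReal (iteratedPartial s F))) s).trans h1
  have hd2 : (1 : ℝ) ≤ d + 2 := by linarith [Nat.cast_nonneg (α := ℝ) d]
  have hpow : ∀ n, (1 : ℝ) ≤ (d + 2) ^ n := fun n => one_le_pow₀ hd2
  have hsup : 0 < ⌊β⌋₊ → ∀ (s : Fin ⌊β⌋₊ → Fin d) x, |iteratedPartial s F x| ≤ M := by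
    intro hpos s
    have := h2 s
    rw [if_pos hpos] at this
    exact abs_le_of_supNorm_le hM (le_self_add.trans this)
  have hmle : m ≤ ⌊β⌋₊ := Nat.le_floor (by linarith)
  -- At the top order the Hölder quotient of the norm is used; below it, the Lipschitz bound,
  -- followed by lowering first the order and then the exponent.
  rcases hmle.eq_or_lt with rfl | hlt
  · have hθβ : θ ≤ β - ⌊β⌋₊ := by linarith
    have hs : ∀ s : Fin ⌊β⌋₊ → Fin d, HolderBound (β - ⌊β⌋₊) 0 (iteratedPartial s F) M := by
      intro s
      refine ⟨fun x => ?_, fun x y => ?_⟩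
      -- For ⌊β⌋ = 0 the seminorm has no sup term, and the bound is that of F itself.
      · rcases Nat.eq_zero_or_pos ⌊β⌋₊ with hz | hpos
        · generalize ⌊β⌋₊ = k at hz s
          subst hz
          rw [iteratedPartial_zero]
          exact h0 x
        · exact hsup hpos s x
      · have he : eHolderNorm (β - ⌊β⌋₊).toNNReal (iteratedPartial s F) ≤ ENNReal.ofReal M :=
          le_add_self.trans (h2 s)
        have hmem : MemHolder (β - ⌊β⌋₊).toNNReal (iteratedPartial s F) :=
          eHolderNorm_lt_top.1 (he.trans_lt ENNReal.ofReal_lt_top)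
        have hle := hmem.holderWith.dist_le x y
        rw [Real.coe_toNNReal _ (hθ.le.trans hθβ), Real.dist_eq] at hle
        refine hle.trans ?_
        have hr := Real.rpow_nonneg (dist_nonneg (x := x) (y := y)) (β - ⌊β⌋₊)
        gcongr
        rw [← hmem.coe_nnHolderNorm_eq_eHolderNorm] at he
        have := ENNReal.toReal_mono ENNReal.ofReal_ne_top he
        rwa [ENNReal.coe_toReal, ENNReal.toReal_ofReal hM] at this
    refine ((hp.holderBound hC h0 hs).of_exponent_le hθ.le hθβ).mono ?_
    have := hpow (⌊β⌋₊ + 1)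
    nlinarith
  · obtain ⟨N, hN⟩ : ∃ N, ⌊β⌋₊ = N + 1 := ⟨⌊β⌋₊ - 1, by omega⟩
    rw [hN] at hsup hC hlt
    have h3 := hp.holderBound_one hC h0 (hsup (by omega))
    have h4 := (h3.of_order_le (k := m) (by omega) zero_le_one le_rfl).of_exponent_le hθ.le hθ1
    refine h4.mono ?_
    rw [hN]
    have h5 : ((d : ℝ) + 2) ^ (N - m) ≤ (d + 2) ^ (N + 1) := pow_le_pow_right₀ hd2 (by omega)
    have h6 : (d : ℝ) + 1 ≤ d + 2 := by linarith
    have h7 : ((d : ℝ) + 1) * M ≤ (d + 2) * M := by gcongr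
    calc 3 * (((d : ℝ) + 2) ^ (N - m) * ((d + 1) * M))
        ≤ 3 * (((d : ℝ) + 2) ^ (N + 1) * ((d + 2) * M)) := by gcongr
      _ = _ := by ring

/-- Interpolation between the sup norm and a stronger Hölder bound, without a rate; it serves only
the continuity of the stationary solution in time. At order zero the stronger bound handles close
points and the sup norm distant ones. A derivative is compared with a difference quotient. -/
theorem HolderBound.exists_interpolation (hθ : 0 ≤ θ) {s : ℝ} (hθs : θ < s) (hs : s ≤ 1) (m : ℕ)
    (M : ℝ) {δ : ℝ} (hδ : 0 < δ) : ∃ ε > 0, ∀ F : EuclideanSpace ℝ (Fin d) → ℝ,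
      HolderBound s m F M → (∀ x, |F x| ≤ ε) → HolderBound θ m F δ := by
  have small : ∀ {p : ℝ} (_ : 0 < p) (L : ℝ) (_ : 0 ≤ L) {a : ℝ} (_ : 0 < a),
      ∃ ρ > 0, L * ρ ^ p ≤ a := by
    intro p hp L hL a ha
    refine ⟨(a / (L + 1)) ^ p⁻¹, by positivity, ?_⟩
    rw [← Real.rpow_mul (by positivity), inv_mul_cancel₀ hp.ne', Real.rpow_one, mul_div_assoc',
      div_le_iff₀ (by positivity)]
    nlinarith
  induction m with
  | zero =>
    obtain ⟨ρ, hρ, hρM⟩ := small (sub_pos.2 hθs) |M| (abs_nonneg M) hδ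
    refine ⟨min δ (δ * ρ ^ θ / 2), by positivity, fun F hF hε => ⟨fun x =>
      (hε x).trans (min_le_left _ _), fun x y => ?_⟩⟩
    have hr := dist_nonneg (x := x) (y := y)
    rcases le_or_gt (dist x y) ρ with h | h
    · rcases hr.eq_or_lt with h0 | h0
      · rw [eq_comm, dist_eq_zero] at h0
        subst h0
        simp only [sub_self, abs_zero]
        positivity
      · have h1 : dist x y ^ s = dist x y ^ (s - θ) * dist x y ^ θ := by
          rw [← Real.rpow_add h0]; ring_nf
        have h2 := hF.2 x y
        rw [h1, ← mul_assoc] at h2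
        refine h2.trans (mul_le_mul_of_nonneg_right ?_ (Real.rpow_nonneg hr _))
        calc M * dist x y ^ (s - θ) ≤ |M| * ρ ^ (s - θ) :=
              mul_le_mul (le_abs_self M) (Real.rpow_le_rpow hr h (sub_pos.2 hθs).le)
                (Real.rpow_nonneg hr _) (abs_nonneg M)
          _ ≤ δ := hρM
    · have h1 := Real.rpow_le_rpow hρ.le h.le hθ
      have h2 : |F x - F y| ≤ δ * ρ ^ θ := by
        have hx := (hε x).trans (min_le_right _ _)
        have hy := (hε y).trans (min_le_right _ _)
        linarith [abs_sub (F x) (F y)]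
      exact h2.trans (by gcongr)
  | succ m ih =>
    obtain ⟨ε', hε', ih⟩ := ih
    -- The step h is so small that ∂F varies by at most ε' / 2 over it; then |F| ≤ ε' h / 4 makes
    -- the slope over h at most ε' / 2.
    obtain ⟨h, hh, hhM⟩ := small (hθ.trans_lt hθs) ((d + 2) ^ m * |M|) (by positivity)
      (half_pos hε')
    refine ⟨min δ (ε' * h / 4), by positivity, fun F hF hε => ⟨fun x =>
      (hε x).trans (min_le_left _ _), hF.2.1, fun i => ih _ (hF.2.2 i) fun x => ?_⟩⟩
    obtain ⟨c, hc, hslope⟩ := exists_classicalPartial_eq_slope hF.2.1 i x hh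
    have h0 := ((hF.2.2 i).of_order_le (Nat.zero_le m) (hθ.trans hθs.le) hs).2 x
      (x + c • EuclideanSpace.single i (1 : ℝ))
    have hdist : dist x (x + c • EuclideanSpace.single i (1 : ℝ)) = c := by
      rw [dist_self_add_right, norm_smul, PiLp.norm_single, norm_one, mul_one,
        Real.norm_of_nonneg hc.1.le]
    rw [hdist, Nat.sub_zero] at h0
    have hM := hF.nonneg
    have h1 : ((d : ℝ) + 2) ^ m * M * c ^ s ≤ ε' / 2 := by
      refine le_trans ?_ hhM
      rw [abs_of_nonneg hM]
      have := Real.rpow_le_rpow hc.1.le hc.2.le (hθ.trans hθs.le)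
      gcongr
    have h2 : |classicalPartial i F (x + c • EuclideanSpace.single i (1 : ℝ))| ≤ ε' / 2 := by
      rw [hslope, abs_div, abs_of_pos hh, div_le_iff₀ hh]
      have hx := (hε x).trans (min_le_right _ _)
      have hy := (hε (x + h • EuclideanSpace.single i (1 : ℝ))).trans (min_le_right _ _)
      linarith [abs_sub (F (x + h • EuclideanSpace.single i (1 : ℝ))) (F x)]
    calc |classicalPartial i F x| = |(classicalPartial i F x -
          classicalPartial i F (x + c • EuclideanSpace.single i (1 : ℝ))) +
          classicalPartial i F (x + c • EuclideanSpace.single i (1 : ℝ))| := by ring_nf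
      _ ≤ _ := abs_add_le _ _
      _ ≤ ε' / 2 + ε' / 2 := add_le_add (h0.trans h1) h2
      _ = ε' := by ring

end HolderNorm

/-! ### The Besov norm of a gradient -/

section Besov

open UnitAddTorus FourierTransform SchwartzMap

variable {d : ℕ}

/-- The quotient map from Euclidean space onto the torus. -/
def torusMk (y : EuclideanSpace ℝ (Fin d)) : Torus d := fun i => ((y i : ℝ) : UnitAddCircle)

theorem continuous_torusMk : Continuous (torusMk (d := d)) := by
  refine continuous_pi fun i => ?_
  exact (AddCircle.continuous_mk' 1).comp (EuclideanSpace.proj i).continuous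

theorem torusMk_surjective : Function.Surjective (torusMk (d := d)) := by
  intro x
  choose y hy using fun i => QuotientAddGroup.mk_surjective (x i)
  exact ⟨WithLp.toLp 2 y, funext hy⟩

/-- An integer vector as a point of Euclidean space. -/
def latticeVec (k : Fin d → ℤ) : EuclideanSpace ℝ (Fin d) := WithLp.toLp 2 fun i => (k i : ℝ)

theorem finite_latticeVec_norm_le (R : ℝ) : {k : Fin d → ℤ | ‖latticeVec k‖ ≤ R}.Finite := by
  refine (Set.finite_Icc (fun _ : Fin d => -⌈R⌉) (fun _ => ⌈R⌉)).subset fun k hk => ?_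
  have h : ∀ i, |(k i : ℝ)| ≤ R := fun i => by
    have := PiLp.norm_apply_le (latticeVec k) i
    exact (by simpa [latticeVec] using this : |(k i : ℝ)| ≤ ‖latticeVec k‖).trans hk
  refine ⟨fun i => ?_, fun i => ?_⟩
  · have : (-(⌈R⌉ : ℝ)) ≤ k i := by linarith [(abs_le.1 (h i)).1, Int.le_ceil R]
    exact_mod_cast this
  · have : (k i : ℝ) ≤ ⌈R⌉ := by linarith [(abs_le.1 (h i)).2, Int.le_ceil R]
    exact_mod_cast this

theorem mFourier_torusMk (k : Fin d → ℤ) (y : EuclideanSpace ℝ (Fin d)) :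
    mFourier k (torusMk y) = Complex.exp (2 * Real.pi * (inner ℝ y (latticeVec k) : ℝ) *
      Complex.I) := by
  have : mFourier k (torusMk y) = ∏ i, fourier (k i) ((y i : ℝ) : UnitAddCircle) := rfl
  rw [this]
  simp only [fourier_coe_apply]
  rw [← Complex.exp_sum]
  congr 1
  simp only [PiLp.inner_apply, latticeVec, RCLike.inner_apply, conj_trivial, Complex.ofReal_sum,
    Finset.mul_sum, Finset.sum_mul]
  refine Finset.sum_congr rfl fun i _ => ?_
  push_cast
  ring

theorem mFourierCoeff_mFourier (k n : Fin d → ℤ) :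
    mFourierCoeff (fun x => mFourier k x) n = if n = k then 1 else 0 := by
  have h1 := mFourierBasis_repr (mFourierLp 2 k) n
  rw [mFourierCoeff_toLp] at h1
  rw [← h1, ← coe_mFourierBasis, HilbertBasis.repr_self]
  simp [lp.single_apply, Pi.single_apply]

instance : IsProbabilityMeasure (torusMeasure d) := by
  unfold torusMeasure
  infer_instance

theorem mFourierCoeff_eq (f : Torus d → ℂ) (n : Fin d → ℤ) :
    mFourierCoeff f n = ∫ t, mFourier (-n) t * f t ∂torusMeasure d := rfl

theorem integrable_torus {E : Type*} [NormedAddCommGroup E] {f : Torus d → E}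
    (hf : Continuous f) : Integrable f (torusMeasure d) :=
  hf.integrable_of_hasCompactSupport (HasCompactSupport.of_compactSpace f)

/-- A Fourier coefficient as a continuous linear functional. -/
noncomputable def coeffCLM (n : Fin d → ℤ) : C(Torus d, ℂ) →L[ℂ] ℂ :=
  LinearMap.mkContinuous
    { toFun := fun f => mFourierCoeff (fun x => f x) n
      map_add' := fun f g => by
        simp only [mFourierCoeff_eq, ContinuousMap.add_apply, mul_add]
        exact integral_add (integrable_torus (by fun_prop)) (integrable_torus (by fun_prop))
      map_smul' := fun c f => by
        simp only [mFourierCoeff_eq, ContinuousMap.smul_apply, smul_eq_mul, RingHom.id_apply]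
        rw [← integral_const_mul]
        congr 1
        ext t
        ring }
    1 fun f => by
      have : ∀ t, ‖mFourier (-n) t * f t‖ ≤ ‖f‖ := fun t => by
        rw [norm_mul]
        have h1 := (mFourier (-n)).norm_coe_le_norm t
        rw [mFourier_norm] at h1
        calc _ ≤ 1 * ‖f‖ := mul_le_mul h1 (f.norm_coe_le_norm t) (norm_nonneg _) zero_le_one
          _ = ‖f‖ := one_mul _
      have h2 := norm_integral_le_of_norm_le_const (μ := torusMeasure d)
        (Eventually.of_forall this)
      simpa [mFourierCoeff_eq] using h2

/-- The convolution with a dilated Schwartz function as a continuous linear functional. -/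
noncomputable def convCLM (ψ : 𝓢(EuclideanSpace ℝ (Fin d), ℂ)) (c : ℝ)
    (x : EuclideanSpace ℝ (Fin d)) : C(Torus d, ℂ) →L[ℂ] ℂ :=
  have hInt : ∀ f : C(Torus d, ℂ), Integrable fun y => ψ y * f (torusMk (x - c • y)) := by
    intro f
    refine ψ.integrable.mul_bdd (c := ‖f‖) ?_ (Eventually.of_forall fun y => f.norm_coe_le_norm _)
    exact (f.continuous.comp (continuous_torusMk.comp
      (continuous_const.sub (continuous_const_smul c)))).aestronglyMeasurable
  LinearMap.mkContinuous
    { toFun := fun f => ∫ y, ψ y * f (torusMk (x - c • y))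
      map_add' := fun f g => by
        simp only [ContinuousMap.add_apply, mul_add]
        exact integral_add (hInt f) (hInt g)
      map_smul' := fun a f => by
        simp only [ContinuousMap.smul_apply, smul_eq_mul, RingHom.id_apply]
        rw [← integral_const_mul]
        congr 1
        ext t
        ring }
    (∫ y, ‖ψ y‖) fun f => by
      rw [← integral_mul_const]
      refine norm_integral_le_of_norm_le (ψ.integrable.norm.mul_const _)
        (Eventually.of_forall fun y => ?_)
      rw [norm_mul]
      exact mul_le_mul_of_nonneg_left (f.norm_coe_le_norm _) (norm_nonneg _)

/-- Characters are eigenvectors of a convolution, and Fourier inversion on ℝ^d identifies the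
eigenvalue as the symbol at the dilated frequency. -/
theorem convCLM_mFourier (a : 𝓢(EuclideanSpace ℝ (Fin d), ℂ)) (c : ℝ)
    (x : EuclideanSpace ℝ (Fin d)) (k : Fin d → ℤ) :
    convCLM (𝓕⁻ a) c x (mFourier k) = a (c • latticeVec k) * mFourier k (torusMk x) := by
  have h1 : a (c • latticeVec k) = 𝓕 (𝓕⁻ a) (c • latticeVec k) := by
    rw [FourierTransform.fourier_fourierInv_eq]
  rw [h1, SchwartzMap.fourier_coe, Real.fourier_eq', ← integral_mul_const]
  change ∫ y, (𝓕⁻ a) y * mFourier k (torusMk (x - c • y)) = _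
  refine integral_congr_ae (Eventually.of_forall fun y => ?_)
  simp only [mFourier_torusMk, inner_sub_left, inner_smul_left, inner_smul_right, smul_eq_mul,
    conj_trivial]
  have hexp : Complex.exp (2 * Real.pi * ((inner ℝ x (latticeVec k) -
      c * inner ℝ y (latticeVec k) : ℝ) : ℂ) * Complex.I) =
      Complex.exp (((-2 * Real.pi * (c * inner ℝ y (latticeVec k)) : ℝ) : ℂ) * Complex.I) *
      Complex.exp (2 * Real.pi * ((inner ℝ x (latticeVec k) : ℝ) : ℂ) * Complex.I) := by
    rw [← Complex.exp_add]
    congr 1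
    push_cast
    ring
  rw [hexp]
  ring

/-- The support condition makes the sum finite, so both sides are continuous linear functionals of
f. They agree on characters, whose span is dense. This replaces Poisson summation. -/
theorem tsum_multiplier_eq_convCLM (a : 𝓢(EuclideanSpace ℝ (Fin d), ℂ)) {R : ℝ}
    (ha : ∀ ξ, a ξ ≠ 0 → ‖ξ‖ ≤ R) {c : ℝ} (hc : 0 < c) (x : EuclideanSpace ℝ (Fin d))
    (f : C(Torus d, ℂ)) :
    ∑' k, a (c • latticeVec k) * mFourierCoeff (fun x => f x) k * mFourier k (torusMk x) =
      convCLM (𝓕⁻ a) c x f := by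
  have hfin := finite_latticeVec_norm_le (d := d) (R / c)
  have hzero : ∀ k ∉ hfin.toFinset, a (c • latticeVec k) = 0 := by
    intro k hk
    by_contra h
    have := ha _ h
    rw [norm_smul, Real.norm_of_nonneg hc.le] at this
    exact hk (hfin.mem_toFinset.2 ((le_div_iff₀' hc).2 this))
  rw [tsum_eq_sum (s := hfin.toFinset) fun k hk => by rw [hzero k hk, zero_mul, zero_mul]]
  let L : C(Torus d, ℂ) →L[ℂ] ℂ := ∑ k ∈ hfin.toFinset,
    (a (c • latticeVec k) * mFourier k (torusMk x)) • coeffCLM k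
  have hL : ∀ f, L f = ∑ k ∈ hfin.toFinset,
      a (c • latticeVec k) * mFourierCoeff (fun x => f x) k * mFourier k (torusMk x) := by
    intro f
    simp only [L, _root_.sum_apply, _root_.smul_apply, smul_eq_mul]
    refine Finset.sum_congr rfl fun k _ => ?_
    change _ * mFourierCoeff (fun x => f x) k = _
    ring
  rw [← hL]
  have hEq : L = convCLM (𝓕⁻ a) c x := by
    refine ContinuousLinearMap.ext_on (s := range mFourier) ?_ ?_
    · rw [Submodule.dense_iff_topologicalClosure_eq_top]
      exact span_mFourier_closure_eq_top
    · rintro _ ⟨k, rfl⟩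
      rw [hL, convCLM_mFourier]
      simp only [mFourierCoeff_mFourier]
      by_cases hk : k ∈ hfin.toFinset
      · rw [Finset.sum_eq_single k]
        · simp
        · intro b _ hb
          simp [hb]
        · exact fun h => absurd hk h
      · rw [hzero k hk, zero_mul]
        refine Finset.sum_eq_zero fun b hb => ?_
        have : b ≠ k := fun h => hk (h ▸ hb)
        simp [this]
  rw [hEq]

/-- A kernel of mean zero allows f(x) to be subtracted under the integral; the dilation then yields
c ^ θ. -/
theorem norm_convCLM_le (ψ : 𝓢(EuclideanSpace ℝ (Fin d), ℂ)) (hψ : ∫ y, ψ y = 0) {c θ M : ℝ}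
    (hc : 0 < c) (hθ : 0 < θ) (hθ1 : θ ≤ 1) (f : C(Torus d, ℂ))
    (hf : ∀ x y, ‖f (torusMk x) - f (torusMk y)‖ ≤ M * dist x y ^ θ)
    (x : EuclideanSpace ℝ (Fin d)) :
    ‖convCLM ψ c x f‖ ≤ M * c ^ θ * ∫ y, ‖ψ y‖ * ‖y‖ ^ θ := by
  have hInt : Integrable fun y => ψ y * f (torusMk (x - c • y)) := by
    refine ψ.integrable.mul_bdd (c := ‖f‖) ?_ (Eventually.of_forall fun y => f.norm_coe_le_norm _)
    exact (f.continuous.comp (continuous_torusMk.comp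
      (continuous_const.sub (continuous_const_smul c)))).aestronglyMeasurable
  have h1 : convCLM ψ c x f = ∫ y, ψ y * (f (torusMk (x - c • y)) - f (torusMk x)) := by
    simp only [mul_sub]
    rw [integral_sub hInt (ψ.integrable.mul_const _), integral_mul_const, hψ, zero_mul, sub_zero]
    rfl
  rw [h1, ← integral_const_mul]
  have hIntθ : Integrable fun y => ‖ψ y‖ * ‖y‖ ^ θ := by
    -- The moment of order θ is dominated by ‖y‖ ^ θ ≤ 1 + ‖y‖.
    have hdom : Integrable fun y => ‖y‖ ^ 0 * ‖ψ y‖ + ‖y‖ ^ 1 * ‖ψ y‖ :=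
      (ψ.integrable_pow_mul volume 0).add (ψ.integrable_pow_mul volume 1)
    refine hdom.mono' ?_ (Eventually.of_forall fun y => ?_)
    · exact (ψ.continuous.norm.mul
        (continuous_norm.rpow_const fun _ => Or.inr hθ.le)).aestronglyMeasurable
    · rw [Real.norm_of_nonneg (by positivity)]
      have h2 : ‖y‖ ^ θ ≤ 1 + ‖y‖ := by
        rcases le_or_gt ‖y‖ 1 with h | h
        · linarith [Real.rpow_le_one (norm_nonneg y) h hθ.le, norm_nonneg y]
        · have := Real.rpow_le_rpow_of_exponent_le h.le hθ1
          rw [Real.rpow_one] at this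
          linarith
      nlinarith [norm_nonneg (ψ y)]
  refine norm_integral_le_of_norm_le (hIntθ.const_mul _) (Eventually.of_forall fun y => ?_)
  rw [norm_mul]
  have h3 := hf (x - c • y) x
  rw [dist_eq_norm, sub_sub_cancel_left, norm_neg, norm_smul, Real.norm_of_nonneg hc.le,
    Real.mul_rpow hc.le (norm_nonneg y)] at h3
  calc _ ≤ ‖ψ y‖ * (M * (c ^ θ * ‖y‖ ^ θ)) := by gcongr
    _ = _ := by ring

/-- The symbol `2πi ξ_i g(ξ)` as a Schwartz function. -/
theorem exists_derivative_symbol {g : EuclideanSpace ℝ (Fin d) → ℝ} {R : ℝ}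
    (hg : ContDiff ℝ (⊤ : ℕ∞) g) (hR : ∀ ξ, g ξ ≠ 0 → ‖ξ‖ ≤ R) (i : Fin d) :
    ∃ a : 𝓢(EuclideanSpace ℝ (Fin d), ℂ), ∀ ξ,
      a ξ = 2 * Real.pi * Complex.I * (ξ i : ℂ) * (g ξ : ℂ) := by
  have hsm : ContDiff ℝ (⊤ : ℕ∞) fun ξ : EuclideanSpace ℝ (Fin d) =>
      2 * Real.pi * Complex.I * (ξ i : ℂ) * (g ξ : ℂ) := by
    have h1 : ContDiff ℝ (⊤ : ℕ∞) fun ξ : EuclideanSpace ℝ (Fin d) => (ξ i : ℂ) :=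
      Complex.ofRealCLM.contDiff.comp
        (EuclideanSpace.proj i : EuclideanSpace ℝ (Fin d) →L[ℝ] ℝ).contDiff
    have h2 : ContDiff ℝ (⊤ : ℕ∞) fun ξ : EuclideanSpace ℝ (Fin d) => (g ξ : ℂ) :=
      Complex.ofRealCLM.contDiff.comp hg
    exact (contDiff_const.mul h1).mul h2
  have hcs : HasCompactSupport fun ξ : EuclideanSpace ℝ (Fin d) =>
      2 * Real.pi * Complex.I * (ξ i : ℂ) * (g ξ : ℂ) := by
    refine HasCompactSupport.intro (isCompact_closedBall (0 : EuclideanSpace ℝ (Fin d)) R)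
      fun ξ hξ => ?_
    have : g ξ = 0 := by
      by_contra h
      exact hξ (by simpa using hR ξ h)
    simp [this]
  exact ⟨hcs.toSchwartzMap hsm, fun ξ => rfl⟩

/-- Writing ξ_i g(cξ) as c⁻¹ times the dilated symbol η_i g(η) gains c⁻¹, and the kernel of that
symbol has mean zero. The constant I is uniform in the scale c. -/
theorem exists_norm_paleyBlock_le {g : EuclideanSpace ℝ (Fin d) → ℝ} {R : ℝ}
    (hg : ContDiff ℝ (⊤ : ℕ∞) g) (hR : ∀ ξ, g ξ ≠ 0 → ‖ξ‖ ≤ R) (i : Fin d) {θ : ℝ} (hθ : 0 < θ)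
    (hθ1 : θ ≤ 1) : ∃ I : ℝ, 0 ≤ I ∧ ∀ (c : ℝ), 0 < c → ∀ (M : ℝ) (f : TorusFn d),
      (∀ x y, |f (torusMk x) - f (torusMk y)| ≤ M * dist x y ^ θ) → ∀ x,
        ‖paleyBlock (fun ξ => g (c • ξ)) (partialCoeff i f) x‖ ≤ c⁻¹ * (M * c ^ θ * I) := by
  obtain ⟨a, ha⟩ := exists_derivative_symbol hg hR i
  refine ⟨∫ y, ‖(𝓕⁻ a) y‖ * ‖y‖ ^ θ, integral_nonneg fun y => by positivity,
    fun c hc M f hf x => ?_⟩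
  obtain ⟨x, rfl⟩ := torusMk_surjective x
  have haR : ∀ ξ, a ξ ≠ 0 → ‖ξ‖ ≤ R := fun ξ h => hR ξ fun h0 => h (by rw [ha, h0]; simp)
  let fc : C(Torus d, ℂ) := ⟨fun x => (f x : ℂ), Complex.continuous_ofReal.comp f.continuous⟩
  -- The integral of the kernel is its symbol at the origin, where the factor ξ_i vanishes.
  have hψ : ∫ y, (𝓕⁻ a) y = 0 := by
    have h1 : a 0 = 𝓕 (𝓕⁻ a) 0 := by rw [FourierTransform.fourier_fourierInv_eq]
    rw [SchwartzMap.fourier_coe, Real.fourier_eq', ha] at h1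
    simpa using h1.symm
  have hbound := norm_convCLM_le (𝓕⁻ a) hψ hc hθ hθ1 fc (M := M) (fun x y => by
    have := hf x y
    rw [← Real.norm_eq_abs, ← Complex.norm_real, Complex.ofReal_sub] at this
    exact this) x
  rw [← tsum_multiplier_eq_convCLM a haR hc x fc] at hbound
  have heq : paleyBlock (fun ξ => g (c • ξ)) (partialCoeff i f) (torusMk x) =
      (c : ℂ)⁻¹ * ∑' k, a (c • latticeVec k) * mFourierCoeff (fun x => fc x) k *
        mFourier k (torusMk x) := by
    rw [← tsum_mul_left, paleyBlock]
    refine tsum_congr fun k => ?_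
    rw [ha]
    have hcc : (c : ℂ) ≠ 0 := by exact_mod_cast hc.ne'
    have : (c • latticeVec k) i = c * (k i : ℝ) := by simp [latticeVec]
    rw [this, partialCoeff]
    change (g (c • latticeVec k) : ℂ) * _ * _ = _
    change _ = _ * (_ * mFourierCoeff (fun x => (f x : ℂ)) k * _)
    push_cast
    field_simp
  rw [heq, norm_mul, norm_inv, Complex.norm_real, Real.norm_of_nonneg hc.le]
  gcongr

theorem partialCoeff_sub (i : Fin d) (f g : TorusFn d) :
    partialCoeff i f - partialCoeff i g = partialCoeff i (f - g : TorusFn d) := by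
  ext k
  have h : mFourierCoeff (fun x => (((f - g : TorusFn d) x : ℝ) : ℂ)) k =
      mFourierCoeff (fun x => ((f x : ℝ) : ℂ)) k - mFourierCoeff (fun x => ((g x : ℝ) : ℂ)) k := by
    simp only [mFourierCoeff_eq, ContinuousMap.sub_apply, Complex.ofReal_sub, mul_sub]
    exact integral_sub (integrable_torus (by fun_prop)) (integrable_torus (by fun_prop))
  simp only [partialCoeff, Pi.sub_apply, h]
  ring

/-- At scale c = 2^{-j} the weight 2^{j(α-1)}, the derivative 2^j and the Hölder gain 2^{-jα} cancel
exactly. The low-frequency block has weight 2^{1-α} ≤ 2. -/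
theorem exists_besovNorm_partialCoeff_le {χ ϱ : EuclideanSpace ℝ (Fin d) → ℝ}
    (h : IsDyadicPartition χ ϱ) {α : ℝ} (hα : 0 < α) (hα1 : α < 1) (i : Fin d) :
    ∃ K : ℝ, 0 ≤ K ∧ ∀ (M : ℝ) (f : TorusFn d),
      (∀ x y, |f (torusMk x) - f (torusMk y)| ≤ M * dist x y ^ α) →
        besovNorm χ ϱ (α - 1) (partialCoeff i f) ≤ ENNReal.ofReal (K * M) := by
  obtain ⟨I, hI, hlow⟩ := exists_norm_paleyBlock_le h.smooth_low h.support_low i hα hα1.le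
  obtain ⟨J, hJ, hhigh⟩ := exists_norm_paleyBlock_le h.smooth_high
    (fun ξ hξ => (h.support_high ξ hξ).2) i hα hα1.le
  refine ⟨2 * I + J, by positivity, fun M f hf => iSup_le fun j => ?_⟩
  -- Nonnegativity of M follows by testing the hypothesis at two points at distance one.
  have hM0 : 0 ≤ M := by
    have h1 := (abs_nonneg _).trans (hf (EuclideanSpace.single i 1) 0)
    rwa [dist_zero_right, PiLp.norm_single, norm_one, Real.one_rpow, mul_one] at h1
  have hsup : ∀ {X : Type} (u : X → ℂ) (B : ℝ), (∀ x, ‖u x‖ ≤ B) →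
      supNorm u ≤ ENNReal.ofReal B := fun u B hu => iSup_le fun x => by
    rw [← ofReal_norm]
    exact ENNReal.ofReal_le_ofReal (hu x)
  cases j with
  | zero =>
    have h1 := hsup _ _ (hlow 1 one_pos M f hf)
    simp only [one_smul, inv_one, one_mul, Real.one_rpow, mul_one] at h1
    refine (mul_le_mul_right h1 _).trans ?_
    rw [← ENNReal.ofReal_mul (by positivity)]
    refine ENNReal.ofReal_le_ofReal ?_
    have h2 : (2 : ℝ) ^ ((((0 : ℕ) : ℝ) - 1) * (α - 1)) ≤ 2 := by
      have := Real.rpow_le_rpow_of_exponent_le (x := 2) (by norm_num)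
        (show (((0 : ℕ) : ℝ) - 1) * (α - 1) ≤ 1 by push_cast; linarith)
      simpa using this
    have hMI : 0 ≤ M * I := by positivity
    have hMJ : 0 ≤ M * J := by positivity
    nlinarith
  | succ j =>
    have hc : (0 : ℝ) < ((2 : ℝ) ^ j)⁻¹ := by positivity
    have h1 := hsup _ _ (hhigh _ hc M f hf)
    refine (mul_le_mul_right h1 _).trans ?_
    rw [← ENNReal.ofReal_mul (by positivity)]
    refine ENNReal.ofReal_le_ofReal ?_
    have h2 : (2 : ℝ) ^ ((((j + 1 : ℕ) : ℝ) - 1) * (α - 1)) * ((((2 : ℝ) ^ j)⁻¹)⁻¹ *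
        (M * ((2 : ℝ) ^ j)⁻¹ ^ α * J)) = M * J := by
      have h3 : (((2 : ℝ) ^ j)⁻¹) ^ α = (2 : ℝ) ^ (-(j : ℝ) * α) := by
        rw [← Real.rpow_natCast, ← Real.rpow_neg (by norm_num), ← Real.rpow_mul (by norm_num)]
      have h4 : (((2 : ℝ) ^ j)⁻¹)⁻¹ = (2 : ℝ) ^ (j : ℝ) := by
        rw [inv_inv, Real.rpow_natCast]
      rw [h3, h4]
      have h5 : (2 : ℝ) ^ ((((j + 1 : ℕ) : ℝ) - 1) * (α - 1)) * (2 : ℝ) ^ (j : ℝ) *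
          (2 : ℝ) ^ (-(j : ℝ) * α) = 1 := by
        rw [← Real.rpow_add (by norm_num), ← Real.rpow_add (by norm_num)]
        have : (((j + 1 : ℕ) : ℝ) - 1) * (α - 1) + j + -(j : ℝ) * α = 0 := by push_cast; ring
        rw [this, Real.rpow_zero]
      calc _ = ((2 : ℝ) ^ ((((j + 1 : ℕ) : ℝ) - 1) * (α - 1)) * (2 : ℝ) ^ (j : ℝ) *
          (2 : ℝ) ^ (-(j : ℝ) * α)) * (M * J) := by ring
        _ = _ := by rw [h5, one_mul]
    rw [h2]
    have hMI : 0 ≤ M * I := by positivity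
    nlinarith

/-- The gradients are as close in `C^{α-1}` as the functions are, modulo constants, in `C^α`. -/
theorem exists_gradDist_le {χ ϱ : EuclideanSpace ℝ (Fin d) → ℝ} (h : IsDyadicPartition χ ϱ)
    {α : ℝ} (hα : 0 < α) (hαm : ∀ m : ℕ, α ≠ m) :
    ∃ K : ℝ, 0 ≤ K ∧ ∀ (M c : ℝ) (f g : TorusFn d) (A B : ℝ),
      HolderBound (α - ⌊α⌋₊) ⌊α⌋₊ (periodicLift f) A →
      HolderBound (α - ⌊α⌋₊) ⌊α⌋₊ (periodicLift g) B →
      HolderBound (α - ⌊α⌋₊) ⌊α⌋₊ (fun y => periodicLift f y - periodicLift g y - c) M →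
      gradDist χ ϱ α f g ≤ ENNReal.ofReal (K * M) := by
  have hθ : 0 < α - ⌊α⌋₊ :=
    sub_pos.2 (lt_of_le_of_ne (Nat.floor_le hα.le) (hαm _).symm)
  by_cases hα1 : α < 1
  · choose K hK0 hK using exists_besovNorm_partialCoeff_le h hα hα1
    refine ⟨∑ i, K i, Finset.sum_nonneg fun i _ => hK0 i, fun M c f g A B _ _ hfg => ?_⟩
    rw [gradDist, if_pos hα1]
    refine iSup_le fun i => ?_
    have hM := hfg.nonneg
    have hfl : ⌊α⌋₊ = 0 := Nat.floor_eq_zero.2 hα1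
    rw [partialCoeff_sub]
    rw [hfl] at hfg
    refine (hK i M (f - g) fun x y => ?_).trans (ENNReal.ofReal_le_ofReal ?_)
    -- The constant c cancels in increments, so only the Hölder quotient is used.
    · have := hfg.2 x y
      simp only [Nat.cast_zero, sub_zero, sub_sub_sub_cancel_right] at this
      exact this
    · gcongr
      exact Finset.single_le_sum (fun i _ => hK0 i) (Finset.mem_univ i)
  · refine ⟨3, by norm_num, fun M c f g A B hf hg hfg => ?_⟩
    obtain ⟨m, hm⟩ : ∃ m, ⌊α⌋₊ = m + 1 :=
      ⟨⌊α⌋₊ - 1, by have : 1 ≤ ⌊α⌋₊ := Nat.le_floor (by simpa using hα1); omega⟩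
    have hCf : ContDiff ℝ 1 (periodicLift f) :=
      (hf.contDiff hθ).of_le (by rw [hm]; norm_cast; omega)
    have hCg : ContDiff ℝ 1 (periodicLift g) :=
      (hg.contDiff hθ).of_le (by rw [hm]; norm_cast; omega)
    rw [gradDist, if_neg hα1, if_pos ⟨hCf, hCg⟩]
    refine iSup_le fun i => ?_
    rw [← classicalPartial_sub (hCf.differentiable (by norm_num))
      (hCg.differentiable (by norm_num))]
    rw [hm] at hfg hθ
    have hpart : classicalPartial i (fun y => periodicLift f y - periodicLift g y - c) =
        classicalPartial i (periodicLift f - periodicLift g) := by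
      ext y
      simp only [classicalPartial, fderiv_sub_const]
      rfl
    rw [← hpart]
    refine (hfg.2.2 i).holderNorm_le hθ ?_ ?_
    · have : ⌊α - 1⌋₊ = ⌊α⌋₊ - 1 := by simp
      rw [this, hm]; rfl
    · push_cast
      ring

end Besov

/-! ### The ergodic theorem -/

section ErgodicTheory

variable {Ω : Type*} {T : Ω → Ω} {g : Ω → ℝ}

/-- The maximum of zero and the first `n` Birkhoff sums. -/
def birkhoffMax (T : Ω → Ω) (g : Ω → ℝ) : ℕ → Ω → ℝ
  | 0, _ => 0
  | n + 1, ω => max 0 (g ω + birkhoffMax T g n (T ω))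

theorem birkhoffMax_nonneg (n : ℕ) (ω : Ω) : 0 ≤ birkhoffMax T g n ω := by
  cases n with
  | zero => exact le_rfl
  | succ n => exact le_max_left _ _

theorem birkhoffSum_le_birkhoffMax (n : ℕ) (ω : Ω) :
    birkhoffSum T g n ω ≤ birkhoffMax T g n ω := by
  induction n generalizing ω with
  | zero => simp [birkhoffMax]
  | succ n ih =>
    rw [birkhoffSum_succ']
    exact (add_le_add_right (ih (T ω)) _).trans (le_max_right _ _)

theorem birkhoffMax_mono (ω : Ω) : Monotone fun n => birkhoffMax T g n ω := by
  refine monotone_nat_of_le_succ fun n => ?_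
  induction n generalizing ω with
  | zero => exact birkhoffMax_nonneg _ _
  | succ n ih => exact max_le_max le_rfl (add_le_add_right (ih (T ω)) _)

variable [MeasurableSpace Ω] {P : Measure Ω}

theorem integrable_birkhoffMax (hT : MeasurePreserving T P P) (hg : Integrable g P) (n : ℕ) :
    Integrable (birkhoffMax T g n) P := by
  induction n with
  | zero => exact integrable_zero _ _ _
  | succ n ih =>
    have h1 : Integrable (fun ω => g ω + birkhoffMax T g n (T ω)) P :=
      hg.add (hT.integrable_comp_of_integrable ih)
    exact (integrable_zero _ _ _).sup h1

theorem measurable_birkhoffMax (hT : Measurable T) (hg : Measurable g) (n : ℕ) :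
    Measurable (birkhoffMax T g n) := by
  induction n with
  | zero => exact measurable_const
  | succ n ih => exact measurable_const.max (hg.add (ih.comp hT))

/-- Write M_n for `birkhoffMax`. The recursion M_{n+1} = max(0, g + M_n ∘ T) shows that boundedness
of (M_n) is an invariant event, hence of probability 0 or 1. If M_n were almost surely unbounded,
M_{n+1} - M_n ∘ T would tend to g, although its integral ∫ (M_{n+1} - M_n) is nonnegative; this
contradicts ∫ g < 0. -/
theorem ae_exists_birkhoffSum_le_of_measurable [IsProbabilityMeasure P] (hT : Ergodic T P)
    (hgm : Measurable g) (hg : Integrable g P) (hneg : ∫ ω, g ω ∂P < 0) :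
    ∀ᵐ ω ∂P, ∃ B, ∀ n, birkhoffSum T g n ω ≤ B := by
  have hTm := hT.toMeasurePreserving
  set A : Set Ω := {ω | BddAbove (range fun n => birkhoffMax T g n ω)} with hA
  have hAm : MeasurableSet A :=
    measurableSet_bddAbove_range fun n => measurable_birkhoffMax hTm.measurable hgm n
  have hinv : T ⁻¹' A = A := by
    ext ω
    simp only [hA, mem_preimage, mem_ofPred_eq]
    constructor
    · rintro ⟨B, hB⟩
      refine ⟨max 0 (g ω + B), ?_⟩
      rintro _ ⟨n, rfl⟩
      cases n with
      | zero => exact le_max_left _ _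
      | succ n => exact max_le_max le_rfl (add_le_add_right (hB ⟨n, rfl⟩) _)
    · rintro ⟨B, hB⟩
      refine ⟨B - g ω, ?_⟩
      rintro _ ⟨n, rfl⟩
      have h1 : birkhoffMax T g (n + 1) ω ≤ B := hB ⟨n + 1, rfl⟩
      have h2 : g ω + birkhoffMax T g n (T ω) ≤ birkhoffMax T g (n + 1) ω := le_max_right _ _
      change birkhoffMax T g n (T ω) ≤ B - g ω
      linarith
  have hcase := hT.toPreErgodic.aeconst_set hAm hinv
  rw [eventuallyConst_set'] at hcase
  rcases hcase with h0 | h1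
  · exfalso
    have hnot : ∀ᵐ ω ∂P, ω ∉ A := by
      rw [ae_eq_empty] at h0
      exact measure_eq_zero_iff_ae_notMem.1 h0
    have hlim : Tendsto (fun n => ∫ ω, (birkhoffMax T g (n + 1) ω - birkhoffMax T g n (T ω)) ∂P)
        atTop (𝓝 (∫ ω, g ω ∂P)) := by
      -- M_{n+1} - M_n ∘ T = max(-M_n ∘ T, g), which lies between g and max(0, g) and equals g once
      -- M_n ∘ T exceeds -g.
      refine tendsto_integral_of_dominated_convergence (fun ω => |g ω|) (fun n => ?_) hg.abs
        (fun n => Eventually.of_forall fun ω => ?_) ?_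
      · exact ((integrable_birkhoffMax hTm hg _).sub (hTm.integrable_comp_of_integrable
          (integrable_birkhoffMax hTm hg n))).aestronglyMeasurable
      · have hM := birkhoffMax_nonneg (T := T) (g := g) n (T ω)
        rw [Real.norm_eq_abs]
        change |max 0 (g ω + birkhoffMax T g n (T ω)) - birkhoffMax T g n (T ω)| ≤ |g ω|
        rcases max_cases 0 (g ω + birkhoffMax T g n (T ω)) with ⟨h, h'⟩ | ⟨h, h'⟩
        · rw [h, zero_sub, abs_neg, abs_of_nonneg hM, abs_of_nonpos (by linarith)]
          linarith
        · rw [h, add_sub_cancel_right]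
      · filter_upwards [hnot] with ω hω
        have hω' : ¬ BddAbove (range fun n => birkhoffMax T g n (T ω)) := fun h =>
          hω (by rw [← hinv]; exact h)
        rw [not_bddAbove_iff] at hω'
        obtain ⟨_, ⟨N, rfl⟩, hN⟩ := hω' (-g ω)
        refine tendsto_const_nhds.congr' ?_
        filter_upwards [eventually_ge_atTop N] with n hn
        have h1 := birkhoffMax_mono (T := T) (g := g) (T ω) hn
        have h2 : birkhoffMax T g (n + 1) ω = g ω + birkhoffMax T g n (T ω) :=
          max_eq_right (by simp only at h1 hN; linarith)
        rw [h2, add_sub_cancel_right]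
    have hnn : ∀ n, 0 ≤ ∫ ω, (birkhoffMax T g (n + 1) ω - birkhoffMax T g n (T ω)) ∂P := by
      intro n
      have hi := integrable_birkhoffMax hTm hg n
      have hi' : Integrable (fun ω => birkhoffMax T g n (T ω)) P :=
        hTm.integrable_comp_of_integrable hi
      rw [integral_sub (integrable_birkhoffMax hTm hg _) hi']
      have h3 : ∫ ω, birkhoffMax T g n (T ω) ∂P = ∫ ω, birkhoffMax T g n ω ∂P := by
        have := integral_map (μ := P) hTm.measurable.aemeasurable (f := birkhoffMax T g n)
          (by rw [hTm.map_eq]; exact hi.aestronglyMeasurable)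
        rw [hTm.map_eq] at this
        exact this.symm
      rw [h3, sub_nonneg]
      exact integral_mono hi (integrable_birkhoffMax hTm hg _)
        fun ω => birkhoffMax_mono ω (Nat.le_succ n)
    exact absurd (ge_of_tendsto' hlim hnn) (not_le.2 hneg)
  · filter_upwards [eventuallyEq_univ.1 h1] with ω hω
    obtain ⟨B, hB⟩ := hω
    exact ⟨B, fun n => (birkhoffSum_le_birkhoffMax n ω).trans (hB ⟨n, rfl⟩)⟩

theorem ae_birkhoffSum_congr (hT : MeasurePreserving T P P) {g g' : Ω → ℝ} (h : g =ᵐ[P] g') :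
    ∀ᵐ ω ∂P, ∀ n, birkhoffSum T g n ω = birkhoffSum T g' n ω := by
  have h1 : ∀ᵐ ω ∂P, ∀ k : ℕ, g (T^[k] ω) = g' (T^[k] ω) :=
    ae_all_iff.2 fun k => (hT.iterate k).quasiMeasurePreserving.ae h
  filter_upwards [h1] with ω hω n
  exact Finset.sum_congr rfl fun k _ => hω k

/-- The upper half of Birkhoff's ergodic theorem. -/
theorem ae_eventually_birkhoffSum_le [IsProbabilityMeasure P] (hT : Ergodic T P)
    (hg : Integrable g P) {c : ℝ} (hc : ∫ ω, g ω ∂P < c) :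
    ∀ᵐ ω ∂P, ∀ᶠ n : ℕ in atTop, birkhoffSum T g n ω ≤ c * n := by
  obtain ⟨g', hg', hgg'⟩ := hg.aestronglyMeasurable
  obtain ⟨c', hc', hcc'⟩ := exists_between hc
  have hInt : Integrable g' P := hg.congr hgg'
  -- Centring at c' strictly between the mean and c gives bounded sums; the slack (c - c')n absorbs
  -- the random bound.
  have h1 := ae_exists_birkhoffSum_le_of_measurable hT (g := fun ω => g' ω - c')
    (hg'.measurable.sub_const c') (hInt.sub (integrable_const c')) (by
      rw [integral_sub hInt (integrable_const c'), ← integral_congr_ae hgg']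
      simpa using hc')
  filter_upwards [h1, ae_birkhoffSum_congr hT.toMeasurePreserving hgg'] with ω ⟨B, hB⟩ hω
  have hlim : Tendsto (fun n : ℕ => (c - c') * n) atTop atTop :=
    tendsto_natCast_atTop_atTop.const_mul_atTop (sub_pos.2 hcc')
  filter_upwards [hlim.eventually_ge_atTop B] with n hn
  rw [hω]
  have h2 := hB n
  have h3 : birkhoffSum T (fun ω => g' ω - c') n ω = birkhoffSum T g' n ω - n * c' := by
    simp [birkhoffSum, Finset.sum_sub_distrib]
  rw [h3] at h2
  linarith

theorem ae_eventually_birkhoffSum_ge [IsProbabilityMeasure P] (hT : Ergodic T P)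
    (hg : Integrable g P) {c : ℝ} (hc : c < ∫ ω, g ω ∂P) :
    ∀ᵐ ω ∂P, ∀ᶠ n : ℕ in atTop, c * n ≤ birkhoffSum T g n ω := by
  have h := ae_eventually_birkhoffSum_le hT (g := fun ω => -g ω) hg.neg (c := -c) (by
    rw [integral_neg]; linarith)
  filter_upwards [h] with ω hω
  filter_upwards [hω] with n hn
  have : birkhoffSum T (fun ω => -g ω) n ω = -birkhoffSum T g n ω := by simp [birkhoffSum]
  rw [this] at hn
  linarith

/-- g(T^n ω) is the increment of the Birkhoff sums from n to n + 1, and both sums are close to their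
linear asymptotics. -/
theorem ae_eventually_iterate_le [IsProbabilityMeasure P] (hT : Ergodic T P)
    (hg : Integrable g P) {ε : ℝ} (hε : 0 < ε) :
    ∀ᵐ ω ∂P, ∀ᶠ n : ℕ in atTop, g (T^[n] ω) ≤ ε * n := by
  filter_upwards [ae_eventually_birkhoffSum_le hT hg (c := ∫ ω, g ω ∂P + ε / 3) (by linarith),
    ae_eventually_birkhoffSum_ge hT hg (c := ∫ ω, g ω ∂P - ε / 3) (by linarith)] with ω h1 h2
  have hlim : Tendsto (fun n : ℕ => (ε / 3) * n) atTop atTop :=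
    tendsto_natCast_atTop_atTop.const_mul_atTop (by positivity)
  filter_upwards [(tendsto_add_atTop_nat 1).eventually h1, h2,
    hlim.eventually_ge_atTop (∫ ω, g ω ∂P + ε / 3)] with n h1 h2 h3
  rw [birkhoffSum_succ] at h1
  push_cast at h1
  linarith

/-- Visits to a set of large probability leave only small gaps. -/
theorem ae_eventually_exists_visit [IsProbabilityMeasure P] (hT : Ergodic T P) {G : Set Ω}
    (hG : MeasurableSet G) {ε : ℝ} (hε : 0 < ε) (hε1 : ε ≤ 1) (hP : P.real Gᶜ < ε / 2) :
    ∀ᵐ ω ∂P, ∀ᶠ n : ℕ in atTop, ∃ k < n, T^[k] ω ∈ G ∧ (n : ℝ) - k ≤ ε * n := by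
  have hInt : Integrable (Gᶜ.indicator fun _ => (1 : ℝ)) P :=
    (integrable_const 1).indicator hG.compl
  obtain ⟨c, hc, hcε⟩ := exists_between hP
  have h := ae_eventually_birkhoffSum_le hT hInt (c := c) (by
    rw [integral_indicator_const _ hG.compl]; simpa using hc)
  filter_upwards [h] with ω hω
  have hlim : Tendsto (fun n : ℕ => (ε / 2) * n) atTop atTop :=
    tendsto_natCast_atTop_atTop.const_mul_atTop (by positivity)
  filter_upwards [hω, hlim.eventually_gt_atTop 1] with n hn hn1
  by_contra! hcon
  -- If none of the last m times visits G, the complement is visited at least m > εn - 1 times,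
  -- while the ergodic theorem allows only cn ≤ εn / 2.
  set m : ℕ := ⌊ε * n⌋₊ with hm
  have hεn : 0 ≤ ε * n := by positivity
  have hmle : (m : ℝ) ≤ ε * n := Nat.floor_le hεn
  have hmlt : ε * n < m + 1 := Nat.lt_floor_add_one _
  have hmn : m ≤ n := by
    have : (m : ℝ) ≤ n := hmle.trans (mul_le_of_le_one_left (Nat.cast_nonneg n) hε1)
    exact_mod_cast this
  have hsum : (m : ℝ) ≤ birkhoffSum T (Gᶜ.indicator fun _ => (1 : ℝ)) n ω := by
    rw [birkhoffSum, ← Finset.sum_range_add_sum_Ico _ (Nat.sub_le n m)]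
    have h1 : ∑ k ∈ Finset.Ico (n - m) n, Gᶜ.indicator (fun _ => (1 : ℝ)) (T^[k] ω) = m := by
      rw [Finset.sum_congr rfl (g := fun _ => (1 : ℝ))]
      · simp [Nat.sub_sub_self hmn]
      · intro k hk
        rw [Finset.mem_Ico] at hk
        refine indicator_of_mem (s := Gᶜ) (fun hkG => ?_) _
        have h2 := hcon k hk.2 hkG
        have h3 : (n : ℝ) ≤ m + k := by exact_mod_cast (by omega : n ≤ m + k)
        linarith
    have h0 : 0 ≤ ∑ k ∈ Finset.range (n - m), Gᶜ.indicator (fun _ => (1 : ℝ)) (T^[k] ω) :=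
      Finset.sum_nonneg fun k _ => indicator_nonneg (fun _ _ => zero_le_one) _
    linarith
  have hcn : c * n ≤ ε / 2 * n := by gcongr
  linarith

/-! ### Products of contraction factors along an orbit -/

/-- The expectation of `log τ` as an extended real number. -/
noncomputable def logExpectation (P : Measure Ω) (τ : Ω → ℝ≥0∞) : EReal :=
  ((∫⁻ ω, (ENNReal.log (τ ω)).toENNReal ∂P : ℝ≥0∞) : EReal) -
    ((∫⁻ ω, (-ENNReal.log (τ ω)).toENNReal ∂P : ℝ≥0∞) : EReal)

theorem logExpectation_congr {τ τ' : Ω → ℝ≥0∞} (h : τ =ᵐ[P] τ') :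
    logExpectation P τ = logExpectation P τ' := by
  have h1 : ∀ F : ℝ≥0∞ → ℝ≥0∞, ∫⁻ ω, F (τ ω) ∂P = ∫⁻ ω, F (τ' ω) ∂P := fun F =>
    lintegral_congr_ae (h.mono fun ω hω => congrArg F hω)
  rw [logExpectation, logExpectation, h1 fun a => (ENNReal.log a).toENNReal,
    h1 fun a => (-ENNReal.log a).toENNReal]

theorem logExpectation_eq {τ : Ω → ℝ≥0∞} (h : ∀ᵐ ω ∂P, τ ω ≤ 1) :
    logExpectation P τ = -((∫⁻ ω, (-ENNReal.log (τ ω)).toENNReal ∂P : ℝ≥0∞) : EReal) := by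
  have h0 : ∫⁻ ω, (ENNReal.log (τ ω)).toENNReal ∂P = 0 := by
    rw [lintegral_congr_ae (g := fun _ => 0)]
    · simp
    · filter_upwards [h] with ω hω
      exact EReal.toENNReal_of_nonpos (ENNReal.log_le_zero_iff.2 hω)
  rw [logExpectation, h0, EReal.coe_ennreal_zero, zero_sub]

theorem measurable_neg_log_toENNReal {τ : Ω → ℝ≥0∞} (hτ : Measurable τ) :
    Measurable fun ω => (-ENNReal.log (τ ω)).toENNReal := by
  exact (measurable_ereal_toENNReal).comp ((ENNReal.measurable_log.comp hτ).neg)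

theorem logExpectation_neg [IsProbabilityMeasure P] {τ : Ω → ℝ≥0∞} (hτ : Measurable τ)
    (h : ∀ᵐ ω ∂P, τ ω < 1) : logExpectation P τ < 0 := by
  rw [logExpectation_eq (h.mono fun ω hω => hω.le)]
  have hpos : 0 < ∫⁻ ω, (-ENNReal.log (τ ω)).toENNReal ∂P := by
    rw [lintegral_pos_iff_support (measurable_neg_log_toENNReal hτ)]
    have : P (Function.support fun ω => (-ENNReal.log (τ ω)).toENNReal) = 1 := by
      rw [← measure_univ (μ := P)]
      refine measure_congr ?_
      filter_upwards [h] with ω hω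
      refine propext ⟨fun _ => trivial, fun _ => ?_⟩
      change (-ENNReal.log (τ ω)).toENNReal ≠ 0
      rw [EReal.toENNReal_ne_zero_iff]
      have : ENNReal.log (τ ω) < 0 := ENNReal.log_lt_zero_iff.2 hω
      simpa using EReal.neg_lt_neg_iff.2 this
    rw [this]
    exact one_pos
  rw [EReal.neg_lt_comm, neg_zero]
  exact_mod_cast hpos

/-- log τ need not be integrable. Truncating it below at -N gives integrable upper bounds whose
integrals decrease to the expectation, by monotone convergence. -/
theorem exists_integrable_of_logExpectation_lt [IsProbabilityMeasure P] {τ : Ω → ℝ≥0∞}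
    (hτ : Measurable τ) (h : ∀ᵐ ω ∂P, τ ω ≤ 1) {c : ℝ} (hc : logExpectation P τ < c) :
    ∃ g : Ω → ℝ, Integrable g P ∧ ∫ ω, g ω ∂P < c ∧
      ∀ᵐ ω ∂P, τ ω ≤ ENNReal.ofReal (Real.exp (g ω)) := by
  -- For c > 0 the bound τ ≤ 1 is enough; otherwise -c ≥ 0 is represented in ℝ≥0∞.
  rcases lt_or_ge 0 c with hc0 | hc0
  · refine ⟨fun _ => 0, integrable_zero _ _ _, by simpa using hc0, ?_⟩
    filter_upwards [h] with ω hω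
    simpa using hω
  set L : Ω → ℝ≥0∞ := fun ω => (-ENNReal.log (τ ω)).toENNReal with hL
  have hLm : Measurable L := measurable_neg_log_toENNReal hτ
  rw [logExpectation_eq h] at hc
  have hc1 : ENNReal.ofReal (-c) < ∫⁻ ω, L ω ∂P := by
    rw [EReal.neg_lt_comm, ← EReal.coe_neg] at hc
    have : ((ENNReal.ofReal (-c) : ℝ≥0∞) : EReal) < ((∫⁻ ω, L ω ∂P : ℝ≥0∞) : EReal) := by
      rwa [EReal.coe_ennreal_ofReal, max_eq_left (by linarith)]
    exact_mod_cast this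
  have hmono : ∫⁻ ω, L ω ∂P = ⨆ N : ℕ, ∫⁻ ω, min (L ω) N ∂P := by
    rw [← lintegral_iSup (fun N => hLm.min measurable_const)]
    · congr 1
      ext ω
      refine le_antisymm ?_ (iSup_le fun N => min_le_left _ _)
      refine le_of_forall_lt fun a ha => ?_
      obtain ⟨N, hN⟩ := ENNReal.exists_nat_gt (ne_top_of_lt ha)
      exact lt_iSup_iff.2 ⟨N, lt_min ha hN⟩
    · intro a b hab ω
      exact min_le_min le_rfl (by exact_mod_cast hab)
  rw [hmono] at hc1
  obtain ⟨N, hN⟩ := lt_iSup_iff.1 hc1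
  have hfin : ∫⁻ ω, min (L ω) N ∂P ≠ ⊤ := by
    refine ((lintegral_mono fun ω => min_le_right _ _).trans_lt ?_).ne (b := ⊤)
    · simp
  have hintL : Integrable (fun ω => (min (L ω) N).toReal) P :=
    integrable_toReal_of_lintegral_ne_top (hLm.min measurable_const).aemeasurable hfin
  refine ⟨fun ω => -(min (L ω) N).toReal, hintL.neg, ?_, ?_⟩
  · rw [integral_neg, integral_toReal (hLm.min measurable_const).aemeasurable
      (Eventually.of_forall fun ω => (min_le_right _ _).trans_lt (by simp))]
    have := (ENNReal.ofReal_lt_iff_lt_toReal (by linarith) hfin).1 hN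
    linarith
  · filter_upwards [h] with ω hω
    rw [← ENNReal.log_le_log_iff, ENNReal.log_ofReal_of_pos (Real.exp_pos _), Real.log_exp]
    have hlog : ENNReal.log (τ ω) ≤ 0 := ENNReal.log_le_zero_iff.2 hω
    have h1 : ((L ω : ℝ≥0∞) : EReal) = -ENNReal.log (τ ω) :=
      EReal.coe_toENNReal (by simpa using EReal.neg_le_neg_iff.2 hlog)
    have h2 : (((min (L ω) N).toReal : ℝ) : EReal) = ((min (L ω) N : ℝ≥0∞) : EReal) :=
      EReal.coe_ennreal_toReal ((min_le_right _ _).trans_lt (by simp)).ne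
    rw [EReal.coe_neg, h2, ← EReal.neg_le_neg_iff, neg_neg, ← h1]
    exact_mod_cast min_le_left _ _

/-- Each c has its own exceptional set, so the ergodic theorem is used for rational c only and
monotonicity gives the rest. -/
theorem ae_eventually_prod_le [IsProbabilityMeasure P] (hT : Ergodic T P) {τ : Ω → ℝ≥0∞}
    (hτ : Measurable τ) (h : ∀ᵐ ω ∂P, τ ω ≤ 1) :
    ∀ᵐ ω ∂P, ∀ c : ℝ, logExpectation P τ < c → ∀ᶠ n : ℕ in atTop,
      ∏ k ∈ Finset.range n, τ (T^[k] ω) ≤ ENNReal.ofReal (Real.exp (c * n)) := by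
  have hq : ∀ q : ℚ, ∀ᵐ ω ∂P, logExpectation P τ < ((q : ℝ) : EReal) → ∀ᶠ n : ℕ in atTop,
      ∏ k ∈ Finset.range n, τ (T^[k] ω) ≤ ENNReal.ofReal (Real.exp (q * n)) := by
    intro q
    by_cases hq : logExpectation P τ < ((q : ℝ) : EReal)
    · obtain ⟨g, hg, hgc, hle⟩ := exists_integrable_of_logExpectation_lt hτ h hq
      have h1 : ∀ᵐ ω ∂P, ∀ k : ℕ, τ (T^[k] ω) ≤ ENNReal.ofReal (Real.exp (g (T^[k] ω))) :=
        ae_all_iff.2 fun k => (hT.toMeasurePreserving.iterate k).quasiMeasurePreserving.ae hle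
      filter_upwards [h1, ae_eventually_birkhoffSum_le hT hg hgc] with ω h1 h2 _
      filter_upwards [h2] with n hn
      calc _ ≤ ∏ k ∈ Finset.range n, ENNReal.ofReal (Real.exp (g (T^[k] ω))) :=
            Finset.prod_le_prod' fun k _ => h1 k
        _ = ENNReal.ofReal (Real.exp (birkhoffSum T g n ω)) := by
            rw [← ENNReal.ofReal_prod_of_nonneg fun k _ => (Real.exp_pos _).le, ← Real.exp_sum]
            rfl
        _ ≤ _ := ENNReal.ofReal_le_ofReal (Real.exp_le_exp.2 hn)
    · exact Eventually.of_forall fun ω h => absurd h hq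
  filter_upwards [ae_all_iff.2 hq] with ω hω c hc
  obtain ⟨q, hq1, hq2⟩ := EReal.lt_iff_exists_rat_btwn.1 hc
  filter_upwards [hω q (by exact_mod_cast hq1)] with n hn
  refine hn.trans (ENNReal.ofReal_le_ofReal (Real.exp_le_exp.2 ?_))
  have : (q : ℝ) < c := by exact_mod_cast hq2
  gcongr

end ErgodicTheory

/-! ### Hilbert's projective distance -/

section ProjectiveDistance

variable {d : ℕ} {f g h : TorusFn d}

/-- The logarithm of the cross ratio of two functions at two points. -/
noncomputable def logCross (f g : Torus d → ℝ) (x y : Torus d) : ℝ :=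
  Real.log (f x) - Real.log (f y) - (Real.log (g x) - Real.log (g y))

/-- The oscillation of `log f - log g`. -/
noncomputable def logDist (f g : Torus d → ℝ) : ℝ≥0∞ :=
  ⨆ (x) (y), ENNReal.ofReal (logCross f g x y)

theorem ofReal_logCross_le (f g : Torus d → ℝ) (x y : Torus d) :
    ENNReal.ofReal (logCross f g x y) ≤ logDist f g :=
  le_iSup₂ (f := fun x y => ENNReal.ofReal (logCross f g x y)) x y

theorem logDist_le_ofReal {f g : Torus d → ℝ} {r : ℝ} (h : ∀ x y, logCross f g x y ≤ r) :
    logDist f g ≤ ENNReal.ofReal r :=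
  iSup₂_le fun x y => ENNReal.ofReal_le_ofReal (h x y)

theorem logCross_le_toReal {f g : Torus d → ℝ} (h : logDist f g ≠ ⊤) (x y : Torus d) :
    logCross f g x y ≤ (logDist f g).toReal :=
  (ENNReal.ofReal_le_iff_le_toReal h).1 (ofReal_logCross_le f g x y)

theorem logDist_comm (f g : Torus d → ℝ) : logDist f g = logDist g f := by
  have : ∀ f g : Torus d → ℝ, logDist f g ≤ logDist g f := fun f g => by
    refine iSup₂_le fun x y => le_trans (le_of_eq ?_) (ofReal_logCross_le g f y x)
    simp only [logCross]
    ring_nf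
  exact le_antisymm (this f g) (this g f)

theorem logDist_triangle (f g h : Torus d → ℝ) : logDist f h ≤ logDist f g + logDist g h := by
  refine iSup₂_le fun x y => ?_
  have : logCross f h x y = logCross f g x y + logCross g h x y := by
    simp only [logCross]
    ring
  rw [this]
  exact ENNReal.ofReal_add_le.trans
    (add_le_add (ofReal_logCross_le _ _ _ _) (ofReal_logCross_le _ _ _ _))

theorem logDist_const_mul_left {f : Torus d → ℝ} {c : ℝ} (hc : c ≠ 0) (hf : ∀ x, f x ≠ 0)
    (g : Torus d → ℝ) : logDist (fun x => c * f x) g = logDist f g := by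
  simp only [logDist, logCross, Real.log_mul hc (hf _)]
  ring_nf

theorem logDist_const_mul_right {g : Torus d → ℝ} {c : ℝ} (hc : c ≠ 0) (hg : ∀ x, g x ≠ 0)
    (f : Torus d → ℝ) : logDist f (fun x => c * g x) = logDist f g := by
  rw [logDist_comm, logDist_const_mul_left hc hg, logDist_comm]

theorem expFn_pos (h : TorusFn d) (x : Torus d) : 0 < expFn h x := Real.exp_pos _

theorem log_expFn (h : TorusFn d) (x : Torus d) : Real.log (expFn h x) = h x := Real.log_exp _

/-- A strictly positive function is an exponential. -/
theorem exists_eq_expFn (hf : ∀ x, 0 < f x) : ∃ h : TorusFn d, f = expFn h :=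
  ⟨⟨fun x => Real.log (f x), f.continuous.log fun x => (hf x).ne'⟩, by
    ext x
    exact (Real.exp_log (hf x)).symm⟩

theorem logDist_expFn_le (h₁ h₂ : TorusFn d) :
    logDist (expFn h₁) (expFn h₂) ≤ ENNReal.ofReal (2 * ‖h₁ - h₂‖) := by
  refine logDist_le_ofReal fun x y => ?_
  simp only [logCross, log_expFn]
  have hx := abs_le.1 ((h₁ - h₂).norm_coe_le_norm x)
  have hy := abs_le.1 ((h₁ - h₂).norm_coe_le_norm y)
  simp only [ContinuousMap.sub_apply] at hx hy
  linarith [hx.2, hy.1]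

theorem logDist_ne_top (hf : ∀ x, 0 < f x) (hg : ∀ x, 0 < g x) : logDist f g ≠ ⊤ := by
  obtain ⟨h₁, rfl⟩ := exists_eq_expFn hf
  obtain ⟨h₂, rfl⟩ := exists_eq_expFn hg
  exact ((logDist_expFn_le h₁ h₂).trans_lt ENNReal.ofReal_lt_top).ne

theorem exists_forall_le_torus {u : Torus d → ℝ} (hu : Continuous u) : ∃ x₀, ∀ x, u x₀ ≤ u x := by
  obtain ⟨x₀, -, h⟩ := isCompact_univ.exists_isMinOn univ_nonempty hu.continuousOn
  exact ⟨x₀, fun x => h (mem_univ x)⟩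

theorem exists_forall_ge_torus {u : Torus d → ℝ} (hu : Continuous u) : ∃ x₀, ∀ x, u x ≤ u x₀ := by
  obtain ⟨x₀, h⟩ := exists_forall_le_torus hu.neg
  exact ⟨x₀, fun x => neg_le_neg_iff.1 (h x)⟩

theorem mem_interior_posCone : f ∈ interior (posCone d) ↔ ∀ x, 0 < f x := by
  rw [mem_interior_iff_mem_nhds, Metric.mem_nhds_iff]
  constructor
  · rintro ⟨ε, hε, hball⟩ x
    have h1 : f - ContinuousMap.const _ (ε / 2) ∈ Metric.ball f ε := by
      rw [Metric.mem_ball, dist_eq_norm, sub_sub_cancel_left, norm_neg]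
      refine ((ContinuousMap.norm_le _ (by positivity)).2 fun x => ?_).trans_lt
        (half_lt_self hε)
      rw [ContinuousMap.const_apply, Real.norm_of_nonneg (by positivity)]
    have h2 : 0 ≤ f x - ε / 2 := hball h1 x
    linarith
  · intro hf
    obtain ⟨x₀, hx₀⟩ := exists_forall_le_torus f.continuous
    refine ⟨f x₀, hf x₀, fun u hu x => ?_⟩
    rw [Metric.mem_ball, dist_eq_norm] at hu
    have h1 := abs_le.1 ((u - f).norm_coe_le_norm x)
    simp only [ContinuousMap.sub_apply] at h1
    linarith [h1.1, hx₀ x]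

/-- By compactness f / g attains its maximum and minimum, and these are the two extremal constants.
-/
theorem hilbertDist_eq_logDist (hf : ∀ x, 0 < f x) (hg : ∀ x, 0 < g x) :
    hilbertDist f g = logDist f g := by
  have hρ : Continuous fun x => f x / g x := f.continuous.div g.continuous fun x => (hg x).ne'
  obtain ⟨x₁, hx₁⟩ := exists_forall_ge_torus hρ
  obtain ⟨x₂, hx₂⟩ := exists_forall_le_torus hρ
  have hpos : ∀ x, 0 < f x / g x := fun x => div_pos (hf x) (hg x)
  have hU : hilbertUpper f g = ENNReal.ofReal (f x₁ / g x₁) := by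
    refine le_antisymm ?_ (le_iInf₂ fun a ha => ?_)
    · refine iInf₂_le (f := fun (a : ℝ≥0) (_ : (a : ℝ) • g - f ∈ posCone d) => (a : ℝ≥0∞))
        (f x₁ / g x₁).toNNReal fun x => ?_
      rw [Real.coe_toNNReal _ (hpos x₁).le]
      have := (div_le_iff₀ (hg x)).1 (hx₁ x)
      simp only [ContinuousMap.sub_apply, ContinuousMap.smul_apply, smul_eq_mul]
      linarith
    · rw [← ENNReal.ofReal_coe_nnreal]
      refine ENNReal.ofReal_le_ofReal ?_
      have h1 : 0 ≤ (a : ℝ) * g x₁ - f x₁ := ha x₁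
      rw [div_le_iff₀ (hg x₁)]
      linarith
  have hL : hilbertLower f g = ENNReal.ofReal (f x₂ / g x₂) := by
    refine le_antisymm (iSup₂_le fun a ha => ?_) ?_
    · rw [← ENNReal.ofReal_coe_nnreal]
      refine ENNReal.ofReal_le_ofReal ?_
      have h1 : 0 ≤ f x₂ - (a : ℝ) * g x₂ := ha x₂
      rw [le_div_iff₀ (hg x₂)]
      linarith
    · refine le_iSup₂ (f := fun (a : ℝ≥0) (_ : f - (a : ℝ) • g ∈ posCone d) => (a : ℝ≥0∞))
        (f x₂ / g x₂).toNNReal fun x => ?_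
      rw [Real.coe_toNNReal _ (hpos x₂).le]
      have := (le_div_iff₀ (hg x)).1 (hx₂ x)
      simp only [ContinuousMap.sub_apply, ContinuousMap.smul_apply, smul_eq_mul]
      linarith
  have hcross : ∀ x y, logCross f g x y = Real.log (f x / g x) - Real.log (f y / g y) := by
    intro x y
    rw [Real.log_div (hf x).ne' (hg x).ne', Real.log_div (hf y).ne' (hg y).ne', logCross]
    ring
  rw [hilbertDist, hU, hL, ENNReal.log_ofReal_of_pos (hpos x₁),
    ENNReal.log_ofReal_of_pos (hpos x₂), ← EReal.coe_sub,
    EReal.toENNReal_of_ne_top (EReal.coe_ne_top _),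
    EReal.toReal_coe]
  refine le_antisymm ?_ (logDist_le_ofReal fun x y => ?_)
  · rw [← hcross]
    exact ofReal_logCross_le _ _ _ _
  · rw [hcross]
    linarith [Real.log_le_log (hpos x) (hx₁ x), Real.log_le_log (hpos x₂) (hx₂ y)]

theorem integral_torus_pos (hf : ∀ x, 0 < f x) : 0 < ∫ x, f x ∂torusMeasure d := by
  obtain ⟨x₀, hx₀⟩ := exists_forall_le_torus f.continuous
  refine (hf x₀).trans_le ?_
  have := integral_mono (μ := torusMeasure d) (integrable_const (f x₀))
    (integrable_torus f.continuous) hx₀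
  simpa using this

/-! ### Positive operators -/

/-- The operator preserves strict positivity. -/
def PreservesPos (A : TorusFn d →L[ℝ] TorusFn d) : Prop :=
  ∀ f : TorusFn d, (∀ x, 0 < f x) → ∀ x, 0 < A f x

variable {A : TorusFn d →L[ℝ] TorusFn d}

theorem hilbertDist_projAction (hA : PreservesPos A) (hf : ∀ x, 0 < f x) (hg : ∀ x, 0 < g x) :
    hilbertDist (projAction A f) (projAction A g) = logDist (A f) (A g) := by
  have h1 : ∀ u : TorusFn d, (∀ x, 0 < u x) → 0 < (∫ x, A u x ∂torusMeasure d)⁻¹ := fun u hu =>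
    inv_pos.2 (integral_torus_pos (hA u hu))
  have h2 : ∀ u : TorusFn d, (∀ x, 0 < u x) → ∀ x, 0 < projAction A u x := fun u hu x =>
    mul_pos (h1 u hu) (hA u hu x)
  rw [hilbertDist_eq_logDist (h2 f hf) (h2 g hg)]
  change logDist (fun x => _ * A f x) (fun x => _ * A g x) = _
  rw [logDist_const_mul_left (h1 f hf).ne' fun x => (hA f hf x).ne',
    logDist_const_mul_right (h1 g hg).ne' fun x => (hA g hg x).ne']

/-- A positive operator contracts the projective distance by the factor `τ(A)`. -/
theorem logDist_le_projNorm_mul (hA : PreservesPos A) (hf : ∀ x, 0 < f x) (hg : ∀ x, 0 < g x) :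
    logDist (A f) (A g) ≤ projNorm A * logDist f g := by
  have hI : ∀ u : TorusFn d, (∀ x, 0 < u x) → 0 < (∫ x, u x ∂torusMeasure d)⁻¹ := fun u hu =>
    inv_pos.2 (integral_torus_pos hu)
  have hnorm : ∀ u : TorusFn d, (∀ x, 0 < u x) →
      (∫ x, u x ∂torusMeasure d)⁻¹ • u ∈ projSpace d := by
    intro u hu
    refine ⟨mem_interior_posCone.2 fun x => mul_pos (hI u hu) (hu x), ?_⟩
    change ∫ x, (∫ x, u x ∂torusMeasure d)⁻¹ * u x ∂torusMeasure d = 1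
    rw [integral_const_mul, inv_mul_cancel₀ (integral_torus_pos hu).ne']
  have hsmul : ∀ (c : ℝ) (u : TorusFn d), ⇑(c • u) = fun x => c * u x := fun c u => rfl
  set f' := (∫ x, f x ∂torusMeasure d)⁻¹ • f with hf'
  set g' := (∫ x, g x ∂torusMeasure d)⁻¹ • g with hg'
  have hpf : ∀ x, 0 < f' x := fun x => mul_pos (hI f hf) (hf x)
  have hpg : ∀ x, 0 < g' x := fun x => mul_pos (hI g hg) (hg x)
  have h1 : logDist f' g' = logDist f g := by
    rw [hf', hg', hsmul, hsmul, logDist_const_mul_left (hI f hf).ne' fun x => (hf x).ne',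
      logDist_const_mul_right (hI g hg).ne' fun x => (hg x).ne']
  have h2 : logDist (A f') (A g') = logDist (A f) (A g) := by
    rw [hf', hg', map_smul, map_smul, hsmul, hsmul,
      logDist_const_mul_left (hI f hf).ne' fun x => (hA f hf x).ne',
      logDist_const_mul_right (hI g hg).ne' fun x => (hA g hg x).ne']
  rw [← h1, ← h2]
  have hself : ∀ u : Torus d → ℝ, logDist u u = 0 := fun u => by simp [logDist, logCross]
  by_cases hfg : f' = g'
  · rw [hfg, hself, hself, mul_zero]
  · have hd0 : logDist f' g' ≠ 0 := by
      intro h0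
      apply hfg
      have hc : ∀ x y, logCross f' g' x y ≤ 0 := fun x y => by
        have := ofReal_logCross_le f' g' x y
        rw [h0, nonpos_iff_eq_zero, ENNReal.ofReal_eq_zero] at this
        exact this
      have hratio : ∀ x, f' x = (f' 0 / g' 0) * g' x := fun x => by
        have e1 : Real.log (f' x * g' 0) = Real.log (f' 0 * g' x) := by
          rw [Real.log_mul (hpf x).ne' (hpg 0).ne', Real.log_mul (hpf 0).ne' (hpg x).ne']
          have a1 := hc x 0
          have a2 := hc 0 x
          simp only [logCross] at a1 a2
          linarith
        have e2 := Real.log_injOn_pos (mul_pos (hpf x) (hpg 0)) (mul_pos (hpf 0) (hpg x)) e1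
        have := (hpg 0).ne'
        field_simp
        linarith
      have hInt : ∫ x, f' x ∂torusMeasure d = (f' 0 / g' 0) * ∫ x, g' x ∂torusMeasure d := by
        rw [← integral_const_mul]
        exact integral_congr_ae (Eventually.of_forall hratio)
      rw [(hnorm f hf).2, (hnorm g hg).2, mul_one] at hInt
      ext x
      rw [hratio x, ← hInt, one_mul]
    rw [← ENNReal.div_le_iff hd0 (logDist_ne_top hpf hpg), ← hilbertDist_projAction hA hpf hpg,
      ← hilbertDist_eq_logDist hpf hpg, projNorm]
    exact le_iSup_of_le f' (le_iSup_of_le (hnorm f hf) (le_iSup_of_le g'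
      (le_iSup_of_le (hnorm g hg) (le_iSup_of_le hfg le_rfl))))

theorem projNorm_le (hA : PreservesPos A) {c : ℝ≥0∞}
    (h : ∀ h₁ h₂ : TorusFn d, logDist (A (expFn h₁)) (A (expFn h₂)) ≤
      c * logDist (expFn h₁) (expFn h₂)) : projNorm A ≤ c := by
  refine iSup₂_le fun f hf => iSup₂_le fun g hg => iSup_le fun hfg => ?_
  have hpf := mem_interior_posCone.1 hf.1
  have hpg := mem_interior_posCone.1 hg.1
  rw [hilbertDist_projAction hA hpf hpg, hilbertDist_eq_logDist hpf hpg]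
  obtain ⟨h₁, rfl⟩ := exists_eq_expFn hpf
  obtain ⟨h₂, rfl⟩ := exists_eq_expFn hpg
  exact ENNReal.div_le_of_le_mul (h h₁ h₂)

theorem continuous_expFn : Continuous (expFn (d := d)) :=
  ContinuousMap.continuous_postcomp ⟨Real.exp, Real.continuous_exp⟩

/-- A Lipschitz estimate for the projective distance extends from a dense sequence. -/
theorem logDist_le_of_denseRange (hA : PreservesPos A) {q : ℕ → TorusFn d} (hq : DenseRange q)
    {c₁ c₂ : ℝ≥0∞} (hc₁ : c₁ ≠ ⊤)
    (h : ∀ i j, logDist (A (expFn (q i))) (A (expFn (q j))) ≤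
      c₁ * logDist (expFn (q i)) (expFn (q j)) + c₂) (h₁ h₂ : TorusFn d) :
    logDist (A (expFn h₁)) (A (expFn h₂)) ≤ c₁ * logDist (expFn h₁) (expFn h₂) + c₂ := by
  obtain ⟨u, hu, hul⟩ := mem_closure_iff_seq_limit.1 (hq h₁)
  obtain ⟨v, hv, hvl⟩ := mem_closure_iff_seq_limit.1 (hq h₂)
  refine iSup₂_le fun x y => ?_
  have hev : ∀ (w : ℕ → TorusFn d) (h : TorusFn d), Tendsto w atTop (𝓝 h) → ∀ x : Torus d,
      Tendsto (fun n => Real.log (A (expFn (w n)) x)) atTop (𝓝 (Real.log (A (expFn h) x))) := by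
    intro w h hw x
    refine Tendsto.log ?_ (hA _ (expFn_pos h) x).ne'
    exact (((continuous_eval_const x).comp (A.continuous.comp continuous_expFn)).tendsto h).comp hw
  have hl : Tendsto (fun n => ENNReal.ofReal (logCross (A (expFn (u n))) (A (expFn (v n))) x y))
      atTop (𝓝 (ENNReal.ofReal (logCross (A (expFn h₁)) (A (expFn h₂)) x y))) :=
    (ENNReal.continuous_ofReal.tendsto _).comp
      (((hev u h₁ hul x).sub (hev u h₁ hul y)).sub ((hev v h₂ hvl x).sub (hev v h₂ hvl y)))
  have hdist : ∀ (w : ℕ → TorusFn d) (h : TorusFn d), Tendsto w atTop (𝓝 h) →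
      Tendsto (fun n => ENNReal.ofReal (2 * ‖w n - h‖)) atTop (𝓝 0) := by
    intro w h hw
    have h1 : Tendsto (fun n => 2 * ‖w n - h‖) atTop (𝓝 (2 * 0)) :=
      (tendsto_iff_norm_sub_tendsto_zero.1 hw).const_mul 2
    have := (ENNReal.continuous_ofReal.tendsto _).comp h1
    rwa [mul_zero, ENNReal.ofReal_zero] at this
  have hr : Tendsto (fun n => c₁ * (ENNReal.ofReal (2 * ‖u n - h₁‖) +
      logDist (expFn h₁) (expFn h₂) + ENNReal.ofReal (2 * ‖v n - h₂‖)) + c₂) atTop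
      (𝓝 (c₁ * (0 + logDist (expFn h₁) (expFn h₂) + 0) + c₂)) := by
    refine Tendsto.add (ENNReal.Tendsto.const_mul ?_ (Or.inr hc₁)) tendsto_const_nhds
    exact ((hdist u h₁ hul).add tendsto_const_nhds).add (hdist v h₂ hvl)
  rw [zero_add, add_zero] at hr
  refine le_of_tendsto_of_tendsto' hl hr fun n => ?_
  obtain ⟨i, hi⟩ := hu n
  obtain ⟨j, hj⟩ := hv n
  refine (ofReal_logCross_le _ _ x y).trans ?_
  rw [← hi, ← hj]
  refine (h i j).trans ?_
  gcongr
  refine (logDist_triangle _ (expFn h₁) _).trans ?_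
  rw [add_assoc]
  refine add_le_add (logDist_expFn_le _ _) ((logDist_triangle _ (expFn h₂) _).trans ?_)
  gcongr
  rw [logDist_comm]
  exact logDist_expFn_le _ _

/-- The projective distance is a countable supremum. -/
theorem logDist_eq_iSup_denseRange {p : ℕ → Torus d} (hp : DenseRange p) (hf : ∀ x, 0 < f x)
    (hg : ∀ x, 0 < g x) :
    logDist f g = ⨆ (i) (j), ENNReal.ofReal (logCross f g (p i) (p j)) := by
  refine le_antisymm ?_ (iSup₂_le fun i j => ofReal_logCross_le _ _ _ _)
  set S := ⨆ (i) (j), ENNReal.ofReal (logCross f g (p i) (p j)) with hS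
  have hcont : Continuous fun z : Torus d × Torus d => ENNReal.ofReal (logCross f g z.1 z.2) := by
    have hlf : Continuous fun x => Real.log (f x) := f.continuous.log fun x => (hf x).ne'
    have hlg : Continuous fun x => Real.log (g x) := g.continuous.log fun x => (hg x).ne'
    have : Continuous fun z : Torus d × Torus d => logCross f g z.1 z.2 := by
      exact ((hlf.comp continuous_fst).sub (hlf.comp continuous_snd)).sub
        ((hlg.comp continuous_fst).sub (hlg.comp continuous_snd))
    exact ENNReal.continuous_ofReal.comp this
  have hclosed : IsClosed {z : Torus d × Torus d | ENNReal.ofReal (logCross f g z.1 z.2) ≤ S} :=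
    isClosed_le hcont continuous_const
  refine iSup₂_le fun x y => ?_
  have hd : DenseRange (Prod.map p p) := hp.prodMap hp
  have := hd.induction_on (p := fun z => ENNReal.ofReal (logCross f g z.1 z.2) ≤ S) (x, y) hclosed
    (fun z => le_iSup₂ (f := fun i j => ENNReal.ofReal (logCross f g (p i) (p j))) z.1 z.2)
  exact this

/-! ### Birkhoff's contraction -/

/-- The analytic core of Birkhoff's contraction: differentiate in D. With a = r exp t ≤ q r' exp t =
q b, the derivative a / (a + 1) - b / (b + 1) is at most (q - 1) / (q + 1). This is not optimal, but
it is below one. -/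
theorem log_ratio_le {r r' q D : ℝ} (hr : 0 < r) (hr' : 0 < r') (hq : 1 ≤ q) (hrq : r ≤ q * r')
    (hD : 0 ≤ D) :
    Real.log ((Real.exp D * r + 1) / (r + 1)) - Real.log ((Real.exp D * r' + 1) / (r' + 1)) ≤
      (q - 1) / (q + 1) * D := by
  have hlog : ∀ {s : ℝ}, 0 < s → ∀ t : ℝ, HasDerivAt
      (fun t => Real.log ((Real.exp t * s + 1) / (s + 1)))
      (Real.exp t * s / (Real.exp t * s + 1)) t := by
    intro s hs t
    have h1 : HasDerivAt (fun t => (Real.exp t * s + 1) / (s + 1))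
        (Real.exp t * s / (s + 1)) t :=
      (((Real.hasDerivAt_exp t).mul_const s).add_const 1).div_const (s + 1)
    have hne : (Real.exp t * s + 1) / (s + 1) ≠ 0 := by positivity
    convert h1.log hne using 1
    field_simp
  have hF : ∀ t : ℝ, HasDerivAt (fun t => Real.log ((Real.exp t * r + 1) / (r + 1)) -
      Real.log ((Real.exp t * r' + 1) / (r' + 1)))
      (Real.exp t * r / (Real.exp t * r + 1) - Real.exp t * r' / (Real.exp t * r' + 1)) t :=
    fun t => (hlog hr t).sub (hlog hr' t)
  have := image_sub_le_mul_sub_of_deriv_le (C := (q - 1) / (q + 1))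
    (fun t => (hF t).differentiableAt) (fun t => ?_) hD
  · simpa [div_self (by positivity : r + 1 ≠ 0), div_self (by positivity : r' + 1 ≠ 0)] using this
  · rw [(hF t).deriv]
    set a := Real.exp t * r with ha
    set b := Real.exp t * r' with hb
    have ha0 : 0 < a := by positivity
    have hb0 : 0 < b := by positivity
    have hab : a ≤ q * b := by
      rw [ha, hb]
      nlinarith [Real.exp_pos t]
    rw [div_sub_div _ _ (by positivity) (by positivity), div_le_div_iff₀ (by positivity)
      (by positivity)]
    -- The difference of the two sides is 2(qb - a) + (q - 1)(ab + 1).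
    nlinarith [mul_pos ha0 hb0, mul_nonneg (sub_nonneg.2 hq) (mul_pos ha0 hb0).le]

variable {k : C(Torus d × Torus d, ℝ)} {γ δ : ℝ}

theorem kernel_bounds (hA : ∀ f x, A f x = ∫ y, k (x, y) * f y ∂torusMeasure d)
    (hk : ∀ x y, γ ≤ k (x, y) ∧ k (x, y) ≤ δ) (hf : ∀ x, 0 < f x) (x : Torus d) :
    γ * ∫ y, f y ∂torusMeasure d ≤ A f x ∧ A f x ≤ δ * ∫ y, f y ∂torusMeasure d := by
  have hi : Integrable (fun y => f y) (torusMeasure d) := integrable_torus f.continuous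
  have hik : Integrable (fun y => k (x, y) * f y) (torusMeasure d) :=
    integrable_torus (by fun_prop)
  rw [hA, ← integral_const_mul, ← integral_const_mul]
  exact ⟨integral_mono (hi.const_mul γ) hik fun y =>
      mul_le_mul_of_nonneg_right (hk x y).1 (hf y).le,
    integral_mono hik (hi.const_mul δ) fun y => mul_le_mul_of_nonneg_right (hk x y).2 (hf y).le⟩

theorem preservesPos_of_kernel (hA : ∀ f x, A f x = ∫ y, k (x, y) * f y ∂torusMeasure d)
    (hk : ∀ x y, γ ≤ k (x, y) ∧ k (x, y) ≤ δ) (hγ : 0 < γ) : PreservesPos A := fun _ hf x =>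
  (mul_pos hγ (integral_torus_pos hf)).trans_le (kernel_bounds hA hk hf x).1

theorem div_le_of_kernel (hA : ∀ f x, A f x = ∫ y, k (x, y) * f y ∂torusMeasure d)
    (hk : ∀ x y, γ ≤ k (x, y) ∧ k (x, y) ≤ δ) (hγ : 0 < γ) (hf : ∀ x, 0 < f x) (x y : Torus d) :
    A f x ≤ δ / γ * A f y := by
  have h1 := (kernel_bounds hA hk hf x).2
  have h2 := (kernel_bounds hA hk hf y).1
  have h3 := integral_torus_pos hf
  have hδ : 0 ≤ δ := (hγ.le.trans (hk 0 0).1).trans (hk 0 0).2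
  calc A f x ≤ δ / γ * (γ * ∫ y, f y ∂torusMeasure d) := by
        rw [← mul_assoc, div_mul_cancel₀ _ hγ.ne']; exact h1
    _ ≤ _ := by gcongr

/-- A positive kernel maps the cone onto a set of finite projective diameter. -/
theorem logDist_le_of_kernel (hA : ∀ f x, A f x = ∫ y, k (x, y) * f y ∂torusMeasure d)
    (hk : ∀ x y, γ ≤ k (x, y) ∧ k (x, y) ≤ δ) (hγ : 0 < γ) (hf : ∀ x, 0 < f x)
    (hg : ∀ x, 0 < g x) : logDist (A f) (A g) ≤ ENNReal.ofReal (2 * Real.log (δ / γ)) := by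
  have hpos := preservesPos_of_kernel hA hk hγ
  have hδ : 0 < δ := (hγ.trans_le (hk 0 0).1).trans_le (hk 0 0).2
  refine logDist_le_ofReal fun x y => ?_
  have key : ∀ u : TorusFn d, (∀ x, 0 < u x) → ∀ x y,
      Real.log (A u x) - Real.log (A u y) ≤ Real.log (δ / γ) := by
    intro u hu x y
    have := Real.log_le_log (hpos u hu x) (div_le_of_kernel hA hk hγ hu x y)
    rw [Real.log_mul (by positivity) (hpos u hu y).ne'] at this
    linarith
  have h1 := key f hf x y
  have h2 := key g hg y x
  simp only [logCross]
  linarith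

/-- Birkhoff's theorem: a kernel operator with a kernel bounded above and away from zero is a
strict contraction of the projective distance. -/
theorem projNorm_lt_one_of_kernel (hA : ∀ f x, A f x = ∫ y, k (x, y) * f y ∂torusMeasure d)
    (hk : ∀ x y, γ ≤ k (x, y) ∧ k (x, y) ≤ δ) (hγ : 0 < γ) : projNorm A < 1 := by
  have hpos := preservesPos_of_kernel hA hk hγ
  have hγδ : γ ≤ δ := (hk 0 0).1.trans (hk 0 0).2
  -- Each of A u and A v varies by a factor of at most δ / γ, so their quotient varies by at most q.
  set q : ℝ := (δ / γ) * (δ / γ) with hq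
  have hδγ : 1 ≤ δ / γ := (one_le_div hγ).2 hγδ
  have hq1 : 1 ≤ q := one_le_mul_of_one_le_of_one_le hδγ hδγ
  have hc0 : 0 ≤ (q - 1) / (q + 1) := div_nonneg (by linarith) (by linarith)
  have hc1 : (q - 1) / (q + 1) < 1 := (div_lt_one (by linarith)).2 (by linarith)
  refine (projNorm_le hpos (c := ENNReal.ofReal ((q - 1) / (q + 1))) fun h₁ h₂ => ?_).trans_lt
    (by rw [← ENNReal.ofReal_one]; exact (ENNReal.ofReal_lt_ofReal_iff one_pos).2 hc1)
  set f := expFn h₁ with hfdef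
  set g := expFn h₂ with hgdef
  have hf : ∀ x, 0 < f x := expFn_pos h₁
  have hg : ∀ x, 0 < g x := expFn_pos h₂
  have htop := logDist_ne_top hf hg
  set D := (logDist f g).toReal with hD
  have hD0 : 0 ≤ D := ENNReal.toReal_nonneg
  rw [← ENNReal.ofReal_toReal htop, ← ENNReal.ofReal_mul hc0, ← hD]
  refine logDist_le_ofReal fun x y => ?_
  have hρ : Continuous fun x => f x / g x := f.continuous.div g.continuous fun x => (hg x).ne'
  obtain ⟨y₀, hy₀⟩ := exists_forall_le_torus hρ
  set m := f y₀ / g y₀ with hm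
  have hm0 : 0 < m := div_pos (hf _) (hg _)
  have hlow : ∀ x, m * g x ≤ f x := fun x => (le_div_iff₀ (hg x)).1 (hy₀ x)
  have hupp : ∀ x, f x ≤ m * Real.exp D * g x := fun x => by
    have h1 := logCross_le_toReal htop x y₀
    have h2 : Real.log (f x / g x) ≤ Real.log (m * Real.exp D) := by
      rw [Real.log_mul hm0.ne' (Real.exp_ne_zero _), Real.log_exp, hm,
        Real.log_div (hf x).ne' (hg x).ne', Real.log_div (hf y₀).ne' (hg y₀).ne']
      simp only [logCross] at h1
      linarith
    have h3 := (Real.log_le_log_iff (div_pos (hf x) (hg x)) (by positivity)).1 h2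
    exact (div_le_iff₀ (hg x)).1 h3
  -- At the optimal constants f - m g and m exp(D) g - f are merely nonnegative. Widening the
  -- interval by ε on both sides makes them strictly positive, and ε tends to zero at the end.
  have hε : ∀ ε > 0, logCross (A f) (A g) x y ≤ (q - 1) / (q + 1) * (D + 2 * ε) := by
    intro ε hε
    set m' := m * Real.exp (-ε) with hm'
    have hm'0 : 0 < m' := by positivity
    have hm'm : m' < m := by
      rw [hm']
      exact mul_lt_of_lt_one_right hm0 (Real.exp_lt_one_iff.2 (by linarith))
    have hM : m * Real.exp D < m' * Real.exp (D + 2 * ε) := by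
      rw [hm', mul_assoc, ← Real.exp_add]
      exact mul_lt_mul_of_pos_left (Real.exp_lt_exp.2 (by linarith)) hm0
    set M := m' * Real.exp (D + 2 * ε) with hMdef
    set u : TorusFn d := f - m' • g with hu
    set v : TorusFn d := M • g - f with hv
    have hu0 : ∀ x, 0 < u x := fun x => by
      have : u x = f x - m' * g x := rfl
      rw [this]
      nlinarith [hlow x, hg x]
    have hv0 : ∀ x, 0 < v x := fun x => by
      have : v x = M * g x - f x := rfl
      rw [this]
      nlinarith [hupp x, hg x]
    have hMm : 0 < M - m' := by
      have : m' < M := hm'm.trans_le ((le_mul_of_one_le_right hm0.le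
        (Real.one_le_exp hD0)).trans hM.le)
      linarith
    have hU := hpos u hu0
    have hV := hpos v hv0
    -- f and g are combinations of u and v, so A f / A g is a Möbius function of A u / A v, to which
    -- `log_ratio_le` applies.
    have hAf : ∀ z, (M - m') * A f z = M * A u z + m' * A v z := fun z => by
      have e1 : A u z = A f z - m' * A g z := by rw [hu, map_sub, map_smul]; rfl
      have e2 : A v z = M * A g z - A f z := by rw [hv, map_sub, map_smul]; rfl
      rw [e1, e2]
      ring
    have hAg : ∀ z, (M - m') * A g z = A u z + A v z := fun z => by
      have e1 : A u z = A f z - m' * A g z := by rw [hu, map_sub, map_smul]; rfl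
      have e2 : A v z = M * A g z - A f z := by rw [hv, map_sub, map_smul]; rfl
      rw [e1, e2]
      ring
    have hratio : ∀ z, A f z / A g z =
        m' * ((Real.exp (D + 2 * ε) * (A u z / A v z) + 1) / (A u z / A v z + 1)) := fun z => by
      have h1 : A f z / A g z = (M * A u z + m' * A v z) / (A u z + A v z) := by
        rw [← hAf, ← hAg, mul_div_mul_left _ _ hMm.ne']
      rw [h1, hMdef]
      have := (hU z).ne'
      have := (hV z).ne'
      field_simp
    have hcmp : A u x / A v x ≤ q * (A u y / A v y) := by
      have h1 := div_le_of_kernel hA hk hγ hu0 x y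
      have h2 := div_le_of_kernel hA hk hγ hv0 y x
      rw [mul_div_assoc', div_le_div_iff₀ (hV x) (hV y), hq]
      calc A u x * A v y ≤ (δ / γ * A u y) * (δ / γ * A v x) :=
            mul_le_mul h1 h2 (hV y).le (by have := (hU y).le; positivity)
        _ = _ := by ring
    have hfin := log_ratio_le (div_pos (hU x) (hV x)) (div_pos (hU y) (hV y)) hq1 hcmp
      (D := D + 2 * ε) (by linarith)
    have hlogr : ∀ z, Real.log (A f z) - Real.log (A g z) = Real.log m' +
        Real.log ((Real.exp (D + 2 * ε) * (A u z / A v z) + 1) / (A u z / A v z + 1)) := by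
      intro z
      have hr := div_pos (hU z) (hV z)
      rw [← Real.log_div (hpos f hf z).ne' (hpos g hg z).ne', hratio,
        Real.log_mul hm'0.ne' (by positivity)]
    have hx := hlogr x
    have hy := hlogr y
    simp only [logCross]
    linarith
  refine le_of_forall_pos_le_add fun ε hε0 => ?_
  have h1 := hε (ε / 2) (by positivity)
  nlinarith

end ProjectiveDistance

/-! ### Pathwise properties of the solution map -/

section Pathwise

variable {Ω : Type*} {ϑ : ℤ → Ω → Ω} {d : ℕ} {φ : ℝ≥0 → Ω → (TorusFn d →L[ℝ] TorusFn d)}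
  {β : ℝ} {Ω₀ : Set Ω} {ω : Ω}

/-- The pathwise consequences of the standing assumption that hold on an invariant set. -/
structure IsRegularSet (ϑ : ℤ → Ω → Ω) (φ : ℝ≥0 → Ω → (TorusFn d →L[ℝ] TorusFn d)) (β : ℝ)
    (Ω₀ : Set Ω) : Prop where
  invariant : ∀ z, ∀ ω ∈ Ω₀, ϑ z ω ∈ Ω₀
  pos : ∀ ω ∈ Ω₀, ∀ t, 0 < t → PreservesPos (φ t ω)
  continuousOn : ∀ ω ∈ Ω₀, ∀ f, ContinuousOn (fun t => φ t ω f) (Ioi 0)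
  lower : ∀ ω ∈ Ω₀, ∀ S T, 0 < S → S < T → ∃ γ : ℝ, 0 < γ ∧ ∀ t ∈ Icc S T, ∀ f : TorusFn d,
    (∀ x, 0 < f x) → ∀ x, γ * ∫ y, f y ∂torusMeasure d ≤ φ t ω f x
  smoothing : ∀ ω ∈ Ω₀, ∀ S T, 0 < S → S < T → ∃ C : ℝ, 0 ≤ C ∧ ∀ t ∈ Icc S T, ∀ f : TorusFn d,
    holderNorm β (periodicLift (φ t ω f)) ≤ ENNReal.ofReal (C * ‖f‖)
  diam : ∀ ω ∈ Ω₀, ∃ M : ℝ, ∀ f g : TorusFn d, (∀ x, 0 < f x) → (∀ x, 0 < g x) →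
    logDist (φ 1 ω f) (φ 1 ω g) ≤ ENNReal.ofReal M
  contracting : ∀ ω ∈ Ω₀, ∀ t, 0 < t → projNorm (φ t ω) < 1

theorem isRegularSet_of_kernel {K : Ω → ℝ≥0 → C(Torus d × Torus d, ℝ)} {C : Ω → ℝ≥0 → ℝ≥0 → ℝ}
    (hinv : ∀ z, ϑ z '' Ω₀ = Ω₀)
    (hK : ∀ ω ∈ Ω₀, ContinuousOn (K ω) (Ioi 0) ∧
      ∀ t, 0 < t → ∀ f x, φ t ω f x = ∫ y, K ω t (x, y) * f y ∂torusMeasure d)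
    (hbd : ∀ ω ∈ Ω₀, ∀ S T, 0 < S → S < T → ∃ γ δ : ℝ, 0 < γ ∧ γ ≤ δ ∧
      ∀ t ∈ Icc S T, ∀ x y, γ ≤ K ω t (x, y) ∧ K ω t (x, y) ≤ δ)
    (hsm : ∀ ω ∈ Ω₀, ∀ S T, 0 < S → S < T → ∀ t ∈ Icc S T, ∀ f : TorusFn d,
      holderNorm β (periodicLift (φ t ω f)) ≤ ENNReal.ofReal (C ω S T * ‖f‖)) :
    IsRegularSet ϑ φ β Ω₀ where
  invariant z ω hω := by
    rw [← hinv z]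
    exact mem_image_of_mem _ hω
  pos ω hω t ht := by
    -- The kernel bounds are assumed on nondegenerate intervals, so the single time t is embedded in
    -- [t, t + 1].
    obtain ⟨γ, δ, hγ, -, h⟩ := hbd ω hω t (t + 1) ht (lt_add_one t)
    exact preservesPos_of_kernel ((hK ω hω).2 t ht) (h t ⟨le_rfl, (lt_add_one t).le⟩) hγ
  continuousOn ω hω f t ht := by
    have hKc := (hK ω hω).1 t ht
    rw [ContinuousWithinAt, tendsto_iff_norm_sub_tendsto_zero] at hKc ⊢
    refine squeeze_zero' (Eventually.of_forall fun s => norm_nonneg _) ?_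
      (by simpa using hKc.mul_const ‖f‖)
    filter_upwards [self_mem_nhdsWithin] with s hs
    refine (ContinuousMap.norm_le _ (by positivity)).2 fun x => ?_
    rw [ContinuousMap.sub_apply, (hK ω hω).2 s hs, (hK ω hω).2 t ht,
      ← integral_sub (integrable_torus (by fun_prop)) (integrable_torus (by fun_prop))]
    have := norm_integral_le_of_norm_le_const (μ := torusMeasure d)
      (f := fun y => K ω s (x, y) * f y - K ω t (x, y) * f y) (C := ‖K ω s - K ω t‖ * ‖f‖)
      (Eventually.of_forall fun y => by
        rw [← sub_mul, norm_mul]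
        exact mul_le_mul ((K ω s - K ω t).norm_coe_le_norm (x, y)) (f.norm_coe_le_norm y)
          (norm_nonneg _) (norm_nonneg _))
    simpa using this
  lower ω hω S T hS hST := by
    obtain ⟨γ, δ, hγ, -, h⟩ := hbd ω hω S T hS hST
    exact ⟨γ, hγ, fun t ht f hf x =>
      (kernel_bounds ((hK ω hω).2 t (hS.trans_le ht.1)) (h t ht) hf x).1⟩
  smoothing ω hω S T hS hST :=
    ⟨max 0 (C ω S T), le_max_left _ _, fun t ht f => (hsm ω hω S T hS hST t ht f).trans
      (ENNReal.ofReal_le_ofReal (mul_le_mul_of_nonneg_right (le_max_right _ _) (norm_nonneg _)))⟩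
  diam ω hω := by
    obtain ⟨γ, δ, hγ, -, h⟩ := hbd ω hω 1 2 one_pos one_lt_two
    exact ⟨_, fun f g hf hg => logDist_le_of_kernel ((hK ω hω).2 1 one_pos)
      (h 1 ⟨le_rfl, one_le_two⟩) hγ hf hg⟩
  contracting ω hω t ht := by
    obtain ⟨γ, δ, hγ, -, h⟩ := hbd ω hω t (t + 1) ht (lt_add_one t)
    exact projNorm_lt_one_of_kernel ((hK ω hω).2 t ht) (h t ⟨le_rfl, (lt_add_one t).le⟩) hγ

theorem IsRegularSet.pos_of_nat (hreg : IsRegularSet ϑ φ β Ω₀) (h0 : ∀ ω f, φ 0 ω f = f)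
    (hω : ω ∈ Ω₀) (t : ℝ≥0) : PreservesPos (φ t ω) := by
  rcases eq_or_ne t 0 with rfl | ht
  · intro f hf x
    rw [h0]
    exact hf x
  · exact hreg.pos ω hω t (pos_iff_ne_zero.2 ht)

/-- The cocycle contracts the projective distance. -/
theorem IsRegularSet.logDist_le_prod (hreg : IsRegularSet ϑ φ β Ω₀) (h0 : ∀ ω f, φ 0 ω f = f)
    (hco : ∀ (t : ℝ≥0) (n : ℕ) ω f, φ (t + n) ω f = φ t (ϑ n ω) (φ n ω f)) (hω : ω ∈ Ω₀) (n : ℕ)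
    {f g : TorusFn d} (hf : ∀ x, 0 < f x) (hg : ∀ x, 0 < g x) :
    logDist (φ n ω f) (φ n ω g) ≤
      (∏ k ∈ Finset.range n, projNorm (φ 1 (ϑ k ω))) * logDist f g := by
  induction n with
  | zero => simp [h0]
  | succ n ih =>
    have hstep : ∀ u, φ (n + 1 : ℕ) ω u = φ 1 (ϑ n ω) (φ n ω u) := fun u => by
      rw [← hco, Nat.cast_add, Nat.cast_one, add_comm]
    rw [hstep, hstep, Finset.prod_range_succ, mul_comm (∏ _ ∈ _, _), mul_assoc]
    have hpos := hreg.pos_of_nat h0 hω n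
    exact (logDist_le_projNorm_mul (hreg.pos _ (hreg.invariant n ω hω) 1 one_pos)
      (hpos f hf) (hpos g hg)).trans (by gcongr)

end Pathwise

/-! ### Measurability -/

section Measurability

variable {Ω : Type*} {ϑ : ℤ → Ω → Ω} {d : ℕ}
  {φ : ℝ≥0 → Ω → (TorusFn d →L[ℝ] TorusFn d)} {β : ℝ} {Ω₀ : Set Ω}

theorem IsContinuousRDS.measurable_eval [MeasurableSpace Ω] (hφ : IsContinuousRDS ϑ φ)
    (t : ℝ≥0) (f : TorusFn d) (x : Torus d) : Measurable fun ω => φ t ω f x := by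
  let _ : MeasurableSpace (TorusFn d) := borel (TorusFn d)
  have : BorelSpace (TorusFn d) := ⟨rfl⟩
  have h1 : Measurable fun ω : Ω => φ t ω f :=
    hφ.measurable.comp (measurable_const.prodMk (measurable_id.prodMk measurable_const))
  exact (continuous_eval_const x).measurable.comp h1

/-- The supremum of the cross ratios of two images over a countable dense set. -/
noncomputable def countableLogDist (φ : ℝ≥0 → Ω → (TorusFn d →L[ℝ] TorusFn d)) (f g : TorusFn d)
    (ω : Ω) : ℝ≥0∞ :=
  ⨆ (a : ℕ) (b : ℕ), ENNReal.ofReal (logCross (φ 1 ω f) (φ 1 ω g)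
    (TopologicalSpace.denseSeq (Torus d) a) (TopologicalSpace.denseSeq (Torus d) b))

theorem measurable_countableLogDist [MeasurableSpace Ω] (hφ : IsContinuousRDS ϑ φ)
    (f g : TorusFn d) :
    Measurable (countableLogDist φ f g) := by
  refine Measurable.iSup fun a => Measurable.iSup fun b => Measurable.ennreal_ofReal ?_
  exact ((hφ.measurable_eval 1 f _).log.sub (hφ.measurable_eval 1 f _).log).sub
    ((hφ.measurable_eval 1 g _).log.sub (hφ.measurable_eval 1 g _).log)

theorem IsRegularSet.countableLogDist_eq (hreg : IsRegularSet ϑ φ β Ω₀) {ω : Ω} (hω : ω ∈ Ω₀)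
    {f g : TorusFn d} (hf : ∀ x, 0 < f x) (hg : ∀ x, 0 < g x) :
    countableLogDist φ f g ω = logDist (φ 1 ω f) (φ 1 ω g) := by
  have hpos := hreg.pos ω hω 1 one_pos
  exact (logDist_eq_iSup_denseRange (TopologicalSpace.denseRange_denseSeq (Torus d))
    (hpos f hf) (hpos g hg)).symm

/-- The exponential of the members of a dense sequence of functions. -/
noncomputable def denseExp (d : ℕ) (i : ℕ) : TorusFn d :=
  expFn (TopologicalSpace.denseSeq (TorusFn d) i)

theorem denseExp_pos (i : ℕ) (x : Torus d) : 0 < denseExp d i x := expFn_pos _ _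

/-- A measurable version of the projective norm. -/
noncomputable def countableProjNorm (φ : ℝ≥0 → Ω → (TorusFn d →L[ℝ] TorusFn d)) (ω : Ω) : ℝ≥0∞ :=
  ⨆ (i : ℕ) (j : ℕ), countableLogDist φ (denseExp d i) (denseExp d j) ω /
    logDist (denseExp d i) (denseExp d j)

/-- A measurable version of the projective diameter of the range. -/
noncomputable def countableDiam (φ : ℝ≥0 → Ω → (TorusFn d →L[ℝ] TorusFn d)) (ω : Ω) : ℝ≥0∞ :=
  ⨆ (i : ℕ) (j : ℕ), countableLogDist φ (denseExp d i) (denseExp d j) ω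

theorem measurable_countableProjNorm [MeasurableSpace Ω] (hφ : IsContinuousRDS ϑ φ) :
    Measurable (countableProjNorm φ) :=
  Measurable.iSup fun _ => Measurable.iSup fun _ =>
    (measurable_countableLogDist hφ _ _).div_const _

theorem measurable_countableDiam [MeasurableSpace Ω] (hφ : IsContinuousRDS ϑ φ) :
    Measurable (countableDiam φ) :=
  Measurable.iSup fun _ => Measurable.iSup fun _ => measurable_countableLogDist hφ _ _

/-- Lipschitz estimates pass from a dense sequence of logarithms to all positive functions, so
countably many pairs determine τ. This makes τ(φ_1) almost surely equal to a measurable function. -/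
theorem IsRegularSet.countableProjNorm_eq (hreg : IsRegularSet ϑ φ β Ω₀) {ω : Ω} (hω : ω ∈ Ω₀) :
    countableProjNorm φ ω = projNorm (φ 1 ω) := by
  have hpos := hreg.pos ω hω 1 one_pos
  have hle : countableProjNorm φ ω ≤ projNorm (φ 1 ω) := by
    refine iSup₂_le fun i j => ENNReal.div_le_of_le_mul ?_
    rw [hreg.countableLogDist_eq hω (denseExp_pos i) (denseExp_pos j)]
    exact logDist_le_projNorm_mul hpos (denseExp_pos i) (denseExp_pos j)
  refine le_antisymm hle (projNorm_le hpos fun h₁ h₂ => ?_)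
  have hfin : countableProjNorm φ ω ≠ ⊤ :=
    ((hle.trans_lt (hreg.contracting ω hω 1 one_pos)).trans ENNReal.one_lt_top).ne
  have := logDist_le_of_denseRange hpos (TopologicalSpace.denseRange_denseSeq (TorusFn d))
    (c₂ := 0) hfin (fun i j => ?_) h₁ h₂
  · simpa using this
  · rw [add_zero]
    change logDist (φ 1 ω (denseExp d i)) (φ 1 ω (denseExp d j)) ≤
      _ * logDist (denseExp d i) (denseExp d j)
    -- For pairs at distance zero the quotient carries no information; there contraction gives
    -- distance zero of the images.
    by_cases h0 : logDist (denseExp d i) (denseExp d j) = 0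
    · have := logDist_le_projNorm_mul hpos (denseExp_pos i) (denseExp_pos j)
      rw [h0, mul_zero] at this ⊢
      exact this
    · rw [← ENNReal.div_le_iff h0 (logDist_ne_top (denseExp_pos i) (denseExp_pos j)),
        ← hreg.countableLogDist_eq hω (denseExp_pos i) (denseExp_pos j)]
      exact le_iSup₂ (f := fun i j => countableLogDist φ (denseExp d i) (denseExp d j) ω /
        logDist (denseExp d i) (denseExp d j)) i j

/-- The same density argument, with Lipschitz constant zero and the diameter as additive constant.
-/
theorem IsRegularSet.logDist_le_countableDiam (hreg : IsRegularSet ϑ φ β Ω₀) {ω : Ω} (hω : ω ∈ Ω₀)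
    {f g : TorusFn d} (hf : ∀ x, 0 < f x) (hg : ∀ x, 0 < g x) :
    logDist (φ 1 ω f) (φ 1 ω g) ≤ countableDiam φ ω := by
  obtain ⟨h₁, rfl⟩ := exists_eq_expFn hf
  obtain ⟨h₂, rfl⟩ := exists_eq_expFn hg
  have := logDist_le_of_denseRange (hreg.pos ω hω 1 one_pos)
    (TopologicalSpace.denseRange_denseSeq (TorusFn d))
    (c₁ := 0) (c₂ := countableDiam φ ω) ENNReal.zero_ne_top (fun i j => ?_) h₁ h₂
  · simpa using this
  · rw [zero_mul, zero_add]
    change logDist (φ 1 ω (denseExp d i)) (φ 1 ω (denseExp d j)) ≤ _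
    rw [← hreg.countableLogDist_eq hω (denseExp_pos i) (denseExp_pos j)]
    exact le_iSup₂ (f := fun i j => countableLogDist φ (denseExp d i) (denseExp d j) ω) i j

theorem IsRegularSet.countableDiam_lt_top (hreg : IsRegularSet ϑ φ β Ω₀) {ω : Ω} (hω : ω ∈ Ω₀) :
    countableDiam φ ω < ⊤ := by
  obtain ⟨M, hM⟩ := hreg.diam ω hω
  refine (iSup₂_le fun i j => ?_).trans_lt (ENNReal.ofReal_lt_top (r := M))
  rw [hreg.countableLogDist_eq hω (denseExp_pos i) (denseExp_pos j)]
  exact hM _ _ (denseExp_pos i) (denseExp_pos j)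

/-- Under the moment assumption the solution started in zero has an integrable envelope. -/
theorem IsRegularSet.exists_envelope [MeasurableSpace Ω] {P : Measure Ω}
    (hreg : IsRegularSet ϑ φ β Ω₀) (hP : P Ω₀ᶜ = 0) (hϑ0 : ∀ ω, ϑ 0 ω = ω) (hφ : IsContinuousRDS ϑ φ)
    (hmom : HasKPZMoments P ϑ φ) {N : ℝ≥0} (hN : 1 < N) :
    ∃ Y : Ω → ℝ, Integrable Y P ∧ ∀ᵐ ω ∂P, ∀ t ∈ Icc 1 N, ∀ x,
      |Real.log (φ t ω (expFn 0) x)| ≤ Y ω := by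
  have hmomN := hmom 1 N one_pos (by exact_mod_cast hN)
  have hne : Nonempty (Icc (1 : ℝ≥0) N) := ⟨⟨1, le_rfl, hN.le⟩⟩
  set e := TopologicalSpace.denseSeq (Icc (1 : ℝ≥0) N) with he
  set p := TopologicalSpace.denseSeq (Torus d) with hp
  -- The supremum over dense times and points is measurable and below the one in the moment
  -- assumption; continuity in time and space gives the bound everywhere.
  set Z : Ω → ℝ≥0∞ := fun ω => ⨆ (a : ℕ) (b : ℕ),
    ENNReal.ofReal |Real.log (φ (e a) ω (expFn 0) (p b))| with hZ
  have hZm : Measurable Z := Measurable.iSup fun a => Measurable.iSup fun b =>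
    Measurable.ennreal_ofReal (hφ.measurable_eval _ _ _).log.abs
  have hZint : ∫⁻ ω, Z ω ∂P ≠ ⊤ := by
    refine ((lintegral_mono fun ω => ?_).trans_lt hmomN).ne
    refine iSup₂_le fun a b => ?_
    have hmem : ((e a : ℝ≥0) : ℝ) ∈ Icc (1 : ℝ) N :=
      ⟨by exact_mod_cast (e a).2.1, by exact_mod_cast (e a).2.2⟩
    refine le_trans ?_ (le_iSup₂_of_le ((e a : ℝ≥0) : ℝ) hmem
      (le_iSup (fun x => ‖kpzSolution ϑ φ 0 0 ω ((e a : ℝ≥0) : ℝ) x‖ₑ) (p b)))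
    rw [← ofReal_norm, Real.norm_eq_abs, kpzSolution, hϑ0]
    simp
  refine ⟨fun ω => (Z ω).toReal, integrable_toReal_of_lintegral_ne_top hZm.aemeasurable hZint, ?_⟩
  have hae : ∀ᵐ ω ∂P, ω ∈ Ω₀ := by
    rw [ae_iff]
    exact hP
  filter_upwards [hae, ae_lt_top hZm hZint] with ω hω hfin t ht x
  have hcont : Continuous fun z : Icc (1 : ℝ≥0) N × Torus d =>
      |Real.log (φ z.1 ω (expFn 0) z.2)| := by
    have h1 : Continuous fun t : Icc (1 : ℝ≥0) N => φ t ω (expFn 0) :=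
      ((hreg.continuousOn ω hω (expFn 0)).mono fun t ht =>
        one_pos.trans_le ht.1).comp_continuous continuous_subtype_val fun t => t.2
    have h2 : Continuous fun z : Icc (1 : ℝ≥0) N × Torus d => φ z.1 ω (expFn 0) z.2 :=
      (h1.comp continuous_fst).eval continuous_snd
    exact (h2.log fun z => (hreg.pos ω hω _ (one_pos.trans_le z.1.2.1) _
      (expFn_pos 0) _).ne').abs
  have hd : DenseRange (Prod.map e p) := (TopologicalSpace.denseRange_denseSeq _).prodMap
    (TopologicalSpace.denseRange_denseSeq _)
  exact hd.induction_on (p := fun z => |Real.log (φ z.1 ω (expFn 0) z.2)| ≤ (Z ω).toReal)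
    (⟨t, ht⟩, x) (isClosed_le hcont continuous_const) fun z =>
      (ENNReal.ofReal_le_iff_le_toReal hfin.ne).1 (le_iSup₂ (f := fun a b =>
        ENNReal.ofReal |Real.log (φ (e a) ω (expFn 0) (p b))|) z.1 z.2)

end Measurability

/-! ### Almost sure asymptotics -/

section Asymptotics

variable {Ω : Type*} [MeasurableSpace Ω] {P : Measure Ω} {ϑ : ℤ → Ω → Ω}

theorem IsErgodicIDS.iterate_one (hϑ : IsErgodicIDS P ϑ) (k : ℕ) (ω : Ω) :
    (ϑ 1)^[k] ω = ϑ k ω := by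
  induction k with
  | zero => simp [hϑ.zero]
  | succ k ih =>
    rw [Function.iterate_succ_apply', ih, ← hϑ.add]
    congr 1
    push_cast
    ring

theorem IsErgodicIDS.iterate_neg_one (hϑ : IsErgodicIDS P ϑ) (k : ℕ) (ω : Ω) :
    (ϑ (-1))^[k] ω = ϑ (-(k : ℤ)) ω := by
  induction k with
  | zero => simp [hϑ.zero]
  | succ k ih =>
    rw [Function.iterate_succ_apply', ih, ← hϑ.add]
    congr 1
    push_cast
    ring

/-- A map and its inverse have the same invariant sets. The pullback runs the ergodic theorem along
ϑ⁻¹. -/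
theorem IsErgodicIDS.ergodic_neg_one (hϑ : IsErgodicIDS P ϑ) : Ergodic (ϑ (-1)) P where
  toMeasurePreserving := hϑ.measurePreserving (-1)
  toPreErgodic := ⟨fun s hs hinv => by
    refine hϑ.ergodic.toPreErgodic.aeconst_set hs ?_
    conv_lhs => rw [← hinv]
    ext ω
    rw [mem_preimage, mem_preimage, ← hϑ.add]
    simp [hϑ.zero]⟩

/-- An event of full probability contains an invariant measurable one. -/
theorem IsErgodicIDS.exists_invariant [IsProbabilityMeasure P] (hϑ : IsErgodicIDS P ϑ)
    {p : Ω → Prop} (hp : ∀ᵐ ω ∂P, p ω) :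
    ∃ Ω₁ : Set Ω, MeasurableSet Ω₁ ∧ (∀ z, ϑ z '' Ω₁ = Ω₁) ∧ P Ω₁ = 1 ∧ ∀ ω ∈ Ω₁, p ω := by
  obtain ⟨s, hs, hsm, hs0⟩ := exists_measurable_superset_of_null (ae_iff.1 hp)
  -- The invariant set consists of the points whose entire orbit avoids a measurable null cover of
  -- the exceptional set.
  have hall : ∀ᵐ ω ∂P, ∀ z, ϑ z ω ∉ s := ae_all_iff.2 fun z =>
    (hϑ.measurePreserving z).quasiMeasurePreserving.ae (measure_eq_zero_iff_ae_notMem.1 hs0)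
  have hmem : ∀ z, ∀ ω ∈ ⋂ z, ϑ z ⁻¹' sᶜ, ϑ z ω ∈ ⋂ z, ϑ z ⁻¹' sᶜ := by
    intro z ω hω
    refine mem_iInter.2 fun z' => ?_
    rw [mem_preimage, ← hϑ.add]
    exact mem_iInter.1 hω (z' + z)
  refine ⟨⋂ z, ϑ z ⁻¹' sᶜ, MeasurableSet.iInter fun z =>
    (hϑ.measurePreserving z).measurable hsm.compl, fun z => ?_, ?_, fun ω hω => ?_⟩
  · refine Subset.antisymm (image_subset_iff.2 (hmem z)) fun ω hω => ?_
    refine ⟨ϑ (-z) ω, hmem (-z) ω hω, ?_⟩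
    rw [← hϑ.add, add_neg_cancel, hϑ.zero]
  · rw [← measure_univ (μ := P)]
    refine measure_congr (eventuallyEq_univ.2 ?_)
    filter_upwards [hall] with ω hω
    exact mem_iInter.2 hω
  · by_contra hn
    have h0 := mem_iInter.1 hω 0
    rw [mem_preimage, hϑ.zero] at h0
    exact h0 (hs hn)

variable {d : ℕ} {φ : ℝ≥0 → Ω → (TorusFn d →L[ℝ] TorusFn d)} {β : ℝ} {Ω₀ : Set Ω}

theorem IsRegularSet.contractionRate_eq (hreg : IsRegularSet ϑ φ β Ω₀) (hP : ∀ᵐ ω ∂P, ω ∈ Ω₀) :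
    contractionRate P φ = logExpectation P (countableProjNorm φ) :=
  logExpectation_congr (τ := fun ω => projNorm (φ 1 ω))
    (hP.mono fun _ hω => (hreg.countableProjNorm_eq hω).symm)

theorem IsRegularSet.contractionRate_neg [IsProbabilityMeasure P] (hreg : IsRegularSet ϑ φ β Ω₀)
    (hP : ∀ᵐ ω ∂P, ω ∈ Ω₀) (hφ : IsContinuousRDS ϑ φ) : contractionRate P φ < 0 := by
  rw [hreg.contractionRate_eq hP]
  refine logExpectation_neg (measurable_countableProjNorm hφ) (hP.mono fun ω hω => ?_)
  rw [hreg.countableProjNorm_eq hω]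
  exact hreg.contracting ω hω 1 one_pos

theorem IsRegularSet.ae_eventually_prod_projNorm_le [IsProbabilityMeasure P]
    (hreg : IsRegularSet ϑ φ β Ω₀) (hP : ∀ᵐ ω ∂P, ω ∈ Ω₀) (hφ : IsContinuousRDS ϑ φ) {T : Ω → Ω}
    (hT : Ergodic T P) (hTΩ : ∀ ω ∈ Ω₀, T ω ∈ Ω₀) :
    ∀ᵐ ω ∂P, ∀ c : ℝ, contractionRate P φ < c → ∀ᶠ n : ℕ in atTop,
      ∏ k ∈ Finset.range n, projNorm (φ 1 (T^[k] ω)) ≤ ENNReal.ofReal (Real.exp (c * n)) := by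
  have hk : ∀ (k : ℕ), ∀ ω ∈ Ω₀, T^[k] ω ∈ Ω₀ := fun k ω hω => by
    induction k with
    | zero => exact hω
    | succ k ih =>
      rw [Function.iterate_succ_apply']
      exact hTΩ _ ih
  rw [hreg.contractionRate_eq hP]
  filter_upwards [hP, ae_eventually_prod_le hT (measurable_countableProjNorm hφ)
    (hP.mono fun ω hω => by
      rw [hreg.countableProjNorm_eq hω]
      exact (hreg.contracting ω hω 1 one_pos).le)] with ω hω h c hc
  filter_upwards [h c hc] with n hn
  refine le_trans (le_of_eq (Finset.prod_congr rfl fun k _ => ?_)) hn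
  rw [hreg.countableProjNorm_eq (hk k ω hω)]

/-- The diameter is almost surely finite, hence at most M with probability close to one for large M,
and visits to that event leave gaps of size at most εn. Only ε = 1 / (j + 1) is treated, so that one
null set serves all ε. -/
theorem IsRegularSet.ae_exists_visit [IsProbabilityMeasure P] (hreg : IsRegularSet ϑ φ β Ω₀)
    (hP : ∀ᵐ ω ∂P, ω ∈ Ω₀) (hφ : IsContinuousRDS ϑ φ) {T : Ω → Ω} (hT : Ergodic T P) :
    ∀ᵐ ω ∂P, ∀ ε : ℝ, 0 < ε → ∃ M : ℕ, ∀ᶠ n : ℕ in atTop, ∃ k < n,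
      countableDiam φ (T^[k] ω) ≤ M ∧ (n : ℝ) - k ≤ ε * n := by
  have hm := measurable_countableDiam hφ
  have hlim : Tendsto (fun M : ℕ => P {ω | (M : ℝ≥0∞) < countableDiam φ ω}) atTop (𝓝 0) := by
    have h1 : P (⋂ M : ℕ, {ω | (M : ℝ≥0∞) < countableDiam φ ω}) = 0 := by
      refine measure_eq_zero_iff_ae_notMem.2 ?_
      filter_upwards [hP] with ω hω hmem
      obtain ⟨M, hM⟩ := ENNReal.exists_nat_gt (hreg.countableDiam_lt_top hω).ne
      exact absurd (mem_iInter.1 hmem M) (not_lt.2 hM.le)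
    rw [← h1]
    refine tendsto_measure_iInter_atTop (fun M => (measurableSet_lt measurable_const
      hm).nullMeasurableSet) (fun a b hab ω hω => ?_) ⟨0, measure_ne_top _ _⟩
    exact lt_of_le_of_lt (Nat.cast_le.2 hab) (show (b : ℝ≥0∞) < countableDiam φ ω from hω)
  have hj : ∀ j : ℕ, ∀ᵐ ω ∂P, ∃ M : ℕ, ∀ᶠ n : ℕ in atTop, ∃ k < n,
      countableDiam φ (T^[k] ω) ≤ M ∧ (n : ℝ) - k ≤ 1 / ((j : ℝ) + 1) * n := by
    intro j
    have hε : (0 : ℝ) < 1 / ((j : ℝ) + 1) := by positivity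
    have hε1 : 1 / ((j : ℝ) + 1) ≤ 1 := by
      rw [div_le_one (by positivity)]
      linarith [Nat.cast_nonneg (α := ℝ) j]
    obtain ⟨M, hM⟩ := (hlim.eventually_lt_const
      (show (0 : ℝ≥0∞) < ENNReal.ofReal (1 / ((j : ℝ) + 1) / 2) by
        rw [ENNReal.ofReal_pos]; positivity)).exists
    have := ae_eventually_exists_visit hT (G := {ω | countableDiam φ ω ≤ M})
      (measurableSet_le hm measurable_const) hε hε1 (by
        have : {ω | countableDiam φ ω ≤ M}ᶜ = {ω | (M : ℝ≥0∞) < countableDiam φ ω} := by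
          ext ω
          simp
        rw [this, Measure.real]
        exact (ENNReal.lt_ofReal_iff_toReal_lt (measure_ne_top _ _)).1 hM)
    filter_upwards [this] with ω hω
    exact ⟨M, hω⟩
  filter_upwards [ae_all_iff.2 hj] with ω hω ε hε
  obtain ⟨j, hj⟩ := exists_nat_one_div_lt hε
  obtain ⟨M, hM⟩ := hω j
  refine ⟨M, hM.mono fun n ⟨k, hk, hk1, hk2⟩ => ⟨k, hk, hk1, hk2.trans ?_⟩⟩
  gcongr

theorem ae_forall_eventually_iterate_le [IsProbabilityMeasure P] {T : Ω → Ω} (hT : Ergodic T P)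
    {Y : Ω → ℝ} (hY : Integrable Y P) :
    ∀ᵐ ω ∂P, ∀ ε : ℝ, 0 < ε → ∀ᶠ n : ℕ in atTop, Y (T^[n] ω) ≤ ε * n := by
  have hj : ∀ j : ℕ, ∀ᵐ ω ∂P, ∀ᶠ n : ℕ in atTop, Y (T^[n] ω) ≤ 1 / ((j : ℝ) + 1) * n :=
    fun j => ae_eventually_iterate_le hT hY (by positivity)
  filter_upwards [ae_all_iff.2 hj] with ω hω ε hε
  obtain ⟨j, hj⟩ := exists_nat_one_div_lt hε
  filter_upwards [hω j] with n hn
  exact hn.trans (by gcongr)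

/-- Both sums are linear up to small multiples of n, so the last ε'n terms contribute at most E ε' n
plus an error of that kind. -/
theorem ae_forall_eventually_birkhoffSum_sub_le [IsProbabilityMeasure P] {T : Ω → Ω}
    (hT : Ergodic T P) {Y : Ω → ℝ} (hY : Integrable Y P) (hY0 : 0 ≤ᵐ[P] Y) :
    ∀ᵐ ω ∂P, ∀ ε : ℝ, 0 < ε → ∃ ε' > 0, ∀ᶠ n : ℕ in atTop, ∀ k < n, (n : ℝ) - k ≤ ε' * n →
      birkhoffSum T Y n ω - birkhoffSum T Y k ω ≤ ε * n := by
  set E := ∫ ω, Y ω ∂P with hE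
  have hE0 : 0 ≤ E := integral_nonneg_of_ae hY0
  have hj : ∀ j : ℕ, ∀ᵐ ω ∂P, (∀ᶠ n : ℕ in atTop, birkhoffSum T Y n ω ≤
      (E + 1 / ((j : ℝ) + 1)) * n) ∧ ∀ᶠ n : ℕ in atTop,
      (E - 1 / ((j : ℝ) + 1)) * n ≤ birkhoffSum T Y n ω := by
    intro j
    have hε : (0 : ℝ) < 1 / ((j : ℝ) + 1) := by positivity
    exact (ae_eventually_birkhoffSum_le hT hY (by linarith)).and
      (ae_eventually_birkhoffSum_ge hT hY (by linarith))
  filter_upwards [ae_all_iff.2 hj] with ω hω ε hε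
  obtain ⟨j, hj⟩ := exists_nat_one_div_lt (show 0 < ε / 4 by positivity)
  obtain ⟨h1, h2⟩ := hω j
  set κ : ℝ := 1 / ((j : ℝ) + 1) with hκ
  have hκ0 : 0 < κ := by positivity
  have hε'0 : 0 < min (1 / 2) (ε / (2 * (E + 1))) := by positivity
  -- The entry 1 / 2 keeps k ≥ n / 2, so that the asymptotics also hold at k. The other makes E (n -
  -- k) at most εn / 2, leaving εn / 4 for each of the two errors.
  refine ⟨min (1 / 2) (ε / (2 * (E + 1))), hε'0, ?_⟩
  obtain ⟨k₀, hk₀⟩ := eventually_atTop.1 h2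
  filter_upwards [h1, eventually_ge_atTop (2 * k₀)] with n hn hnk k hkn hk
  have hn0 : (0 : ℝ) ≤ n := Nat.cast_nonneg n
  have hkhalf : (n : ℝ) - k ≤ 1 / 2 * n := hk.trans (by gcongr; exact min_le_left _ _)
  have hkE : (n : ℝ) - k ≤ ε / (2 * (E + 1)) * n := hk.trans (by gcongr; exact min_le_right _ _)
  have hkk : k₀ ≤ k := by
    have h3 : (2 * k₀ : ℝ) ≤ n := by exact_mod_cast hnk
    have : (k₀ : ℝ) ≤ k := by linarith
    exact_mod_cast this
  have h4 := hk₀ k hkk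
  have hkn' : (k : ℝ) ≤ n := by exact_mod_cast hkn.le
  have h5 : E * ((n : ℝ) - k) ≤ ε / 2 * n := by
    calc E * ((n : ℝ) - k) ≤ E * (ε / (2 * (E + 1)) * n) := by gcongr
      _ = (E / (E + 1)) * (ε / 2 * n) := by field_simp
      _ ≤ 1 * (ε / 2 * n) := by
          gcongr
          rw [div_le_one (by linarith)]
          linarith
      _ = _ := one_mul _
  have h6 : κ * k ≤ ε / 4 * n := mul_le_mul hj.le hkn' (Nat.cast_nonneg k) (by positivity)
  have h7 : κ * n ≤ ε / 4 * n := by gcongr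
  linarith

/-- Solutions started in different functions in the past approach each other at the rate
`E log τ(φ_1)`, uniformly in the initial data. -/
theorem IsRegularSet.eventually_pullback_logDist_le (hreg : IsRegularSet ϑ φ β Ω₀)
    (hϑ : IsErgodicIDS P ϑ) (hφ : IsContinuousRDS ϑ φ) {ω : Ω} (hω : ω ∈ Ω₀) {ρ : EReal}
    (hρ : ρ < 0)
    (hprod : ∀ c : ℝ, ρ < c → ∀ᶠ n : ℕ in atTop,
      ∏ k ∈ Finset.range n, projNorm (φ 1 ((ϑ (-1))^[k] (ϑ (-1) ω))) ≤
        ENNReal.ofReal (Real.exp (c * n)))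
    (hvisit : ∀ ε : ℝ, 0 < ε → ∃ M : ℕ, ∀ᶠ n : ℕ in atTop, ∃ k < n,
      countableDiam φ ((ϑ (-1))^[k] (ϑ (-1) ω)) ≤ M ∧ (n : ℝ) - k ≤ ε * n)
    {c : ℝ} (hc : ρ < c) : ∀ᶠ n : ℕ in atTop, ∀ f g : TorusFn d, (∀ x, 0 < f x) →
      (∀ x, 0 < g x) → logDist (φ n (ϑ (-(n : ℤ)) ω) f) (φ n (ϑ (-(n : ℤ)) ω) g) ≤
        ENNReal.ofReal (Real.exp (c * n)) := by
  obtain ⟨c', hρc', hc'⟩ := EReal.exists_rat_btwn_of_lt (lt_min hc hρ)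
  have hc'c : (c' : ℝ) < c := by exact_mod_cast hc'.trans_le (min_le_left _ _)
  have hc'0 : (c' : ℝ) < 0 := by exact_mod_cast hc'.trans_le (min_le_right _ _)
  -- The lost factors cost exp(-c' ε n) ≤ exp((c - c') n / 2), and the diameter M is absorbed by
  -- another factor of this size.
  set ε : ℝ := min (1 / 2) ((c - c') / (2 * -c')) with hε
  have hε0 : 0 < ε := lt_min (by norm_num) (div_pos (by linarith) (by linarith))
  have hεc : ε * -c' ≤ (c - c') / 2 := by
    have : ε ≤ (c - c') / (2 * -c') := min_le_right _ _
    rw [le_div_iff₀ (by linarith)] at this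
    linarith
  obtain ⟨M, hM⟩ := hvisit ε hε0
  obtain ⟨k₀, hk₀⟩ := eventually_atTop.1 (hprod c' hρc')
  have hlim : Tendsto (fun n : ℕ => (c - c') / 2 * n) atTop atTop :=
    tendsto_natCast_atTop_atTop.const_mul_atTop (by linarith)
  filter_upwards [hM, eventually_ge_atTop (2 * k₀),
    (Real.tendsto_exp_atTop.comp hlim).eventually_ge_atTop M] with n ⟨k, hkn, hkM, hkε⟩ hn hMn f g
    hf hg
  have hshift : ∀ j : ℕ, (ϑ (-1))^[j] (ϑ (-1) ω) = ϑ (-((j : ℤ) + 1)) ω := fun j => by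
    rw [hϑ.iterate_neg_one, ← hϑ.add]
    congr 1
    ring
  simp only [hshift] at hkM hk₀
  -- Starting at time -n there are l arbitrary steps, one step whose image has diameter at most M,
  -- and k contracting steps.
  obtain ⟨l, rfl⟩ : ∃ l, n = k + (1 + l) := ⟨n - k - 1, by omega⟩
  have hdec : ∀ u, φ (k + (1 + l) : ℕ) (ϑ (-((k + (1 + l) : ℕ) : ℤ)) ω) u =
      φ k (ϑ (-(k : ℤ)) ω) (φ 1 (ϑ (-((k : ℤ) + 1)) ω)
        (φ l (ϑ (-((k + (1 + l) : ℕ) : ℤ)) ω) u)) := fun u => by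
    have h1 := hφ.cocycle k (1 + l) (ϑ (-((k + (1 + l) : ℕ) : ℤ)) ω) u
    have h2 := hφ.cocycle 1 l (ϑ (-((k + (1 + l) : ℕ) : ℤ)) ω) u
    rw [← hϑ.add] at h1 h2
    have e1 : ((1 + l : ℕ) : ℤ) + -((k + (1 + l) : ℕ) : ℤ) = -(k : ℤ) := by push_cast; ring
    have e2 : (l : ℤ) + -((k + (1 + l) : ℕ) : ℤ) = -((k : ℤ) + 1) := by push_cast; ring
    rw [e1] at h1
    rw [e2] at h2
    push_cast at h1 h2 ⊢
    rw [h1, h2]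
  have hΩ : ∀ z, ϑ z ω ∈ Ω₀ := fun z => hreg.invariant z ω hω
  have hpl := hreg.pos_of_nat hφ.zero (hΩ (-((k + (1 + l) : ℕ) : ℤ))) l
  have hp1 := hreg.pos _ (hΩ (-((k : ℤ) + 1))) 1 one_pos
  rw [hdec, hdec]
  have h3 := hreg.logDist_le_prod hφ.zero hφ.cocycle (hΩ (-(k : ℤ))) k
    (hp1 _ (hpl f hf)) (hp1 _ (hpl g hg))
  have h4 := (hreg.logDist_le_countableDiam (hΩ (-((k : ℤ) + 1))) (hpl f hf) (hpl g hg)).trans hkM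
  -- The cocycle multiplies forward from -k to 0; reversing the order gives the orbit of ϑ⁻¹ω under
  -- ϑ⁻¹.
  have h5 : ∏ j ∈ Finset.range k, projNorm (φ 1 (ϑ j (ϑ (-(k : ℤ)) ω))) =
      ∏ j ∈ Finset.range k, projNorm (φ 1 (ϑ (-((j : ℤ) + 1)) ω)) := by
    rw [← Finset.prod_range_reflect]
    refine Finset.prod_congr rfl fun j hj => ?_
    rw [Finset.mem_range] at hj
    rw [← hϑ.add]
    congr 3
    omega
  have hnR : (0 : ℝ) ≤ (k + (1 + l) : ℕ) := Nat.cast_nonneg _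
  have hkhalf : (((k + (1 + l) : ℕ) : ℝ)) - k ≤ 1 / 2 * (k + (1 + l) : ℕ) :=
    hkε.trans (by gcongr; exact min_le_left _ _)
  have hkk : k₀ ≤ k := by
    have h3 : (2 * k₀ : ℝ) ≤ (k + (1 + l) : ℕ) := by exact_mod_cast hn
    have : (k₀ : ℝ) ≤ k := by linarith
    exact_mod_cast this
  have h6 := hk₀ k hkk
  rw [h5] at h3
  refine (h3.trans (mul_le_mul' h6 h4)).trans ?_
  have hM' : (M : ℝ≥0∞) = ENNReal.ofReal (M : ℝ) := by simp
  rw [hM', ← ENNReal.ofReal_mul (Real.exp_pos _).le]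
  refine ENNReal.ofReal_le_ofReal ?_
  refine (mul_le_mul_of_nonneg_left hMn (Real.exp_pos _).le).trans ?_
  rw [Function.comp_apply, ← Real.exp_add, Real.exp_le_exp]
  set n := k + (1 + l)
  have h7 : ε * -c' * n ≤ (c - c') / 2 * n := by gcongr
  have h8 : -c' * ((n : ℝ) - k) ≤ -c' * (ε * n) :=
    mul_le_mul_of_nonneg_left hkε (by linarith)
  linarith

/-- Under a moment assumption the projective distance of a solution from the constants grows
sublinearly. -/
theorem IsRegularSet.eventually_logDist_one_le (hreg : IsRegularSet ϑ φ β Ω₀)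
    (hϑ : IsErgodicIDS P ϑ) (hφ : IsContinuousRDS ϑ φ) {ω : Ω} (hω : ω ∈ Ω₀) {Y : Ω → ℝ}
    (hY : ∀ (n : ℕ) (x : Torus d), |Real.log (φ 1 (ϑ n ω) (expFn 0) x)| ≤ Y (ϑ n ω))
    (hsum : ∀ ε : ℝ, 0 < ε → ∃ ε' > 0, ∀ᶠ n : ℕ in atTop, ∀ k < n, (n : ℝ) - k ≤ ε' * n →
      birkhoffSum (ϑ 1) Y n ω - birkhoffSum (ϑ 1) Y k ω ≤ ε * n)
    (hvisit : ∀ ε : ℝ, 0 < ε → ∃ M : ℕ, ∀ᶠ n : ℕ in atTop, ∃ k < n,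
      countableDiam φ ((ϑ 1)^[k] ω) ≤ M ∧ (n : ℝ) - k ≤ ε * n)
    {f : TorusFn d} (hf : ∀ x, 0 < f x) {ε : ℝ} (hε : 0 < ε) :
    ∀ᶠ n : ℕ in atTop, logDist (φ n ω f) (expFn 0) ≤ ENNReal.ofReal (ε * n) := by
  have hΩ : ∀ z, ϑ z ω ∈ Ω₀ := fun z => hreg.invariant z ω hω
  have hY0 : ∀ n : ℕ, 0 ≤ Y (ϑ n ω) := fun n => (abs_nonneg _).trans (hY n 0)
  have hone : ∀ n : ℕ, logDist (φ 1 (ϑ n ω) (expFn 0)) (expFn 0) ≤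
      ENNReal.ofReal (2 * Y (ϑ n ω)) := fun n => by
    refine logDist_le_ofReal fun x y => ?_
    have hx := abs_le.1 (hY n x)
    have hy := abs_le.1 (hY n y)
    simp only [logCross, log_expFn, ContinuousMap.zero_apply]
    linarith [hx.2, hy.1]
  have hstep : ∀ (n : ℕ) u, φ (n + 1 : ℕ) ω u = φ 1 (ϑ n ω) (φ n ω u) := fun n u => by
    rw [← hφ.cocycle, Nat.cast_add, Nat.cast_one, add_comm]
  have hposn : ∀ n : ℕ, ∀ x, 0 < φ n ω f x := fun n => hreg.pos_of_nat hφ.zero hω n f hf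
  -- The sum of Y enters with factor 2, so ε / 4 leaves εn / 2 for the constant M.
  obtain ⟨ε', hε', hev⟩ := hsum (ε / 4) (by positivity)
  obtain ⟨M, hM⟩ := hvisit ε' hε'
  have hlim : Tendsto (fun n : ℕ => ε / 2 * n) atTop atTop :=
    tendsto_natCast_atTop_atTop.const_mul_atTop (by linarith)
  filter_upwards [hev, hM, hlim.eventually_ge_atTop M] with n hn ⟨k, hkn, hkM, hkε⟩ hMn
  -- The step at the visit k forgets the past: its image is within M of the image of 1. Each step is
  -- nonexpansive, and replacing φ_1 1 by 1 costs 2Y.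
  have hchain : ∀ j : ℕ, logDist (φ (k + 1 + j : ℕ) ω f) (expFn 0) ≤
      ENNReal.ofReal (M + 2 * (birkhoffSum (ϑ 1) Y (k + 1 + j) ω - birkhoffSum (ϑ 1) Y k ω)) := by
    intro j
    induction j with
    | zero =>
      rw [add_zero, hstep, birkhoffSum_succ, hϑ.iterate_one, add_sub_cancel_left]
      refine (logDist_triangle _ (φ 1 (ϑ k ω) (expFn 0)) _).trans ?_
      rw [ENNReal.ofReal_add (Nat.cast_nonneg M) (by linarith [hY0 k])]
      refine add_le_add ?_ (hone k)
      rw [hϑ.iterate_one] at hkM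
      refine (hreg.logDist_le_countableDiam (hΩ k) (hposn k) (expFn_pos 0)).trans ?_
      simpa using hkM
    | succ j ih =>
      rw [← add_assoc, hstep, birkhoffSum_succ, hϑ.iterate_one]
      refine (logDist_triangle _ (φ 1 (ϑ ((k + 1 + j : ℕ) : ℤ) ω) (expFn 0)) _).trans ?_
      have h1 := logDist_le_projNorm_mul (hreg.pos _ (hΩ (k + 1 + j : ℕ)) 1 one_pos)
        (hposn (k + 1 + j)) (expFn_pos (0 : TorusFn d))
      have h2 : projNorm (φ 1 (ϑ ((k + 1 + j : ℕ) : ℤ) ω)) ≤ 1 :=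
        (hreg.contracting _ (hΩ _) 1 one_pos).le
      have h3 := (h1.trans (mul_le_of_le_one_left' h2)).trans ih
      refine (add_le_add h3 (hone (k + 1 + j))).trans ?_
      have hmono : birkhoffSum (ϑ 1) Y k ω ≤ birkhoffSum (ϑ 1) Y (k + 1 + j) ω := by
        refine Finset.sum_le_sum_of_subset_of_nonneg ?_ fun i _ _ => ?_
        · exact Finset.range_mono (by omega)
        · rw [hϑ.iterate_one]
          exact hY0 i
      rw [← ENNReal.ofReal_add (by linarith [Nat.cast_nonneg (α := ℝ) M])
        (by linarith [hY0 (k + 1 + j)])]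
      refine ENNReal.ofReal_le_ofReal (le_of_eq ?_)
      ring
  obtain ⟨j, rfl⟩ : ∃ j, n = k + 1 + j := ⟨n - k - 1, by omega⟩
  refine (hchain j).trans (ENNReal.ofReal_le_ofReal ?_)
  have := hn k hkn hkε
  linarith

end Asymptotics

/-! ### Logarithms of smoothed functions -/

section LogImage

variable {d : ℕ} {α β : ℝ}

/-- The logarithm of a strictly positive function, normalized to vanish at the origin. -/
noncomputable def normLog (u : TorusFn d) : TorusFn d :=
  open Classical in
  if h : ∀ x, 0 < u x then
    ⟨fun x => Real.log (u x) - Real.log (u 0),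
      (u.continuous.log fun x => (h x).ne').sub continuous_const⟩
  else 0

theorem normLog_apply {u : TorusFn d} (hu : ∀ x, 0 < u x) (x : Torus d) :
    normLog u x = Real.log (u x) - Real.log (u 0) := by
  rw [normLog, dif_pos hu]
  rfl

theorem norm_normLog_sub_le {u v : TorusFn d} (hu : ∀ x, 0 < u x) (hv : ∀ x, 0 < v x) {r : ℝ}
    (hr : 0 ≤ r) (h : logDist u v ≤ ENNReal.ofReal r) : ‖normLog u - normLog v‖ ≤ r := by
  have hc : ∀ x y, logCross u v x y ≤ r := fun x y =>
    (ENNReal.ofReal_le_ofReal_iff hr).1 ((ofReal_logCross_le u v x y).trans h)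
  refine (ContinuousMap.norm_le _ hr).2 fun x => ?_
  rw [ContinuousMap.sub_apply, normLog_apply hu, normLog_apply hv, Real.norm_eq_abs, abs_le]
  have h1 := hc x 0
  have h2 := hc 0 x
  simp only [logCross] at h1 h2
  constructor <;> linarith

theorem normLog_eq_of_logDist_eq_zero {u v : TorusFn d} (hu : ∀ x, 0 < u x) (hv : ∀ x, 0 < v x)
    (h : logDist u v = 0) : normLog u = normLog v := by
  have := norm_normLog_sub_le hu hv le_rfl (by rw [h]; exact zero_le)
  exact sub_eq_zero.1 (norm_le_zero_iff.1 this)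

theorem logDist_expFn_normLog {u : TorusFn d} (hu : ∀ x, 0 < u x) (v : Torus d → ℝ) :
    logDist v (expFn (normLog u)) = logDist v u := by
  simp only [logDist, logCross, log_expFn, normLog_apply hu]
  ring_nf

theorem floor_frac_pos (hα : 0 < α) (hαm : ∀ m : ℕ, α ≠ m) : 0 < α - ⌊α⌋₊ :=
  sub_pos.2 (lt_of_le_of_ne (Nat.floor_le hα.le) (hαm _).symm)

theorem floor_frac_lt_one (α : ℝ) : α - ⌊α⌋₊ < 1 := by
  linarith [Nat.lt_floor_add_one α]

/-- Logarithms of functions that are bounded in `C^β` and bounded away from zero. -/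
theorem exists_log_estimate (d : ℕ) (hα : 0 < α) (hαβ : α < β) (hαm : ∀ m : ℕ, α ≠ m) :
    ∃ (K : ℝ) (N : ℕ), 1 ≤ K ∧ ∀ (u₁ u₂ : TorusFn d) (R δ : ℝ), 1 ≤ R → 0 ≤ δ →
      holderNorm β (periodicLift u₁) ≤ ENNReal.ofReal R →
      holderNorm β (periodicLift u₂) ≤ ENNReal.ofReal R →
      (∀ x, R⁻¹ ≤ u₁ x) → (∀ x, R⁻¹ ≤ u₂ x) →
      HolderBound (α - ⌊α⌋₊) ⌊α⌋₊ (periodicLift u₁ - periodicLift u₂) δ →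
      HolderBound (α - ⌊α⌋₊) ⌊α⌋₊ (fun y => Real.log (periodicLift u₁ y)) (K * R ^ N) ∧
      HolderBound (α - ⌊α⌋₊) ⌊α⌋₊
        (fun y => Real.log (periodicLift u₁ y) - Real.log (periodicLift u₂ y)) (K * R ^ N * δ) := by
  have hθ := floor_frac_pos hα hαm
  have hθ1 := (floor_frac_lt_one α).le
  obtain ⟨K, N, hK, hlog⟩ := HolderBound.exists_log_sub_log d hθ.le hθ1 ⌊α⌋₊
  set c₀ : ℝ := 3 * (d + 2) ^ (⌊β⌋₊ + 1) with hc₀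
  have hc₀1 : 1 ≤ c₀ := by
    have : (1 : ℝ) ≤ (d + 2) ^ (⌊β⌋₊ + 1) :=
      one_le_pow₀ (by linarith [Nat.cast_nonneg (α := ℝ) d])
    rw [hc₀]
    linarith
  clear_value c₀
  have hc₀N : 1 ≤ c₀ ^ (N + 1) := one_le_pow₀ hc₀1
  refine ⟨2 * K * c₀ ^ (N + 1), N + 1, by nlinarith, fun u₁ u₂ R δ hR hδ h₁ h₂ hl₁ hl₂ h₁₂ => ?_⟩
  have hcR : 1 ≤ c₀ * R := one_le_mul_of_one_le_of_one_le hc₀1 hR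
  have hlow : (c₀ * R)⁻¹ ≤ R⁻¹ :=
    inv_anti₀ (by positivity) (le_mul_of_one_le_left (by positivity) hc₀1)
  have hm : (⌊α⌋₊ : ℝ) + (α - ⌊α⌋₊) ≤ β := by linarith
  have hB₁ := (unitPeriodic_periodicLift u₁).holderBound_of_holderNorm_le (by positivity) h₁ hθ
    hθ1 hm
  have hB₂ := (unitPeriodic_periodicLift u₂).holderBound_of_holderNorm_le (by positivity) h₂ hθ
    hθ1 hm
  rw [← hc₀] at hB₁ hB₂
  -- The logarithm itself is estimated as log u₁ - log 1.
  have hone : HolderBound (d := d) (α - ⌊α⌋₊) ⌊α⌋₊ (fun _ => (1 : ℝ)) (c₀ * R) :=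
    (HolderBound.const 1).mono (by simpa using hcR)
  constructor
  · have := hlog _ _ (c₀ * R) _ hcR hB₁ hone (fun x => hlow.trans (hl₁ _))
      (fun x => inv_le_one_of_one_le₀ hcR) (hB₁.sub hone)
    simp only [Real.log_one, sub_zero] at this
    refine this.mono (le_of_eq ?_)
    ring
  · refine (hlog _ _ (c₀ * R) _ hcR hB₁ hB₂ (fun x => hlow.trans (hl₁ _))
      (fun x => hlow.trans (hl₂ _)) h₁₂).mono ?_
    refine mul_le_mul_of_nonneg_right ?_ hδ
    have h3 : (c₀ * R) ^ N ≤ (c₀ * R) ^ (N + 1) := pow_le_pow_right₀ hcR (by omega)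
    calc K * (c₀ * R) ^ N ≤ 1 * K * (c₀ * R) ^ (N + 1) := by rw [one_mul]; gcongr
      _ ≤ 2 * K * (c₀ * R) ^ (N + 1) := by gcongr; norm_num
      _ = _ := by ring

/-- The logarithms of the images of two functions under a smoothing positive operator are close
modulo constants when the functions are close in the projective distance. -/
theorem exists_log_image_estimate (d : ℕ) (hα : 0 < α) (hαβ : α < β) (hαm : ∀ m : ℕ, α ≠ m) :
    ∃ (K : ℝ) (N : ℕ), 1 ≤ K ∧ ∀ (A : TorusFn d →L[ℝ] TorusFn d), PreservesPos A →
      ∀ (C : ℝ), 0 ≤ C →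
      (∀ f : TorusFn d, holderNorm β (periodicLift (A f)) ≤ ENNReal.ofReal (C * ‖f‖)) →
      ∀ (w₁ w₂ : TorusFn d), (∀ x, 0 < w₁ x) → (∀ x, 0 < w₂ x) → ∀ (D l R : ℝ), 0 ≤ D → D ≤ 1 →
      0 ≤ l → 1 ≤ R → logDist w₁ w₂ ≤ ENNReal.ofReal D →
      logDist w₂ (expFn 0) ≤ ENNReal.ofReal l → C * Real.exp (l + 1) ≤ R →
      (∀ x, R⁻¹ ≤ Real.exp (-(l + 1)) * A (expFn 0) x) →
      (∃ B, HolderBound (α - ⌊α⌋₊) ⌊α⌋₊ (fun y => Real.log (A w₁ (torusMk y))) B) ∧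
      (∃ B, HolderBound (α - ⌊α⌋₊) ⌊α⌋₊ (fun y => Real.log (A w₂ (torusMk y))) B) ∧
      ∃ c, HolderBound (α - ⌊α⌋₊) ⌊α⌋₊
        (fun y => Real.log (A w₁ (torusMk y)) - Real.log (A w₂ (torusMk y)) - c)
          (K * R ^ N * D) := by
  obtain ⟨K, N, hK, hlog⟩ := exists_log_estimate d hα hαβ hαm
  have hθ := floor_frac_pos hα hαm
  have hθ1 := (floor_frac_lt_one α).le
  set c₀ : ℝ := 3 * (d + 2) ^ (⌊β⌋₊ + 1) with hc₀
  have hc₀1 : 1 ≤ c₀ := by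
    have : (1 : ℝ) ≤ (d + 2) ^ (⌊β⌋₊ + 1) :=
      one_le_pow₀ (by linarith [Nat.cast_nonneg (α := ℝ) d])
    rw [hc₀]
    linarith
  refine ⟨K * (2 * c₀), N + 1, by nlinarith, fun A hA C hC hsm w₁ w₂ hw₁ hw₂ D l R hD hD1 hl hR hDw
    hlw hCR hAR => ?_⟩
  have hcD : ∀ x y, logCross w₁ w₂ x y ≤ D := fun x y =>
    (ENNReal.ofReal_le_ofReal_iff hD).1 ((ofReal_logCross_le _ _ x y).trans hDw)
  have hcl : ∀ x y, logCross w₂ (expFn 0) x y ≤ l := fun x y =>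
    (ENNReal.ofReal_le_ofReal_iff hl).1 ((ofReal_logCross_le _ _ x y).trans hlw)
  -- Dividing w_i by its value at the origin puts it between exp(-(l + 1)) and exp(l + 1); by
  -- linearity this only adds a constant to the logarithm of the image.
  set v₁ : TorusFn d := expFn (normLog w₁) with hv₁
  set v₂ : TorusFn d := expFn (normLog w₂) with hv₂
  have hn₂ : ∀ x, |normLog w₂ x| ≤ l := fun x => by
    rw [normLog_apply hw₂, abs_le]
    have h1 := hcl x 0
    have h2 := hcl 0 x
    simp only [logCross, log_expFn, ContinuousMap.zero_apply] at h1 h2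
    constructor <;> linarith
  have hn₁₂ : ∀ x, |normLog w₁ x - normLog w₂ x| ≤ D := fun x => by
    have := (normLog w₁ - normLog w₂).norm_coe_le_norm x
    exact this.trans (norm_normLog_sub_le hw₁ hw₂ hD hDw)
  have hn₁ : ∀ x, |normLog w₁ x| ≤ l + 1 := fun x => by
    have h1 := abs_le.1 (hn₁₂ x)
    have h2 := abs_le.1 (hn₂ x)
    rw [abs_le]
    constructor <;> linarith [h1.1, h1.2, h2.1, h2.2]
  have hscale : ∀ w : TorusFn d, (∀ x, 0 < w x) → ∀ x, Real.log (A w x) =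
      Real.log (w 0) + Real.log (A (expFn (normLog w)) x) := by
    intro w hw x
    have h1 : w = w 0 • expFn (normLog w) := by
      ext z
      have : expFn (normLog w) z = Real.exp (normLog w z) := rfl
      rw [ContinuousMap.smul_apply, this, normLog_apply hw, Real.exp_sub, Real.exp_log (hw z),
        Real.exp_log (hw 0), smul_eq_mul, mul_div_cancel₀ _ (hw 0).ne']
    conv_lhs => rw [h1, map_smul, ContinuousMap.smul_apply, smul_eq_mul]
    exact Real.log_mul (hw 0).ne' (hA _ (expFn_pos _) x).ne'
  have hmono : ∀ (h : TorusFn d), (∀ x, |h x| ≤ l + 1) → ∀ x, R⁻¹ ≤ A (expFn h) x := by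
    intro h hh x
    refine (hAR x).trans ?_
    -- Since A is only known to preserve strict positivity, exp(-(l + 1)) is lowered by η, with the
    -- resulting error below ε.
    refine le_of_forall_pos_lt_add fun ε hε => ?_
    obtain ⟨M, hM⟩ : ∃ M, ∀ x, A (expFn 0) x ≤ M :=
      ⟨‖A (expFn 0)‖, fun x => (le_abs_self _).trans ((A (expFn 0)).norm_coe_le_norm x)⟩
    have hM0 : 0 < M := (hA _ (expFn_pos 0) 0).trans_le (hM 0)
    obtain ⟨η, hη0, hη⟩ : ∃ η : ℝ, 0 < η ∧ η * M < ε := ⟨ε / (2 * M), by positivity, by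
      rw [div_mul_eq_mul_div, div_lt_iff₀ (by positivity)]
      nlinarith⟩
    have hpos : ∀ z, 0 < (expFn h - (Real.exp (-(l + 1)) - η) • expFn 0 : TorusFn d) z :=
        fun z => by
      have h1 : Real.exp (-(l + 1)) ≤ Real.exp (h z) :=
        Real.exp_le_exp.2 (abs_le.1 (hh z)).1
      have h2 : (expFn h - (Real.exp (-(l + 1)) - η) • expFn 0 : TorusFn d) z =
          Real.exp (h z) - (Real.exp (-(l + 1)) - η) * Real.exp 0 := rfl
      rw [h2, Real.exp_zero]
      linarith
    have h3 := hA _ hpos x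
    rw [map_sub, map_smul, ContinuousMap.sub_apply, ContinuousMap.smul_apply, smul_eq_mul] at h3
    nlinarith [hM x, hA _ (expFn_pos 0) x]
  have hvn : ∀ (h : TorusFn d), (∀ x, |h x| ≤ l + 1) → ‖expFn h‖ ≤ Real.exp (l + 1) := by
    intro h hh
    refine (ContinuousMap.norm_le _ (Real.exp_pos _).le).2 fun x => ?_
    have : expFn h x = Real.exp (h x) := rfl
    rw [this, Real.norm_of_nonneg (Real.exp_pos _).le, Real.exp_le_exp]
    exact (abs_le.1 (hh x)).2
  have hn₂' : ∀ x, |normLog w₂ x| ≤ l + 1 := fun x => (hn₂ x).trans (by linarith)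
  have hH : ∀ (h : TorusFn d), (∀ x, |h x| ≤ l + 1) →
      holderNorm β (periodicLift (A (expFn h))) ≤ ENNReal.ofReal R := fun h hh =>
    (hsm _).trans (ENNReal.ofReal_le_ofReal
      ((mul_le_mul_of_nonneg_left (hvn h hh) hC).trans hCR))
  -- Here D ≤ 1 is used, through |exp s - 1| ≤ 2|s| for |s| ≤ 1.
  have hdiff : ‖v₁ - v₂‖ ≤ Real.exp (l + 1) * (2 * D) := by
    refine (ContinuousMap.norm_le _ (by positivity)).2 fun x => ?_
    have h1 : (v₁ - v₂) x = Real.exp (normLog w₂ x) *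
        (Real.exp (normLog w₁ x - normLog w₂ x) - 1) := by
      rw [mul_sub, ← Real.exp_add, mul_one, add_sub_cancel]
      rfl
    rw [h1, norm_mul, Real.norm_of_nonneg (Real.exp_pos _).le, Real.norm_eq_abs]
    refine mul_le_mul (Real.exp_le_exp.2 ((abs_le.1 (hn₂' x)).2)) ?_ (abs_nonneg _)
      (Real.exp_pos _).le
    exact (Real.abs_exp_sub_one_le ((hn₁₂ x).trans hD1)).trans (by linarith [hn₁₂ x])
  have hHd : HolderBound (α - ⌊α⌋₊) ⌊α⌋₊ (periodicLift (A v₁) - periodicLift (A v₂))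
      (c₀ * (R * (2 * D))) := by
    have h1 : periodicLift (A v₁) - periodicLift (A v₂) = periodicLift (A (v₁ - v₂)) := by
      rw [map_sub]
      rfl
    rw [h1]
    have h2 : holderNorm β (periodicLift (A (v₁ - v₂))) ≤ ENNReal.ofReal (R * (2 * D)) := by
      refine (hsm _).trans (ENNReal.ofReal_le_ofReal ?_)
      calc C * ‖v₁ - v₂‖ ≤ C * (Real.exp (l + 1) * (2 * D)) := by gcongr
        _ = C * Real.exp (l + 1) * (2 * D) := by ring
        _ ≤ _ := by gcongr
    exact (unitPeriodic_periodicLift _).holderBound_of_holderNorm_le (by positivity) h2 hθ hθ1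
      (by linarith)
  have hδ : 0 ≤ c₀ * (R * (2 * D)) := hHd.nonneg
  have hself : HolderBound (α - ⌊α⌋₊) ⌊α⌋₊ (periodicLift (A v₂) - periodicLift (A v₂)) 0 := by
    rw [sub_self]
    simpa using! HolderBound.const (d := d) (θ := α - ⌊α⌋₊) (m := ⌊α⌋₊) 0
  have h₁ := hlog (A v₁) (A v₂) R _ hR hδ (hH _ hn₁) (hH _ hn₂') (hmono _ hn₁) (hmono _ hn₂') hHd
  -- Comparing v₂ with itself serves only to bound the logarithm of A v₂.
  have h₂ := hlog (A v₂) (A v₂) R 0 hR le_rfl (hH _ hn₂') (hH _ hn₂') (hmono _ hn₂')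
    (hmono _ hn₂') hself
  refine ⟨⟨|Real.log (w₁ 0)| + K * R ^ N, ?_⟩, ⟨|Real.log (w₂ 0)| + K * R ^ N, ?_⟩,
    Real.log (w₁ 0) - Real.log (w₂ 0), ?_⟩
  · simp only [hscale w₁ hw₁]
    exact (HolderBound.const _).add h₁.1
  · simp only [hscale w₂ hw₂]
    exact (HolderBound.const _).add h₂.1
  · have he : (fun y => Real.log (A w₁ (torusMk y)) - Real.log (A w₂ (torusMk y)) -
        (Real.log (w₁ 0) - Real.log (w₂ 0))) = fun y : EuclideanSpace ℝ (Fin d) =>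
        Real.log (periodicLift (A v₁) y) - Real.log (periodicLift (A v₂) y) := by
      ext y
      rw [hscale w₁ hw₁, hscale w₂ hw₂, ← hv₁, ← hv₂]
      change _ = Real.log (A v₁ (torusMk y)) - Real.log (A v₂ (torusMk y))
      ring
    rw [he]
    refine h₁.2.mono (le_of_eq ?_)
    ring

/-- Subtracting the value at the origin at most doubles a Hölder bound. -/
theorem HolderBound.sub_apply_zero {θ M : ℝ} {m : ℕ} {F : EuclideanSpace ℝ (Fin d) → ℝ}
    (h : HolderBound θ m F M) : HolderBound θ m (fun y => F y - F 0) (2 * M) := by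
  refine (h.sub (HolderBound.const (F 0))).mono ?_
  linarith [h.abs_le 0]

/-- A bounded family in `C^β` that converges uniformly and stays away from zero has logarithms
that converge in `C^α`. -/
theorem exists_log_continuity (d : ℕ) (hα : 0 < α) (hαβ : α < β) (hαm : ∀ m : ℕ, α ≠ m) {R : ℝ}
    (hR : 1 ≤ R) {δ : ℝ} (hδ : 0 < δ) :
    ∃ ε > 0, ∀ u₁ u₂ : TorusFn d, holderNorm β (periodicLift u₁) ≤ ENNReal.ofReal R →
      holderNorm β (periodicLift u₂) ≤ ENNReal.ofReal R → (∀ x, R⁻¹ ≤ u₁ x) → (∀ x, R⁻¹ ≤ u₂ x) →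
      ‖u₁ - u₂‖ ≤ ε → HolderBound (α - ⌊α⌋₊) ⌊α⌋₊
        (fun y => Real.log (periodicLift u₁ y) - Real.log (periodicLift u₂ y)) δ := by
  obtain ⟨K, N, hK, hlog⟩ := exists_log_estimate d hα hαβ hαm
  have hθ := floor_frac_pos hα hαm
  have hθ1 := floor_frac_lt_one α
  -- An exponent strictly above the fractional part of α that the C^β bound still controls; the gap
  -- is what interpolation needs.
  set s : ℝ := min 1 (β - ⌊α⌋₊) with hs
  have hs1 : s ≤ 1 := min_le_left _ _
  have hsβ : (⌊α⌋₊ : ℝ) + s ≤ β := by linarith [min_le_right 1 (β - (⌊α⌋₊ : ℝ))]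
  have hθs : α - ⌊α⌋₊ < s := lt_min hθ1 (by linarith)
  set c₀ : ℝ := 3 * (d + 2) ^ (⌊β⌋₊ + 1) with hc₀
  have hKR : 0 < K * R ^ N := by positivity
  obtain ⟨ε, hε, hInt⟩ := HolderBound.exists_interpolation (d := d) hθ.le hθs hs1 ⌊α⌋₊
    (c₀ * R + c₀ * R) (div_pos hδ hKR)
  refine ⟨ε, hε, fun u₁ u₂ h₁ h₂ hl₁ hl₂ h₁₂ => ?_⟩
  have hR0 : 0 ≤ R := by linarith
  have hB₁ := (unitPeriodic_periodicLift u₁).holderBound_of_holderNorm_le hR0 h₁ (hθ.trans hθs)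
    hs1 hsβ
  have hB₂ := (unitPeriodic_periodicLift u₂).holderBound_of_holderNorm_le hR0 h₂ (hθ.trans hθs)
    hs1 hsβ
  have hd := hInt _ (hB₁.sub hB₂) fun y =>
    ((u₁ - u₂).norm_coe_le_norm (torusMk y)).trans h₁₂
  refine (hlog u₁ u₂ R _ hR (div_pos hδ hKR).le h₁ h₂ hl₁ hl₂ hd).2.mono (le_of_eq ?_)
  exact mul_div_cancel₀ δ hKR.ne'

end LogImage

/-! ### Exponential rates -/

/-- Any constant K is absorbed by a slightly larger exponent. Since ρ < 0, negative c suffice, as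
there is always one between ρ and the target. -/
theorem exponentialRate_le {a : ℕ → ℝ≥0∞} {ρ : EReal} (hρ : ρ < 0)
    (h : ∀ c : ℝ, ρ < c → c < 0 → ∃ K : ℝ, ∀ᶠ n : ℕ in atTop,
      a n ≤ ENNReal.ofReal (K * Real.exp (c * n))) : exponentialRate a ≤ ρ := by
  refine EReal.le_of_forall_lt_iff_le.1 fun c hc => ?_
  obtain ⟨c', hρc', hc'⟩ := EReal.exists_rat_btwn_of_lt (lt_min hc hρ)
  have hc'c : (c' : ℝ) < c := by exact_mod_cast hc'.trans_le (min_le_left _ _)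
  have hc'0 : (c' : ℝ) < 0 := by exact_mod_cast hc'.trans_le (min_le_right _ _)
  obtain ⟨K, hK⟩ := h c' hρc' hc'0
  have hlim : Tendsto (fun n : ℕ => (c - c') * n) atTop atTop :=
    tendsto_natCast_atTop_atTop.const_mul_atTop (by linarith)
  refine limsup_le_of_le (by isBoundedDefault) ?_
  filter_upwards [hK, (Real.tendsto_exp_atTop.comp hlim).eventually_ge_atTop K,
    eventually_gt_atTop 0] with n hn hKn hn0
  have hn0' : (0 : ℝ) < n := by exact_mod_cast hn0
  have h1 : a n ≤ ENNReal.ofReal (Real.exp (c * n)) := by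
    refine hn.trans (ENNReal.ofReal_le_ofReal ?_)
    refine (mul_le_mul_of_nonneg_right hKn (Real.exp_pos _).le).trans (le_of_eq ?_)
    rw [Function.comp_apply, ← Real.exp_add]
    ring_nf
  have h2 : ENNReal.log (a n) ≤ ((c * n : ℝ) : EReal) := by
    refine (ENNReal.log_monotone h1).trans (le_of_eq ?_)
    rw [ENNReal.log_ofReal_of_pos (Real.exp_pos _), Real.log_exp]
  calc (((n : ℝ)⁻¹ : ℝ) : EReal) * ENNReal.log (a n)
      ≤ (((n : ℝ)⁻¹ : ℝ) : EReal) * ((c * n : ℝ) : EReal) :=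
        mul_le_mul_of_nonneg_left h2 (by exact_mod_cast (inv_pos.2 hn0').le)
    _ = c := by
        rw [← EReal.coe_mul]
        congr 1
        field_simp

theorem tendsto_exp_mul_atTop_zero {c : ℝ} (hc : c < 0) :
    Tendsto (fun n : ℕ => Real.exp (c * n)) atTop (𝓝 0) :=
  Real.tendsto_exp_atBot.comp (tendsto_natCast_atTop_atTop.const_mul_atTop_of_neg hc)

/-! ### The pullback limit -/

section Pullback

variable {Ω : Type*} {ϑ : ℤ → Ω → Ω} {d : ℕ}
  {φ : ℝ≥0 → Ω → (TorusFn d →L[ℝ] TorusFn d)} {α β : ℝ} {ρ : EReal} {Ω₁ : Set Ω} {ω : Ω}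

/-- A regular set on which solutions started in the past approach each other at the rate `ρ`. -/
structure IsPullbackSet (ϑ : ℤ → Ω → Ω) (φ : ℝ≥0 → Ω → (TorusFn d →L[ℝ] TorusFn d)) (β : ℝ)
    (ρ : EReal) (Ω₁ : Set Ω) : Prop extends IsRegularSet ϑ φ β Ω₁ where
  neg : ρ < 0
  shift_zero : ∀ ω, ϑ 0 ω = ω
  shift_add : ∀ z z' ω, ϑ (z + z') ω = ϑ z (ϑ z' ω)
  start : ∀ ω f, φ 0 ω f = f
  cocycle : ∀ (t : ℝ≥0) (n : ℕ) ω f, φ (t + n) ω f = φ t (ϑ n ω) (φ n ω f)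
  approach : ∀ ω ∈ Ω₁, ∀ c : ℝ, ρ < c → ∀ᶠ n : ℕ in atTop, ∀ f g : TorusFn d, (∀ x, 0 < f x) →
    (∀ x, 0 < g x) → logDist (φ n (ϑ (-(n : ℤ)) ω) f) (φ n (ϑ (-(n : ℤ)) ω) g) ≤
      ENNReal.ofReal (Real.exp (c * n))

/-- The limit, modulo constants, of the solutions at time zero started in the past. -/
noncomputable def pullbackLimit (ϑ : ℤ → Ω → Ω) (φ : ℝ≥0 → Ω → (TorusFn d →L[ℝ] TorusFn d))
    (ω : Ω) : TorusFn d :=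
  limUnder atTop fun n : ℕ => normLog (φ n (ϑ (-(n : ℤ)) ω) (expFn 0))

namespace IsPullbackSet

theorem exists_rate (hS : IsPullbackSet ϑ φ β ρ Ω₁) : ∃ c : ℝ, ρ < c ∧ c < 0 := by
  obtain ⟨c, hc, hc0⟩ := EReal.exists_rat_btwn_of_lt hS.neg
  exact ⟨c, hc, by exact_mod_cast hc0⟩

theorem preservesPos (hS : IsPullbackSet ϑ φ β ρ Ω₁) (hω : ω ∈ Ω₁) (t : ℝ≥0) :
    PreservesPos (φ t ω) :=
  hS.toIsRegularSet.pos_of_nat hS.start hω t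

theorem logDist_le (hS : IsPullbackSet ϑ φ β ρ Ω₁) (hω : ω ∈ Ω₁) (t : ℝ≥0)
    {f g : TorusFn d} (hf : ∀ x, 0 < f x) (hg : ∀ x, 0 < g x) :
    logDist (φ t ω f) (φ t ω g) ≤ logDist f g := by
  rcases eq_or_ne t 0 with rfl | ht
  · rw [hS.start, hS.start]
  · have ht' := pos_iff_ne_zero.2 ht
    exact (logDist_le_projNorm_mul (hS.pos ω hω t ht') hf hg).trans
      (mul_le_of_le_one_left' (hS.contracting ω hω t ht').le)

/-- The solution at time `t` started at time `-n` factors through an intermediate time `-m`. -/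
theorem factor (hS : IsPullbackSet ϑ φ β ρ Ω₁) {t : ℝ} {m n : ℕ} (hmn : m ≤ n)
    (ht : 0 ≤ t + m) (f : TorusFn d) :
    φ (t + n).toNNReal (ϑ (-(n : ℤ)) ω) f =
      φ (t + m).toNNReal (ϑ (-(m : ℤ)) ω)
        (φ (n - m : ℕ) (ϑ (-((n - m : ℕ) : ℤ)) (ϑ (-(m : ℤ)) ω)) f) := by
  have h1 : (t + n).toNNReal = (t + m).toNNReal + (n - m : ℕ) := by
    rw [← Real.toNNReal_natCast (n - m), ← Real.toNNReal_add ht (Nat.cast_nonneg _),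
      Nat.cast_sub hmn]
    congr 1
    ring
  have h2 : -((n - m : ℕ) : ℤ) + -(m : ℤ) = -(n : ℤ) := by omega
  have h3 : ((n - m : ℕ) : ℤ) + -(n : ℤ) = -(m : ℤ) := by omega
  rw [← hS.shift_add, h2, h1, hS.cocycle, ← hS.shift_add, h3]

theorem factor_nat (hS : IsPullbackSet ϑ φ β ρ Ω₁) {m n : ℕ} (hmn : m ≤ n) (f : TorusFn d) :
    φ n (ϑ (-(n : ℤ)) ω) f = φ m (ϑ (-(m : ℤ)) ω)
      (φ (n - m : ℕ) (ϑ (-((n - m : ℕ) : ℤ)) (ϑ (-(m : ℤ)) ω)) f) := by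
  have := hS.factor (ω := ω) (t := 0) hmn (by positivity) f
  simpa using this

/-- A solution started at -n is also one started at -N with other data, so the estimate uniform in
the data gives the Cauchy property. -/
theorem tendsto_pullbackLimit (hS : IsPullbackSet ϑ φ β ρ Ω₁) (hω : ω ∈ Ω₁) :
    Tendsto (fun n : ℕ => normLog (φ n (ϑ (-(n : ℤ)) ω) (expFn 0))) atTop
      (𝓝 (pullbackLimit ϑ φ ω)) := by
  refine CauchySeq.tendsto_limUnder ?_
  rw [Metric.cauchySeq_iff']
  intro ε hε
  obtain ⟨c, hc, hc0⟩ := hS.exists_rate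
  obtain ⟨N, hN, hNε⟩ := ((hS.approach ω hω c hc).and
    ((tendsto_exp_mul_atTop_zero hc0).eventually_lt_const hε)).exists
  refine ⟨N, fun n hn => lt_of_le_of_lt ?_ hNε⟩
  have hΩ : ∀ z, ϑ z ω ∈ Ω₁ := fun z => hS.invariant z ω hω
  rw [dist_eq_norm]
  refine norm_normLog_sub_le (hS.preservesPos (hΩ _) _ _ (expFn_pos 0))
    (hS.preservesPos (hΩ _) _ _ (expFn_pos 0)) (Real.exp_pos _).le ?_
  rw [hS.factor_nat hn]
  exact hN _ _ (hS.preservesPos (hS.invariant _ _ (hΩ _)) _ _ (expFn_pos 0)) (expFn_pos 0)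

/-- Solutions started in the past approach the pullback limit, uniformly in the initial data. -/
theorem eventually_logDist_pullbackLimit_le (hS : IsPullbackSet ϑ φ β ρ Ω₁) (hω : ω ∈ Ω₁)
    {c : ℝ} (hc : ρ < c) :
    ∀ᶠ n : ℕ in atTop, ∀ f : TorusFn d, (∀ x, 0 < f x) →
      logDist (φ n (ϑ (-(n : ℤ)) ω) f) (expFn (pullbackLimit ϑ φ ω)) ≤
        ENNReal.ofReal (Real.exp (c * n)) := by
  have hΩ : ∀ z, ϑ z ω ∈ Ω₁ := fun z => hS.invariant z ω hω
  filter_upwards [hS.approach ω hω c hc] with n hn f hf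
  refine logDist_le_ofReal fun x y => ?_
  have hlim := hS.tendsto_pullbackLimit hω
  have hx := ((continuous_eval_const x).tendsto _).comp hlim
  have hy := ((continuous_eval_const y).tendsto _).comp hlim
  have hcross : Tendsto (fun k : ℕ => logCross (φ n (ϑ (-(n : ℤ)) ω) f)
      (expFn (normLog (φ k (ϑ (-(k : ℤ)) ω) (expFn 0)))) x y) atTop
      (𝓝 (logCross (φ n (ϑ (-(n : ℤ)) ω) f) (expFn (pullbackLimit ϑ φ ω)) x y)) := by
    simp only [logCross, log_expFn]
    exact tendsto_const_nhds.sub (hx.sub hy)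
  -- Earlier solutions, started at -k with k ≥ n, obey the bound already, being solutions started at
  -- -n; then k tends to infinity.
  refine le_of_tendsto hcross ?_
  filter_upwards [eventually_ge_atTop n] with k hk
  have hpos : ∀ x, 0 < φ k (ϑ (-(k : ℤ)) ω) (expFn 0) x :=
    hS.preservesPos (hΩ _) _ _ (expFn_pos 0)
  refine (ENNReal.ofReal_le_ofReal_iff (Real.exp_pos _).le).1
    ((ofReal_logCross_le _ _ x y).trans ?_)
  rw [logDist_expFn_normLog hpos, hS.factor_nat hk]
  exact hn _ _ hf (hS.preservesPos (hS.invariant _ _ (hΩ _)) _ _ (expFn_pos 0))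

/-- The pullback limit is invariant under the dynamics, modulo constants. -/
theorem logDist_pullbackLimit (hS : IsPullbackSet ϑ φ β ρ Ω₁) (hω : ω ∈ Ω₁) (k : ℕ) :
    logDist (φ k ω (expFn (pullbackLimit ϑ φ ω))) (expFn (pullbackLimit ϑ φ (ϑ k ω))) = 0 := by
  have hΩ : ∀ z, ϑ z ω ∈ Ω₁ := fun z => hS.invariant z ω hω
  obtain ⟨c, hc, hc0⟩ := hS.exists_rate
  have hlim : Tendsto (fun n : ℕ => ENNReal.ofReal (Real.exp (c * n)) +
      ENNReal.ofReal (Real.exp (c * (n + k : ℕ)))) atTop (𝓝 0) := by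
    have h1 := ENNReal.tendsto_ofReal (tendsto_exp_mul_atTop_zero hc0)
    have h2 := h1.comp (tendsto_add_atTop_nat k)
    simpa using h1.add h2
  refine le_antisymm (ge_of_tendsto hlim ?_) zero_le
  filter_upwards [hS.eventually_logDist_pullbackLimit_le hω hc, (tendsto_add_atTop_nat k).eventually
    (hS.eventually_logDist_pullbackLimit_le (hΩ k) hc)] with n hn hnk
  have hpos : ∀ x, 0 < φ n (ϑ (-(n : ℤ)) ω) (expFn 0) x :=
    hS.preservesPos (hΩ _) _ _ (expFn_pos 0)
  -- Both limits are compared with one solution started at -n: the limit at ω after the nonexpansive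
  -- φ_k, the limit at ϑ^k ω after n + k steps.
  refine (logDist_triangle _ (φ k ω (φ n (ϑ (-(n : ℤ)) ω) (expFn 0))) _).trans
    (add_le_add ?_ ?_)
  · refine (hS.logDist_le hω k (expFn_pos _) hpos).trans ?_
    rw [logDist_comm]
    exact hn _ (expFn_pos 0)
  · have h1 := hnk (expFn 0) (expFn_pos 0)
    rw [hS.factor_nat (Nat.le_add_left k n), Nat.add_sub_cancel, ← hS.shift_add (-(k : ℤ)),
      neg_add_cancel, hS.shift_zero] at h1
    exact h1

end IsPullbackSet

open Classical in
/-- The stationary solution modulo constants, normalized to vanish at the origin. -/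
noncomputable def pullbackSolution (ϑ : ℤ → Ω → Ω) (φ : ℝ≥0 → Ω → (TorusFn d →L[ℝ] TorusFn d))
    (Ω₁ : Set Ω) (ω : Ω) (t : ℝ) : TorusFn d :=
  if ω ∈ Ω₁ then
    -- The starting time -(⌈|t|⌉ + 1) is merely some integer before t; on `Ω₁` the value does not
    -- depend on it.
    normLog (φ (t + (⌈|t|⌉₊ + 1 : ℕ)).toNNReal (ϑ (-((⌈|t|⌉₊ + 1 : ℕ) : ℤ)) ω)
      (expFn (pullbackLimit ϑ φ (ϑ (-((⌈|t|⌉₊ + 1 : ℕ) : ℤ)) ω))))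
  else 0

namespace IsPullbackSet

/-- Invariance of the pullback limit modulo constants makes the starting time irrelevant; two
choices are compared with their maximum. This permits one starting time for a whole interval of t.
-/
theorem pullbackSolution_eq (hS : IsPullbackSet ϑ φ β ρ Ω₁) (hω : ω ∈ Ω₁) {t : ℝ} {m : ℕ}
    (hm : 0 ≤ t + m) :
    pullbackSolution ϑ φ Ω₁ ω t = normLog (φ (t + m).toNNReal (ϑ (-(m : ℤ)) ω)
      (expFn (pullbackLimit ϑ φ (ϑ (-(m : ℤ)) ω)))) := by
  have hΩ : ∀ z, ϑ z ω ∈ Ω₁ := fun z => hS.invariant z ω hω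
  have key : ∀ {m n : ℕ}, 0 ≤ t + m → m ≤ n →
      normLog (φ (t + m).toNNReal (ϑ (-(m : ℤ)) ω) (expFn (pullbackLimit ϑ φ (ϑ (-(m : ℤ)) ω)))) =
      normLog (φ (t + n).toNNReal (ϑ (-(n : ℤ)) ω)
        (expFn (pullbackLimit ϑ φ (ϑ (-(n : ℤ)) ω)))) := by
    intro m n hm hmn
    refine normLog_eq_of_logDist_eq_zero (hS.preservesPos (hΩ _) _ _ (expFn_pos _))
      (hS.preservesPos (hΩ _) _ _ (expFn_pos _)) ?_
    rw [hS.factor hmn hm]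
    have hsh : ϑ (-((n - m : ℕ) : ℤ)) (ϑ (-(m : ℤ)) ω) = ϑ (-(n : ℤ)) ω := by
      rw [← hS.shift_add]
      congr 1
      omega
    have hsh' : ϑ ((n - m : ℕ) : ℤ) (ϑ (-(n : ℤ)) ω) = ϑ (-(m : ℤ)) ω := by
      rw [← hS.shift_add]
      congr 1
      omega
    refine le_antisymm ((hS.logDist_le (hΩ _) _ (expFn_pos _) (hS.preservesPos (hsh ▸ hΩ _) _ _
      (expFn_pos _))).trans (le_of_eq ?_)) zero_le
    have := hS.logDist_pullbackLimit (hΩ (-(n : ℤ))) (n - m)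
    rw [hsh'] at this
    rw [hsh, logDist_comm, this]
  rw [pullbackSolution, if_pos hω]
  have hm' : 0 ≤ t + (⌈|t|⌉₊ + 1 : ℕ) := by
    push_cast
    linarith [Nat.le_ceil |t|, neg_abs_le t]
  rw [key hm' (le_max_left _ m), key hm (le_max_right (⌈|t|⌉₊ + 1) m)]

/-- It is the pointwise limit of the normalized solutions started in 0 at time -n, cut off by the
indicator of `Ω₁`. -/
theorem measurable_pullbackSolution [MeasurableSpace Ω] (hS : IsPullbackSet ϑ φ β ρ Ω₁)
    (hφ : IsContinuousRDS ϑ φ) (hϑ : ∀ z, Measurable (ϑ z)) (hΩ₁ : MeasurableSet Ω₁)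
    (t : ℝ) (x : Torus d) :
    Measurable fun ω => pullbackSolution ϑ φ Ω₁ ω t x := by
  have hmeas : ∀ (n : ℕ) (x : Torus d), Measurable fun ω =>
      Real.log (φ (t + n).toNNReal (ϑ (-(n : ℤ)) ω) (expFn 0) x) := fun n x =>
    ((hφ.measurable_eval _ _ x).comp (hϑ _)).log
  refine measurable_of_tendsto_metrizable (fun n : ℕ => ((hmeas n x).sub (hmeas n 0)).indicator hΩ₁)
    (tendsto_pi_nhds.2 fun ω => ?_)
  by_cases hω : ω ∈ Ω₁
  swap
  · simp only [indicator_of_notMem hω, pullbackSolution, if_neg hω]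
    exact tendsto_const_nhds
  have hΩ : ∀ z, ϑ z ω ∈ Ω₁ := fun z => hS.invariant z ω hω
  obtain ⟨m, hm⟩ : ∃ m : ℕ, 0 ≤ t + m := ⟨⌈|t|⌉₊, by linarith [Nat.le_ceil |t|, neg_abs_le t]⟩
  obtain ⟨c, hc, hc0⟩ := hS.exists_rate
  simp only [indicator_of_mem hω, hS.pullbackSolution_eq hω hm]
  rw [tendsto_iff_norm_sub_tendsto_zero]
  refine squeeze_zero' (Eventually.of_forall fun n => norm_nonneg _) ?_
    ((tendsto_exp_mul_atTop_zero hc0).comp (tendsto_sub_atTop_nat m))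
  filter_upwards [(tendsto_sub_atTop_nat m).eventually
    (hS.eventually_logDist_pullbackLimit_le (hΩ (-(m : ℤ))) hc), eventually_ge_atTop m]
    with n hn hmn
  have hpos := hS.preservesPos (hΩ (-(n : ℤ))) (t + n).toNNReal _ (expFn_pos 0)
  have hposm := hS.preservesPos (hΩ (-(m : ℤ))) (t + m).toNNReal _
    (expFn_pos (pullbackLimit ϑ φ (ϑ (-(m : ℤ)) ω)))
  have h1 := norm_normLog_sub_le hpos hposm (Real.exp_pos (c * (n - m : ℕ))).le (by
    rw [hS.factor hmn hm]
    exact (hS.logDist_le (hΩ _) _ (hS.preservesPos (hS.invariant _ _ (hΩ _)) _ _ (expFn_pos 0))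
      (expFn_pos _)).trans (hn _ (expFn_pos 0)))
  have h2 := (ContinuousMap.norm_coe_le_norm _ x).trans h1
  rw [ContinuousMap.sub_apply, normLog_apply hpos] at h2
  exact h2

/-- Bounds for the images of a strictly positive function on a compact time interval. -/
theorem exists_bounds (hS : IsPullbackSet ϑ φ β ρ Ω₁) (hω : ω ∈ Ω₁) {f : TorusFn d}
    (hf : ∀ x, 0 < f x) {S T : ℝ≥0} (h0 : 0 < S) (hST : S < T) : ∃ R : ℝ, 1 ≤ R ∧ ∀ t ∈ Icc S T,
      holderNorm β (periodicLift (φ t ω f)) ≤ ENNReal.ofReal R ∧ ∀ x, R⁻¹ ≤ φ t ω f x := by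
  obtain ⟨γ, hγ, hlow⟩ := hS.lower ω hω S T h0 hST
  obtain ⟨C, hC, hsm⟩ := hS.smoothing ω hω S T h0 hST
  have hI := integral_torus_pos hf
  set a := γ * ∫ y, f y ∂torusMeasure d with ha
  have ha0 : 0 < a := mul_pos hγ hI
  refine ⟨max 1 (max (C * ‖f‖) a⁻¹), le_max_left _ _, fun t ht => ⟨(hsm t ht f).trans
    (ENNReal.ofReal_le_ofReal ((le_max_left _ _).trans (le_max_right _ _))), fun x => ?_⟩⟩
  refine (inv_le_of_inv_le₀ ha0 ?_).trans (hlow t ht f hf x)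
  exact (le_max_right _ _).trans (le_max_right _ _)

end IsPullbackSet

theorem periodicLift_zero (f : Torus d → ℝ) : periodicLift f 0 = f 0 := by
  simp only [periodicLift]
  congr 1

theorem periodicLift_normLog {u : TorusFn d} (hu : ∀ x, 0 < u x) (y : EuclideanSpace ℝ (Fin d)) :
    periodicLift (normLog u) y =
      Real.log (periodicLift u y) - Real.log (periodicLift u 0) := by
  rw [periodicLift_zero]
  exact normLog_apply hu _

/-- The stationary solution is a continuous curve in `C^α`. -/
theorem IsPullbackSet.continuous_pullbackSolution (hS : IsPullbackSet ϑ φ β ρ Ω₁) (hα : 0 < α)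
    (hαβ : α < β) (hαm : ∀ m : ℕ, α ≠ m) (ω : Ω) (t : ℝ) :
    holderNorm α (periodicLift (pullbackSolution ϑ φ Ω₁ ω t)) < ⊤ ∧
      Tendsto (fun s => holderNorm α (periodicLift
        (pullbackSolution ϑ φ Ω₁ ω s - pullbackSolution ϑ φ Ω₁ ω t : TorusFn d))) (𝓝 t) (𝓝 0) := by
  have hθ := floor_frac_pos hα hαm
  by_cases hω : ω ∈ Ω₁
  swap
  · have hz : ∀ s, pullbackSolution ϑ φ Ω₁ ω s = 0 := fun s => by rw [pullbackSolution, if_neg hω]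
    have h0 : holderNorm α (periodicLift (0 : TorusFn d)) = 0 := by
      have : HolderBound (α - ⌊α⌋₊) ⌊α⌋₊ (periodicLift (0 : TorusFn d)) |0| := HolderBound.const 0
      have := this.holderNorm_le hθ rfl rfl
      simpa using this
    simp only [hz, sub_zero]
    simp only [h0]
    exact ⟨ENNReal.zero_lt_top, tendsto_const_nhds⟩
  have hΩ : ∀ z, ϑ z ω ∈ Ω₁ := fun z => hS.invariant z ω hω
  -- For |s - t| ≤ 1 the elapsed time s + m stays in [1, 2m], where the bounds are uniform.
  set m : ℕ := ⌈|t|⌉₊ + 2 with hm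
  have hmt : |t| + 2 ≤ m := by
    rw [hm]
    push_cast
    linarith [Nat.le_ceil |t|]
  set f : TorusFn d := expFn (pullbackLimit ϑ φ (ϑ (-(m : ℤ)) ω)) with hf
  set u : ℝ → TorusFn d := fun s => φ (s + m).toNNReal (ϑ (-(m : ℤ)) ω) f with hu
  have hupos : ∀ s x, 0 < u s x := fun s => hS.preservesPos (hΩ _) _ _ (expFn_pos _)
  obtain ⟨R, hR, hRb⟩ := hS.exists_bounds (hΩ (-(m : ℤ))) (expFn_pos _ : ∀ x, 0 < f x)
    (S := 1) (T := 2 * m) one_pos (by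
      have h2 : (2 : ℝ) ≤ m := by linarith [abs_nonneg t]
      have : (1 : ℝ) < 2 * m := by linarith
      exact_mod_cast this)
  have hs : ∀ s, |s - t| ≤ 1 → (s + m).toNNReal ∈ Icc (1 : ℝ≥0) (2 * m) := by
    intro s hs
    have h1 := abs_le.1 hs
    have h2 := neg_abs_le t
    have h3 := le_abs_self t
    constructor
    · rw [Real.one_le_toNNReal]
      linarith [h1.1]
    · rw [Real.toNNReal_le_iff_le_coe]
      push_cast
      linarith [h1.2]
  have hsol : ∀ s, |s - t| ≤ 1 → pullbackSolution ϑ φ Ω₁ ω s = normLog (u s) := fun s hs' =>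
    hS.pullbackSolution_eq hω (by
      linarith [(abs_le.1 hs').1, neg_abs_le t])
  have htt : |t - t| ≤ 1 := by simp
  constructor
  · obtain ⟨K, N, hK, hlog⟩ := exists_log_estimate d hα hαβ hαm
    have h1 := hRb _ (hs t htt)
    have hself : HolderBound (α - ⌊α⌋₊) ⌊α⌋₊ (periodicLift (u t) - periodicLift (u t)) 0 := by
      rw [sub_self]
      simpa using! HolderBound.const (d := d) (θ := α - ⌊α⌋₊) (m := ⌊α⌋₊) 0
    have h2 := (hlog (u t) (u t) R 0 hR le_rfl h1.1 h1.1 h1.2 h1.2 hself).1.sub_apply_zero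
    simp only [← periodicLift_normLog (hupos t)] at h2
    rw [hsol t htt]
    exact (h2.holderNorm_le hθ rfl rfl).trans_lt ENNReal.ofReal_lt_top
  · rw [ENNReal.tendsto_nhds_zero]
    intro ε hε
    -- The factor 2 comes from subtracting the value at the origin, the factor 3 from
    -- `HolderBound.holderNorm_le`.
    obtain ⟨δ, hδ, hδε⟩ : ∃ δ : ℝ, 0 < δ ∧ ENNReal.ofReal (3 * (2 * δ)) ≤ ε := by
      rcases eq_or_ne ε ⊤ with rfl | hε'
      · exact ⟨1, one_pos, le_top⟩
      · have := ENNReal.toReal_pos hε.ne' hε'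
        refine ⟨ε.toReal / 6, by positivity, ?_⟩
        rw [show 3 * (2 * (ε.toReal / 6)) = ε.toReal by ring, ENNReal.ofReal_toReal hε']
    obtain ⟨η, hη, hcont⟩ := exists_log_continuity d hα hαβ hαm hR hδ
    have hut : ContinuousAt u t := by
      have hpos : 0 < (t + m).toNNReal := one_pos.trans_le (hs t htt).1
      have h1 := (hS.continuousOn _ (hΩ (-(m : ℤ))) f).continuousAt (Ioi_mem_nhds hpos)
      have h2 : ContinuousAt (fun s : ℝ => (s + m).toNNReal) t := by fun_prop
      exact ContinuousAt.comp (f := fun s : ℝ => (s + m).toNNReal) h1 h2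
    have hball : ∀ᶠ s in 𝓝 t, |s - t| ≤ 1 := by
      filter_upwards [Metric.closedBall_mem_nhds t one_pos] with s hs
      simpa [Real.dist_eq] using hs
    filter_upwards [hball, hut.eventually (Metric.closedBall_mem_nhds _ hη)] with s hst hsη
    have h1 := hRb _ (hs t htt)
    have h2 := hRb _ (hs s hst)
    rw [dist_eq_norm] at hsη
    have h3 := (hcont (u s) (u t) h2.1 h1.1 h2.2 h1.2 hsη).sub_apply_zero
    rw [hsol t htt, hsol s hst]
    refine le_trans ?_ hδε
    refine HolderBound.holderNorm_le ?_ hθ rfl rfl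
    convert h3 using 1
    ext y
    change periodicLift (normLog (u s)) y - periodicLift (normLog (u t)) y = _
    rw [periodicLift_normLog (hupos _), periodicLift_normLog (hupos _)]
    ring

/-- Pullback convergence in `C^α` modulo constants. -/
theorem IsPullbackSet.exists_pullback_estimate (hS : IsPullbackSet ϑ φ β ρ Ω₁) (hα : 0 < α)
    (hαβ : α < β) (hαm : ∀ m : ℕ, α ≠ m) (hω : ω ∈ Ω₁) {T : ℝ} (hT : 0 < T) {c : ℝ} (hc : ρ < c)
    (hc0 : c < 0) : ∃ K : ℝ, ∀ᶠ n : ℕ in atTop, ∀ (h₀ : TorusFn d), ∀ t ∈ Icc (-T) T,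
      (∃ B, HolderBound (α - ⌊α⌋₊) ⌊α⌋₊
        (periodicLift (kpzSolution ϑ φ (-(n : ℤ)) h₀ ω t)) B) ∧
      (∃ B, HolderBound (α - ⌊α⌋₊) ⌊α⌋₊ (periodicLift (pullbackSolution ϑ φ Ω₁ ω t)) B) ∧
      HolderBound (α - ⌊α⌋₊) ⌊α⌋₊ (fun y => periodicLift (kpzSolution ϑ φ (-(n : ℤ)) h₀ ω t) y -
        periodicLift (pullbackSolution ϑ φ Ω₁ ω t) y -
        (kpzSolution ϑ φ (-(n : ℤ)) h₀ ω t 0 - pullbackSolution ϑ φ Ω₁ ω t 0))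
        (K * Real.exp (c * n)) := by
  obtain ⟨K, N, hK, himg⟩ := exists_log_image_estimate d hα hαβ hαm
  have hΩ : ∀ z, ϑ z ω ∈ Ω₁ := fun z => hS.invariant z ω hω
  -- The evolution from -m to t lasts between 1 and 2m for all |t| ≤ T and is independent of n, and
  -- so are the constants C and R.
  set m : ℕ := ⌈T⌉₊ + 1 with hm
  have hmT : T + 1 ≤ m := by
    rw [hm]
    push_cast
    linarith [Nat.le_ceil T]
  have h2m : (1 : ℝ≥0) < 2 * m := by
    have : (1 : ℝ) < 2 * m := by linarith
    exact_mod_cast this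
  set g : TorusFn d := pullbackLimit ϑ φ (ϑ (-(m : ℤ)) ω) with hg
  set l : ℝ := 2 * ‖g - 0‖ with hl
  have hl0 : 0 ≤ l := by positivity
  obtain ⟨R₁, hR₁, hRb⟩ := hS.exists_bounds (hΩ (-(m : ℤ))) (expFn_pos (0 : TorusFn d))
    (S := 1) (T := 2 * m) one_pos h2m
  obtain ⟨C, hC, hsm⟩ := hS.smoothing _ (hΩ (-(m : ℤ))) 1 (2 * m) one_pos h2m
  set R : ℝ := max (C * Real.exp (l + 1)) (R₁ * Real.exp (l + 1)) with hR
  have hexp : 1 ≤ Real.exp (l + 1) := Real.one_le_exp (by linarith)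
  have hR1 : 1 ≤ R := (one_le_mul_of_one_le_of_one_le hR₁ hexp).trans (le_max_right _ _)
  -- At time -m only n - m steps have passed, which costs exp(-cm); normalizing at the origin costs
  -- 2.
  refine ⟨2 * (K * R ^ N * Real.exp (-(c * m))), ?_⟩
  filter_upwards [(tendsto_sub_atTop_nat m).eventually
    (hS.eventually_logDist_pullbackLimit_le (hΩ (-(m : ℤ))) hc), eventually_ge_atTop m]
    with n hn hmn h₀ t ht
  have htm : 0 ≤ t + m := by linarith [ht.1]
  have hmem : (t + m).toNNReal ∈ Icc (1 : ℝ≥0) (2 * m) := by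
    constructor
    · rw [Real.one_le_toNNReal]
      linarith [ht.1]
    · rw [Real.toNNReal_le_iff_le_coe]
      push_cast
      linarith [ht.2]
  set A := φ (t + m).toNNReal (ϑ (-(m : ℤ)) ω) with hA
  set w₁ : TorusFn d := φ (n - m : ℕ) (ϑ (-((n - m : ℕ) : ℤ)) (ϑ (-(m : ℤ)) ω)) (expFn h₀) with hw₁
  have hkpz : kpzSolution ϑ φ (-(n : ℤ)) h₀ ω t = fun x => Real.log (A w₁ x) := by
    ext x
    rw [kpzSolution, Int.cast_neg, Int.cast_natCast, sub_neg_eq_add, hS.factor hmn htm]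
  have hApos : PreservesPos A := hS.preservesPos (hΩ _) _
  have hw₁pos : ∀ x, 0 < w₁ x :=
    hS.preservesPos (hS.invariant _ _ (hΩ _)) _ _ (expFn_pos _)
  have hD1 : Real.exp (c * (n - m : ℕ)) ≤ 1 :=
    Real.exp_le_one_iff.2 (mul_nonpos_of_nonpos_of_nonneg hc0.le (Nat.cast_nonneg _))
  obtain ⟨⟨B₁, hB₁⟩, ⟨B₂, hB₂⟩, c', hc'⟩ := himg A hApos C hC (hsm _ hmem) w₁ (expFn g) hw₁pos
    (expFn_pos g) (Real.exp (c * (n - m : ℕ))) l R (Real.exp_pos _).le hD1 hl0 hR1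
    (hn _ (expFn_pos h₀)) (logDist_expFn_le g 0) (le_max_left _ _) (fun x => by
      have h1 := (hRb _ hmem).2 x
      have h2 : R⁻¹ ≤ (R₁ * Real.exp (l + 1))⁻¹ :=
        inv_anti₀ (by positivity) (le_max_right _ _)
      refine h2.trans ?_
      rw [mul_inv, mul_comm, ← Real.exp_neg]
      exact mul_le_mul_of_nonneg_left h1 (Real.exp_pos _).le)
  have hAg : ∀ x, 0 < A (expFn g) x := hApos _ (expFn_pos g)
  have hsol := hS.pullbackSolution_eq hω htm
  rw [← hg, ← hA] at hsol
  rw [hkpz, hsol]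
  refine ⟨⟨B₁, hB₁⟩, ⟨2 * B₂, ?_⟩, ?_⟩
  · have h2 : HolderBound (α - ⌊α⌋₊) ⌊α⌋₊ (fun y => Real.log (periodicLift (A (expFn g)) y)) B₂ :=
      hB₂
    have h3 := h2.sub_apply_zero
    simp only [← periodicLift_normLog hAg] at h3
    exact h3
  · have h3 := hc'.sub_apply_zero
    have e0 : torusMk (0 : EuclideanSpace ℝ (Fin d)) = 0 := rfl
    have he : Real.exp (c * (n - m : ℕ)) = Real.exp (-(c * m)) * Real.exp (c * n) := by
      rw [← Real.exp_add, Nat.cast_sub hmn]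
      ring_nf
    rw [he] at h3
    convert h3 using 1
    · ext y
      have e1 : periodicLift (normLog (A (expFn g))) y =
        Real.log (A (expFn g) (torusMk y)) - Real.log (A (expFn g) 0) := normLog_apply hAg _
      rw [e0, e1, normLog_apply hAg]
      change Real.log (A w₁ (torusMk y)) - _ - _ = _
      ring
    · ring

/-- Synchronization of two solutions in `C^α` modulo constants. -/
theorem IsRegularSet.exists_forward_estimate (hS : IsRegularSet ϑ φ β Ω₁)
    (hshift : ∀ ω, ϑ 0 ω = ω) (h0 : ∀ ω f, φ 0 ω f = f)
    (hco : ∀ (t : ℝ≥0) (n : ℕ) ω f, φ (t + n) ω f = φ t (ϑ n ω) (φ n ω f)) (hα : 0 < α)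
    (hαβ : α < β) (hαm : ∀ m : ℕ, α ≠ m) (hω : ω ∈ Ω₁) {T : ℝ} {N : ℝ≥0} (hTN : T + 1 ≤ N)
    (hprod : ∀ c : ℝ, ρ < c → ∀ᶠ n : ℕ in atTop,
      ∏ k ∈ Finset.range n, projNorm (φ 1 (ϑ k ω)) ≤ ENNReal.ofReal (Real.exp (c * n)))
    (hgrowth : ∀ f : TorusFn d, (∀ x, 0 < f x) → ∀ ε : ℝ, 0 < ε → ∀ᶠ n : ℕ in atTop,
      logDist (φ n ω f) (expFn 0) ≤ ENNReal.ofReal (ε * n))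
    (hsm : ∀ ε : ℝ, 0 < ε → ∀ᶠ n : ℕ in atTop, ∀ t ∈ Icc 1 N, ∀ f : TorusFn d,
      holderNorm β (periodicLift (φ t (ϑ n ω) f)) ≤ ENNReal.ofReal (Real.exp (ε * n) * ‖f‖))
    (hlow : ∀ ε : ℝ, 0 < ε → ∀ᶠ n : ℕ in atTop, ∀ t ∈ Icc 1 N, ∀ x,
      Real.exp (-(ε * n)) ≤ φ t (ϑ n ω) (expFn 0) x)
    (h₁ h₂ : TorusFn d) {c : ℝ} (hc : ρ < c) (hc0 : c < 0) :
    ∃ K : ℝ, ∀ᶠ n : ℕ in atTop, ∀ t ∈ Icc (n : ℝ) (n + T),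
      (∃ B, HolderBound (α - ⌊α⌋₊) ⌊α⌋₊ (periodicLift (kpzSolution ϑ φ 0 h₁ ω t)) B) ∧
      (∃ B, HolderBound (α - ⌊α⌋₊) ⌊α⌋₊ (periodicLift (kpzSolution ϑ φ 0 h₂ ω t)) B) ∧
      ∃ c', HolderBound (α - ⌊α⌋₊) ⌊α⌋₊ (fun y => periodicLift (kpzSolution ϑ φ 0 h₁ ω t) y -
        periodicLift (kpzSolution ϑ φ 0 h₂ ω t) y - c') (K * Real.exp (c * n)) := by
  obtain ⟨K, p, hK, himg⟩ := exists_log_image_estimate d hα hαβ hαm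
  obtain ⟨c₁, hρc₁, hc₁⟩ := EReal.exists_rat_btwn_of_lt hc
  have hc₁c : (c₁ : ℝ) < c := by exact_mod_cast hc₁
  -- The regularity constant R = exp(2εk + 1) enters with power p, so the loss 2pεk has to stay
  -- below (c - c₁)k.
  set ε : ℝ := (c - c₁) / (2 * (p + 1)) with hε
  have hε0 : 0 < ε := div_pos (by linarith) (by positivity)
  have hεp : p * (2 * ε) ≤ c - c₁ := by
    rw [hε]
    have : (p : ℝ) * (2 * ((c - c₁) / (2 * (p + 1)))) = p / (p + 1) * (c - c₁) := by
      field_simp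
    rw [this]
    refine mul_le_of_le_one_left (by linarith) ?_
    rw [div_le_one (by positivity)]
    linarith
  set L : ℝ := (logDist (expFn h₁) (expFn h₂)).toReal with hL
  have hLtop := logDist_ne_top (expFn_pos h₁) (expFn_pos h₂)
  have hL0 : 0 ≤ L := ENNReal.toReal_nonneg
  have hsmall : ∀ᶠ k : ℕ in atTop, Real.exp (c₁ * k) * L < 1 := by
    have := (tendsto_exp_mul_atTop_zero (hc₁c.trans hc0)).mul_const L
    rw [zero_mul] at this
    exact this.eventually_lt_const one_pos
  refine ⟨K * Real.exp p * L * Real.exp (-c), ?_⟩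
  -- With n = k + 1 the last stretch t - k has length between 1 and T + 1. The factor exp(-c) of the
  -- constant compensates this shift.
  suffices H : ∀ᶠ k : ℕ in atTop, ∀ t ∈ Icc ((k + 1 : ℕ) : ℝ) ((k + 1 : ℕ) + T),
      (∃ B, HolderBound (α - ⌊α⌋₊) ⌊α⌋₊ (periodicLift (kpzSolution ϑ φ 0 h₁ ω t)) B) ∧
      (∃ B, HolderBound (α - ⌊α⌋₊) ⌊α⌋₊ (periodicLift (kpzSolution ϑ φ 0 h₂ ω t)) B) ∧
      ∃ c', HolderBound (α - ⌊α⌋₊) ⌊α⌋₊ (fun y => periodicLift (kpzSolution ϑ φ 0 h₁ ω t) y -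
        periodicLift (kpzSolution ϑ φ 0 h₂ ω t) y - c')
        (K * Real.exp p * L * Real.exp (-c) * Real.exp (c * (k + 1 : ℕ))) by
    obtain ⟨k₀, hk₀⟩ := eventually_atTop.1 H
    refine eventually_atTop.2 ⟨k₀ + 1, fun n hn => ?_⟩
    obtain ⟨k, rfl⟩ : ∃ k, n = k + 1 := ⟨n - 1, by omega⟩
    exact hk₀ k (by omega)
  filter_upwards [hprod c₁ hρc₁, hgrowth _ (expFn_pos h₂) ε hε0, hsm ε hε0, hlow ε hε0, hsmall]
    with k hkprod hkgrowth hksm hklow hksmall t ht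
  have hkk : (0 : ℝ) ≤ k := Nat.cast_nonneg k
  rw [Nat.cast_add, Nat.cast_one] at ht
  have hs0 : 0 ≤ t - k := by linarith [ht.1]
  have hmem : (t - k).toNNReal ∈ Icc 1 N := by
    constructor
    · rw [Real.one_le_toNNReal]
      linarith [ht.1]
    · rw [Real.toNNReal_le_iff_le_coe]
      linarith [ht.2]
  have ht' : (t - ((0 : ℤ) : ℝ)).toNNReal = (t - k).toNNReal + k := by
    rw [← Real.toNNReal_natCast k, ← Real.toNNReal_add hs0 hkk]
    simp
  have hkpz : ∀ h : TorusFn d, kpzSolution ϑ φ 0 h ω t = fun x =>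
      Real.log (φ (t - k).toNNReal (ϑ k ω) (φ k ω (expFn h)) x) := fun h => by
    ext x
    rw [kpzSolution, ht', hshift, hco]
  have hpos := hS.pos_of_nat h0 (hS.invariant k ω hω) (t - k).toNNReal
  have hposk := hS.pos_of_nat h0 hω k
  have hD : logDist (φ k ω (expFn h₁)) (φ k ω (expFn h₂)) ≤
      ENNReal.ofReal (Real.exp (c₁ * k) * L) := by
    refine (hS.logDist_le_prod h0 hco hω k (expFn_pos h₁) (expFn_pos h₂)).trans ?_
    rw [ENNReal.ofReal_mul (Real.exp_pos _).le, hL, ENNReal.ofReal_toReal hLtop]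
    gcongr
  set R : ℝ := Real.exp (2 * ε * k + 1) with hR
  have hεk : 0 ≤ ε * k := by positivity
  have hR1 : 1 ≤ R := Real.one_le_exp (by nlinarith)
  obtain ⟨hB₁, hB₂, c', hc'⟩ := himg (φ (t - k).toNNReal (ϑ k ω)) hpos (Real.exp (ε * k))
    (Real.exp_pos _).le (hksm _ hmem) (φ k ω (expFn h₁)) (φ k ω (expFn h₂))
    (hposk _ (expFn_pos h₁)) (hposk _ (expFn_pos h₂)) (Real.exp (c₁ * k) * L) (ε * k) R
    (by positivity) hksmall.le hεk hR1 hD hkgrowth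
    (by
      rw [hR, ← Real.exp_add]
      refine Real.exp_le_exp.2 (le_of_eq ?_)
      ring)
    (fun x => by
      refine le_trans (le_of_eq ?_)
        (mul_le_mul_of_nonneg_left (hklow _ hmem x) (Real.exp_pos _).le)
      rw [hR, ← Real.exp_neg, ← Real.exp_add]
      congr 1
      ring)
  rw [hkpz, hkpz]
  refine ⟨hB₁, hB₂, c', HolderBound.mono hc' ?_⟩
  have h3 : R ^ p * Real.exp (c₁ * k) ≤
      Real.exp p * Real.exp (-c) * Real.exp (c * (k + 1 : ℕ)) := by
    rw [hR, ← Real.exp_nat_mul, ← Real.exp_add, ← Real.exp_add, ← Real.exp_add, Real.exp_le_exp]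
    push_cast
    have h4 : p * (2 * ε) * k ≤ (c - c₁) * k := mul_le_mul_of_nonneg_right hεp hkk
    linarith
  calc K * R ^ p * (Real.exp (c₁ * k) * L) = K * L * (R ^ p * Real.exp (c₁ * k)) := by ring
    _ ≤ K * L * (Real.exp p * Real.exp (-c) * Real.exp (c * (k + 1 : ℕ))) := by gcongr
    _ = _ := by ring

end Pullback

/-! ### The main theorem -/

section Main

variable {Ω : Type*} {ϑ : ℤ → Ω → Ω} {d : ℕ}
  {φ : ℝ≥0 → Ω → (TorusFn d →L[ℝ] TorusFn d)} {α β : ℝ} {Ω₀ : Set Ω}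

theorem IsRegularSet.restrict {Ω₁ : Set Ω} (hreg : IsRegularSet ϑ φ β Ω₀) (hsub : Ω₁ ⊆ Ω₀)
    (hinv : ∀ z, ϑ z '' Ω₁ = Ω₁) : IsRegularSet ϑ φ β Ω₁ where
  invariant z ω hω := by
    rw [← hinv z]
    exact mem_image_of_mem _ hω
  pos ω hω := hreg.pos ω (hsub hω)
  continuousOn ω hω := hreg.continuousOn ω (hsub hω)
  lower ω hω := hreg.lower ω (hsub hω)
  smoothing ω hω := hreg.smoothing ω (hsub hω)
  diam ω hω := hreg.diam ω (hsub hω)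
  contracting ω hω := hreg.contracting ω (hsub hω)

variable [MeasurableSpace Ω] {P : Measure Ω} [IsProbabilityMeasure P]

/-- Smoothing constants with a logarithmic moment grow subexponentially along orbits. -/
theorem ae_eventually_le_exp (hϑ : IsErgodicIDS P ϑ) {C : Ω → ℝ} (hC : AEMeasurable C P)
    (hlog : ∫⁻ ω, ENNReal.ofReal (Real.log (C ω)) ∂P < ⊤) :
    ∀ᵐ ω ∂P, ∀ ε : ℝ, 0 < ε → ∀ᶠ n : ℕ in atTop, C (ϑ n ω) ≤ Real.exp (ε * n) := by
  have hInt := integrable_toReal_of_lintegral_ne_top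
    (Real.measurable_log.comp_aemeasurable hC).ennreal_ofReal hlog.ne
  filter_upwards [ae_forall_eventually_iterate_le hϑ.ergodic hInt] with ω hω ε hε
  filter_upwards [hω ε hε] with n hn
  rw [hϑ.iterate_one] at hn
  -- The inequality x ≤ exp(log x) holds for every real x, so no sign of C is needed.
  refine (Real.le_exp_log _).trans (Real.exp_le_exp.2 (le_trans ?_ hn))
  rw [Function.comp_apply, ENNReal.toReal_ofReal']
  exact le_max_left _ _

theorem IsRegularSet.ae_eventually_lower (hreg : IsRegularSet ϑ φ β Ω₀) (hP : P Ω₀ᶜ = 0)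
    (hϑ : IsErgodicIDS P ϑ) (hφ : IsContinuousRDS ϑ φ) (hmom : HasKPZMoments P ϑ φ) {N : ℝ≥0}
    (hN : 1 < N) : ∀ᵐ ω ∂P, ∀ ε : ℝ, 0 < ε → ∀ᶠ n : ℕ in atTop, ∀ t ∈ Icc 1 N, ∀ x,
      Real.exp (-(ε * n)) ≤ φ t (ϑ n ω) (expFn 0) x := by
  obtain ⟨Y, hY, hYb⟩ := hreg.exists_envelope hP hϑ.zero hφ hmom hN
  have hall : ∀ᵐ ω ∂P, ∀ n : ℕ, ∀ t ∈ Icc 1 N, ∀ x,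
      |Real.log (φ t (ϑ n ω) (expFn 0) x)| ≤ Y (ϑ n ω) := ae_all_iff.2 fun n =>
    (hϑ.measurePreserving n).quasiMeasurePreserving.ae hYb
  filter_upwards [hall, ae_forall_eventually_iterate_le hϑ.ergodic hY,
    measure_eq_zero_iff_ae_notMem.1 hP] with ω hω hit hω₀ ε hε
  filter_upwards [hit ε hε] with n hn t ht x
  rw [hϑ.iterate_one] at hn
  have hpos := hreg.pos _ (hreg.invariant n ω (not_not.1 hω₀)) t (one_pos.trans_le ht.1) _
    (expFn_pos 0) x
  rw [← Real.le_log_iff_exp_le hpos]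
  linarith [(abs_le.1 (hω n t ht x)).1]

theorem IsRegularSet.ae_eventually_logDist_one_le (hreg : IsRegularSet ϑ φ β Ω₀)
    (hP : P Ω₀ᶜ = 0) (hϑ : IsErgodicIDS P ϑ) (hφ : IsContinuousRDS ϑ φ)
    (hmom : HasKPZMoments P ϑ φ) : ∀ᵐ ω ∂P, ∀ f : TorusFn d, (∀ x, 0 < f x) → ∀ ε : ℝ, 0 < ε →
      ∀ᶠ n : ℕ in atTop, logDist (φ n ω f) (expFn 0) ≤ ENNReal.ofReal (ε * n) := by
  have hP' : ∀ᵐ ω ∂P, ω ∈ Ω₀ := hP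
  obtain ⟨Y, hY, hYb⟩ := hreg.exists_envelope hP hϑ.zero hφ hmom (one_lt_two : (1 : ℝ≥0) < 2)
  have hY1 : ∀ᵐ ω ∂P, ∀ x, |Real.log (φ 1 ω (expFn 0) x)| ≤ Y ω :=
    hYb.mono fun ω hω => hω 1 ⟨le_rfl, one_le_two⟩
  have hall : ∀ᵐ ω ∂P, ∀ (n : ℕ) x, |Real.log (φ 1 (ϑ n ω) (expFn 0) x)| ≤ Y (ϑ n ω) :=
    ae_all_iff.2 fun n => (hϑ.measurePreserving n).quasiMeasurePreserving.ae hY1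
  filter_upwards [hP', hall, ae_forall_eventually_birkhoffSum_sub_le hϑ.ergodic hY
    (hY1.mono fun ω hω => (abs_nonneg _).trans (hω 0)), hreg.ae_exists_visit hP' hφ hϑ.ergodic]
    with ω hω hYω hsum hvisit f hf ε hε
  exact hreg.eventually_logDist_one_le hϑ hφ hω hYω hsum hvisit hf hε

/-- It lets continuity of a periodic lift descend to the torus. -/
theorem isOpenQuotientMap_torusMk : IsOpenQuotientMap (torusMk (d := d)) := by
  have h : IsOpenQuotientMap (Pi.map fun (_ : Fin d) (x : ℝ) => (x : UnitAddCircle)) :=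
    IsOpenQuotientMap.piMap fun _ => QuotientAddGroup.isOpenQuotientMap_mk
  exact h.comp (PiLp.homeomorph 2 fun _ : Fin d => ℝ).isOpenQuotientMap

theorem exists_gradDist_le_of_holderBound {χ ϱ : EuclideanSpace ℝ (Fin d) → ℝ}
    (h : IsDyadicPartition χ ϱ) (hα : 0 < α) (hαm : ∀ m : ℕ, α ≠ m) :
    ∃ K : ℝ, 0 ≤ K ∧ ∀ (f g : Torus d → ℝ) (M c : ℝ),
      (∃ A, HolderBound (α - ⌊α⌋₊) ⌊α⌋₊ (periodicLift f) A) →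
      (∃ B, HolderBound (α - ⌊α⌋₊) ⌊α⌋₊ (periodicLift g) B) →
      HolderBound (α - ⌊α⌋₊) ⌊α⌋₊ (fun y => periodicLift f y - periodicLift g y - c) M →
      gradDist χ ϱ α f g ≤ ENNReal.ofReal (K * M) := by
  have hθ := floor_frac_pos hα hαm
  obtain ⟨K, hK, hgrad⟩ := exists_gradDist_le h hα hαm
  refine ⟨K, hK, fun f g M c ⟨A, hA⟩ ⟨B, hB⟩ hfg => ?_⟩
  exact hgrad M c ⟨f, isOpenQuotientMap_torusMk.continuous_comp_iff.1 (hA.continuous hθ)⟩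
    ⟨g, isOpenQuotientMap_torusMk.continuous_comp_iff.1 (hB.continuous hθ)⟩ A B hA hB hfg

end Main

theorem mainTheorem5 {Ω : Type*} [MeasurableSpace Ω] (P : Measure Ω) [IsProbabilityMeasure P]
    (ϑ : ℤ → Ω → Ω) (hϑ : IsErgodicIDS P ϑ) (d : ℕ) (hd : 1 ≤ d) (β : ℝ) (hβ : 0 < β)
    (φ : ℝ≥0 → Ω → (TorusFn d →L[ℝ] TorusFn d)) (hφ : IsContinuousRDS ϑ φ)
    (hreg : RegularizingAssumption P ϑ φ β) :
    contractionRate P φ < 0 ∧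
    ∃ (Ω₁ : Set Ω) (hinf : Ω → ℝ → TorusFn d),
      MeasurableSet Ω₁ ∧ (∀ z, ϑ z '' Ω₁ = Ω₁) ∧ P Ω₁ = 1 ∧
      (∀ t x, Measurable fun ω => hinf ω t x) ∧
      ∀ α : ℝ, 0 < α → α < β → (∀ m : ℕ, α ≠ m) →
        -- `hinf ω` is a continuous curve in `C^α`
        (∀ ω t, holderNorm α (periodicLift (hinf ω t)) < ⊤ ∧
          Tendsto (fun s => holderNorm α (periodicLift (hinf ω s - hinf ω t : TorusFn d)))
            (𝓝 t) (𝓝 0)) ∧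
        ∀ T : ℝ, 0 < T → ∀ ω ∈ Ω₁,
          -- `hinf` is the pullback limit of the solutions modulo constants
          (∃ c : ℕ → ℝ → TorusFn d → ℝ,
            exponentialRate (fun n => ⨆ (h₀ : TorusFn d) (t ∈ Icc (max (-T) (-(n : ℝ))) T),
              holderNorm α (periodicLift fun x =>
                kpzSolution ϑ φ (-(n : ℤ)) h₀ ω t x - hinf ω t x - c n t h₀))
              ≤ contractionRate P φ) ∧
          ∀ χ ϱ : EuclideanSpace ℝ (Fin d) → ℝ, IsDyadicPartition χ ϱ →
            -- synchronization of the gradients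
            (HasKPZMoments P ϑ φ → ∀ h₁ h₂ : TorusFn d,
              exponentialRate (fun n => ⨆ t ∈ Icc (n : ℝ) (n + T),
                gradDist χ ϱ α (kpzSolution ϑ φ 0 h₁ ω t) (kpzSolution ϑ φ 0 h₂ ω t))
                ≤ contractionRate P φ) ∧
            -- pullback convergence of the gradients, uniformly in the initial data
            exponentialRate (fun n => ⨆ (h₀ : TorusFn d) (t ∈ Icc (max (-T) (-(n : ℝ))) T),
              gradDist χ ϱ α (kpzSolution ϑ φ (-(n : ℤ)) h₀ ω t) (hinf ω t))
              ≤ contractionRate P φ := by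
  obtain ⟨Ω₀, K, C, hinv, hP, hK, hbd, hsm, hmoment⟩ := hreg
  have hreg : IsRegularSet ϑ φ β Ω₀ := isRegularSet_of_kernel hinv hK hbd hsm
  have hP' : ∀ᵐ ω ∂P, ω ∈ Ω₀ := hP
  have hρ : contractionRate P φ < 0 := hreg.contractionRate_neg hP' hφ
  refine ⟨hρ, ?_⟩
  set ρ := contractionRate P φ with hρdef
  -- Countably many windows [1, N + 2] suffice, so a single null set works for all T.
  have hN : ∀ N : ℕ, (1 : ℝ≥0) < (N + 2 : ℕ) := fun N => by exact_mod_cast (by omega : 1 < N + 2)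
  -- The step that ends at time 0 is φ_1 at ϑ⁻¹ω, so the backward statements are needed at that
  -- point.
  have hback := (hϑ.measurePreserving (-1)).quasiMeasurePreserving
  have hprodb := hback.ae (hreg.ae_eventually_prod_projNorm_le hP' hφ hϑ.ergodic_neg_one
    (hreg.invariant (-1)))
  have hvisitb := hback.ae (hreg.ae_exists_visit hP' hφ hϑ.ergodic_neg_one)
  have hprodf := hreg.ae_eventually_prod_projNorm_le hP' hφ hϑ.ergodic (hreg.invariant 1)
  have hCf : ∀ᵐ ω ∂P, ∀ N : ℕ, ∀ ε : ℝ, 0 < ε → ∀ᶠ n : ℕ in atTop,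
      C (ϑ n ω) 1 (N + 2 : ℕ) ≤ Real.exp (ε * n) := ae_all_iff.2 fun N =>
    ae_eventually_le_exp hϑ (hmoment 1 _ one_pos (hN N)).1 (hmoment 1 _ one_pos (hN N)).2.1
  have hmomf : ∀ᵐ ω ∂P, HasKPZMoments P ϑ φ →
      (∀ f : TorusFn d, (∀ x, 0 < f x) → ∀ ε : ℝ, 0 < ε →
        ∀ᶠ n : ℕ in atTop, logDist (φ n ω f) (expFn 0) ≤ ENNReal.ofReal (ε * n)) ∧
      ∀ N : ℕ, ∀ ε : ℝ, 0 < ε → ∀ᶠ n : ℕ in atTop, ∀ t ∈ Icc 1 ((N + 2 : ℕ) : ℝ≥0), ∀ x,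
        Real.exp (-(ε * n)) ≤ φ t (ϑ n ω) (expFn 0) x := by
    -- The moment assumption does not involve ω, so one set `Ω₁` can be chosen before knowing
    -- whether it holds.
    rw [eventually_imp_distrib_left]
    exact fun hmom => (hreg.ae_eventually_logDist_one_le hP hϑ hφ hmom).and
      (ae_all_iff.2 fun N => hreg.ae_eventually_lower hP hϑ hφ hmom (hN N))
  obtain ⟨Ω₁, hΩ₁m, hΩ₁inv, hΩ₁P, hΩ₁⟩ := hϑ.exists_invariant
    (hP'.and (hprodb.and (hvisitb.and (hprodf.and (hCf.and hmomf)))))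
  have hS : IsPullbackSet ϑ φ β ρ Ω₁ :=
    { hreg.restrict (fun ω hω => (hΩ₁ ω hω).1) hΩ₁inv with
      neg := hρ
      shift_zero := hϑ.zero
      shift_add := hϑ.add
      start := hφ.zero
      cocycle := hφ.cocycle
      approach := fun ω hω c hc => hreg.eventually_pullback_logDist_le hϑ hφ (hΩ₁ ω hω).1 hρ
        (hΩ₁ ω hω).2.1 (hΩ₁ ω hω).2.2.1 hc }
  refine ⟨Ω₁, pullbackSolution ϑ φ Ω₁, hΩ₁m, hΩ₁inv, hΩ₁P,
    hS.measurable_pullbackSolution hφ (fun z => (hϑ.measurePreserving z).measurable) hΩ₁m,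
    fun α hα hαβ hαm => ⟨hS.continuous_pullbackSolution hα hαβ hαm, fun T hT ω hω => ⟨?_, ?_⟩⟩⟩
  · refine ⟨fun n t h₀ => kpzSolution ϑ φ (-(n : ℤ)) h₀ ω t 0 - pullbackSolution ϑ φ Ω₁ ω t 0,
      exponentialRate_le hρ fun c hc hc0 => ?_⟩
    obtain ⟨K, hK⟩ := hS.exists_pullback_estimate hα hαβ hαm hω hT hc hc0
    refine ⟨3 * K, hK.mono fun n hn => iSup_le fun h₀ => iSup₂_le fun t ht => ?_⟩
    have h1 := (hn h₀ t ⟨(le_max_left _ _).trans ht.1, ht.2⟩).2.2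
    rw [mul_assoc]
    exact h1.holderNorm_le (floor_frac_pos hα hαm) rfl rfl
  · intro χ ϱ hχ
    obtain ⟨L, hL, hgrad⟩ := exists_gradDist_le_of_holderBound hχ hα hαm
    obtain ⟨-, -, -, hprod, hCω, hmomω⟩ := hΩ₁ ω hω
    constructor
    · intro hmom h₁ h₂
      obtain ⟨hgrowth, hlow⟩ := hmomω hmom
      set N := ⌈T⌉₊ with hNdef
      refine exponentialRate_le hρ fun c hc hc0 => ?_
      obtain ⟨K, hK⟩ := hreg.exists_forward_estimate hϑ.zero hφ.zero hφ.cocycle hα hαβ hαm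
        (hΩ₁ ω hω).1 (T := T) (N := ((N + 2 : ℕ) : ℝ≥0))
        (by push_cast; linarith [Nat.le_ceil T])
        (fun c hc => by simpa only [hϑ.iterate_one] using hprod c hc) hgrowth
        (fun ε hε => by
          filter_upwards [hCω N ε hε] with n hn t ht f
          refine (hsm _ (hreg.invariant n ω (hΩ₁ ω hω).1) 1 _ one_pos (hN N) t ht f).trans ?_
          gcongr)
        (hlow N) h₁ h₂ hc hc0
      refine ⟨L * K, hK.mono fun n hn => iSup₂_le fun t ht => ?_⟩
      obtain ⟨hA, hB, c', hc'⟩ := hn t ht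
      rw [mul_assoc]
      exact hgrad _ _ _ c' hA hB hc'
    · refine exponentialRate_le hρ fun c hc hc0 => ?_
      obtain ⟨K, hK⟩ := hS.exists_pullback_estimate hα hαβ hαm hω hT hc hc0
      refine ⟨L * K, hK.mono fun n hn => iSup_le fun h₀ => iSup₂_le fun t ht => ?_⟩
      obtain ⟨hA, hB, hc'⟩ := hn h₀ t ⟨(le_max_left _ _).trans ht.1, ht.2⟩
      rw [mul_assoc]
      exact hgrad _ _ _ _ hA hB hc'
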